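/- \textbf{Setting.} Let $N\ge 1$. For $k=1,\dots,N$ let $(X_k,R_k)$ be a metric space with a Borel measure $\mu_k$ that is positive and finite on balls and doubling: $\mu_k(B(x,2r))\le C\mu_k(B(x,r))$ for all $x\in X_k$, $r>0$. Let $\Delta_k$ be a non-positive self-adjoint operator on $L^2(\mu_k)$, and write $E_k$ for the spectral resolution of $-\Delta_k$. Assume that, for $\operatorname{Re}z>0$, the heat operator $e^{z\Delta_k}=\int_{(0,\infty)}e^{-z\lambda}\,dE_k(\lambda)$ (taken off the zero eigenspace, if there is one) is given by integration against a jointly measurable kernel $h^{(k)}_z(x,y)$ which for each $x,y$ is holomorphic in $z$ on $\{\operatorname{Re}z>0\}$, is real-valued for $z=t>0$ (in particular it may be positive), and satisfies, with constants $d_k,\gamma_k,c_1,c_2>0$, $$|h^{(k)}_t(x,y)|\le c_1t^{-d_k/(d_k+1)}\exp\Bigl(-c_2\Bigl(\tfrac{R_k(x,y)^{d_k+1}}{t}\Bigr)^{\gamma_k}\Bigr)\qquad(t>0,\ x,y\in X_k).$$ Let $X=X_1\times\dots\times X_N$, $\mu=\mu_1\times\dots\times\mu_N$, and let $E$ be the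 joint spectral resolution of $(-\Delta_1,\dots,-\Delta_N)$ on $L^2(\mu)$, that is $E(s_1\times\dots\times s_N)(u_1\otimes\dots\otimes u_N)=E_1(s_1)u_1\otimes\dots\otimes E_N(s_N)u_N$. For bounded measurable $p$ on $(0,\infty)^N$ put $p(-\Delta)=p(-\Delta_1,\dots,-\Delta_N)=\int_{(0,\infty)^N}p\,dE$. Call $(x,y)\in X\times X$ \emph{off the diagonal} if $x_k\ne y_k$ for every $k$. For an open set $U\subset X_i$ we say that $f$ is locally in the domain of $\Delta_i$ on $U$ with $\Delta_if=g$ if $(f,g)$ is the limit in $L^2_{loc}(U)\times L^2_{loc}(U)$ of elements of the graph of $\Delta_i$. \textbf{Theorem.} Let $p:(0,\infty)^N\to\mathbb{C}$ be smooth and such that for every $\alpha\in\mathbb{N}^N$ there is $C_\alpha$ with $$\lambda^\alpha\left|\frac{\partial^\alpha}{\partial\lambda^\alpha}p(\lambda)\right|\le C_\alpha\qquad(\lambda\in(0,\infty)^N).$$ Then $p(-\Delta)$ exists as a bounded operator on $L^2(\mu)$, and there is a measurable function $K_p$ on $X\times X$ such that: (1) $p(-\Delta)$ is given off the diagonal by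 integration with respect to $K_p$: for $u\in L^1(\mu)\cap L^2(\mu)$ one has $p(-\Delta)u(x)=\int K_p(x,y)u(y)\,d\mu(y)$, absolutely convergent, for almost every $x$ for which there is $\varepsilon>0$ with $R_k(x_k,y_k)\ge\varepsilon$ for all $k$ and almost all $y$ with $u(y)\neq0$; (2) there is a constant $C$ with $|K_p(x,y)|\le C\prod_{k=1}^NR_k(x_k,y_k)^{-d_k}$ for all $(x,y)$ off the diagonal; (3) $K_p$ is smooth off the diagonal: all iterated Laplacians $\Delta_{x,1}^{a_1}\cdots\Delta_{x,N}^{a_N}\Delta_{y,1}^{b_1}\cdots\Delta_{y,N}^{b_N}K_p$ ($a,b\in\mathbb{N}^N$) exist there as measurable functions, each of them being, in each single variable $x_i$ (on $\{x_i\ne y_i\}$) or $y_j$ (on $\{y_j\neq x_j\}$) with the other variables fixed off the diagonal, locally in the domain of $\Delta_i$ (resp. $\Delta_j$), with the next function as its Laplacian; and they can be chosen so that for all $i,j\in\{1,\dots,N\}$ and all integers $\beta_1,\beta_2\ge0$ there is a constant $C$ with $$\left|\Delta_{x,i}^{\beta_1}\Delta_{y,j}^{\beta_2}K_p(x,y)\right|\le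 C\,R_i(x_i,y_i)^{-\beta_1(d_i+1)}R_j(x_j,y_j)^{-\beta_2(d_j+1)}\prod_{k=1}^NR_k(x_k,y_k)^{-d_k}$$ for all $(x,y)$ off the diagonal. -/

import Mathlib

open MeasureTheory Filter Set
open scoped Topology ENNReal NNReal ContDiff

noncomputable section

/-! ### Projection-valued measures and spectral integrals -/

/-- A projection-valued measure on the measurable space `Ω`, acting on the Hilbert space `H`. -/
structure ProjectionValuedMeasure (Ω : Type*) [MeasurableSpace Ω]
    (H : Type*) [NormedAddCommGroup H] [InnerProductSpace ℂ H] where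
  proj : Set Ω → H →L[ℂ] H
  symm : ∀ s, MeasurableSet s → ∀ u v : H, inner ℂ (proj s u) v = inner ℂ u (proj s v)
  inter : ∀ s t, MeasurableSet s → MeasurableSet t → proj (s ∩ t) = proj s * proj t
  univ : proj Set.univ = 1
  iUnion : ∀ s : ℕ → Set Ω, (∀ n, MeasurableSet (s n)) → Pairwise (Function.onFun Disjoint s) →
    ∀ u : H, HasSum (fun n => proj (s n) u) (proj (⋃ n, s n) u)

namespace ProjectionValuedMeasure

variable {Ω : Type*} [MeasurableSpace Ω] {H : Type*} [NormedAddCommGroup H]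
  [InnerProductSpace ℂ H]

theorem proj_empty (E : ProjectionValuedMeasure Ω H) (u : H) : E.proj ∅ u = 0 := by
  have h := (E.iUnion (fun _ => ∅) (fun _ => MeasurableSet.empty)
    (fun _ _ _ => disjoint_bot_left) u).summable
  exact tendsto_nhds_unique tendsto_const_nhds h.tendsto_atTop_zero

theorem inner_proj (E : ProjectionValuedMeasure Ω H) {s : Set Ω} (hs : MeasurableSet s) (u : H) :
    inner ℂ u (E.proj s u) = ((‖E.proj s u‖ ^ 2 : ℝ) : ℂ) := by
  have h : E.proj s u = E.proj s (E.proj s u) := by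
    have h1 := E.inter s s hs hs
    rw [Set.inter_self] at h1
    exact congrArg (fun T : H →L[ℂ] H => T u) h1
  rw [h, ← E.symm s hs, ← h, inner_self_eq_norm_sq_to_K]
  norm_cast

/-- The finite positive measure `s ↦ ‖E(s) u‖² = ⟨u, E(s) u⟩`. -/
def scalarMeasure (E : ProjectionValuedMeasure Ω H) (u : H) : Measure Ω :=
  Measure.ofMeasurable (fun s _ => ENNReal.ofReal (‖E.proj s u‖ ^ 2))
    (by simp [proj_empty])
    (by
      intro s hs hd
      have h1 := (E.iUnion s hs hd u).mapL (innerSL ℂ u)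
      simp only [innerSL_apply_apply] at h1
      rw [E.inner_proj (MeasurableSet.iUnion hs)] at h1
      have h2 : HasSum (fun n => ((‖E.proj (s n) u‖ ^ 2 : ℝ) : ℂ))
          ((‖E.proj (⋃ n, s n) u‖ ^ 2 : ℝ) : ℂ) := by
        refine h1.congr_fun ?_
        intro n
        exact (E.inner_proj (hs n) u).symm
      have h3 := Complex.hasSum_ofReal.mp h2
      rw [← h3.tsum_eq, ENNReal.ofReal_tsum_of_nonneg (fun n => by positivity) h3.summable])

/-- `T = ∫_A f dE`, for `f` bounded and measurable on `A`: the bounded operator `T` is determined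
by its quadratic form `⟨u, T u⟩ = ∫_A f(λ) d⟨u, E(λ) u⟩`. -/
def IsIntegralOn (E : ProjectionValuedMeasure Ω H) (A : Set Ω) (f : Ω → ℂ) (T : H →L[ℂ] H) :
    Prop :=
  ∀ u : H, inner ℂ u (T u) = ∫ l in A, f l ∂(E.scalarMeasure u)

/-- `E` is the spectral resolution of the self-adjoint operator `A`, i.e. `A = ∫ λ dE(λ)`, with
domain the vectors `u` for which `∫ λ² d⟨u, E(λ) u⟩` is finite. -/
def IsSpectralResolution (E : ProjectionValuedMeasure ℝ H) (A : H →ₗ.[ℂ] H) : Prop :=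
  (∀ u : H, u ∈ A.domain ↔ Integrable (fun l : ℝ => l ^ 2) (E.scalarMeasure u)) ∧
  ∀ u : A.domain, inner ℂ (u : H) (A u) = ((∫ l, l ∂(E.scalarMeasure (u : H)) : ℝ) : ℂ)

end ProjectionValuedMeasure

/-! ### Metric measure spaces with a Laplacian -/

section OneSpace

variable {X : Type*} [MetricSpace X] [MeasurableSpace X]

/-- The doubling condition, for a measure for which balls have positive finite measure. -/
def IsDoubling (μ : Measure X) : Prop :=
  (∀ (x : X) (r : ℝ), 0 < r → 0 < μ (Metric.ball x r) ∧ μ (Metric.ball x r) < ⊤) ∧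
  ∃ C : ℝ≥0, ∀ (x : X) (r : ℝ), 0 < r →
    μ (Metric.ball x (2 * r)) ≤ C * μ (Metric.ball x r)

/-- `Δ` is self-adjoint and non-positive. -/
def IsNegSelfAdjoint {μ : Measure X} (Δ : Lp ℂ 2 μ →ₗ.[ℂ] Lp ℂ 2 μ) : Prop :=
  IsSelfAdjoint Δ ∧ ∀ u : Δ.domain, (inner ℂ (u : Lp ℂ 2 μ) (Δ u)).re ≤ 0

/-- The operator `S` is given by integration against the kernel `k`. -/
def HasKernel {μ : Measure X} (S : Lp ℂ 2 μ →L[ℂ] Lp ℂ 2 μ) (k : X → X → ℂ) : Prop :=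
  Measurable (fun z : X × X => k z.1 z.2) ∧
  ∀ u : Lp ℂ 2 μ, ∀ᵐ x ∂μ, Integrable (fun y => k x y * u y) μ ∧ S u x = ∫ y, k x y * u y ∂μ

/-- `h` is the complex heat kernel of `Δ`: for `Re z > 0` the kernel of
`e^{zΔ} = ∫_{(0,∞)} e^{-zλ} dE(λ)`, where `E` is the spectral resolution of `-Δ`, holomorphic in
`z`, and real for real `z`. (The eigenvalue `0`, if present, is left out of the heat operator.) -/
def IsHeatKernel {μ : Measure X} (Δ : Lp ℂ 2 μ →ₗ.[ℂ] Lp ℂ 2 μ) (h : ℂ → X → X → ℂ) : Prop :=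
  (∃ E : ProjectionValuedMeasure ℝ (Lp ℂ 2 μ), E.IsSpectralResolution (-Δ) ∧
    ∀ z : ℂ, 0 < z.re → ∃ S : Lp ℂ 2 μ →L[ℂ] Lp ℂ 2 μ,
      E.IsIntegralOn (Ioi 0) (fun l => Complex.exp (-(z * l))) S ∧ HasKernel S (h z)) ∧
  (∀ x y : X, DifferentiableOn ℂ (fun z => h z x y) {z : ℂ | 0 < z.re}) ∧
  ∀ t : ℝ, 0 < t → ∀ x y : X, (h t x y).im = 0

/-- The sub-Gaussian upper estimate with exponents `d`, `γ` and `β = d / (d + 1)`. -/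
def SubGaussianBound (d γ : ℝ) (h : ℂ → X → X → ℂ) : Prop :=
  ∃ c₁ > 0, ∃ c₂ > 0, ∀ t : ℝ, 0 < t → ∀ x y : X,
    ‖h t x y‖ ≤ c₁ * t ^ (-(d / (d + 1))) *
      Real.exp (-(c₂ * (dist x y ^ (d + 1) / t) ^ γ))

/-- On the open set `U`, the function `f` is locally in the domain of `Δ`, and `Δ f = g`: the pair
`(f, g)` is the limit in `L²_loc(U) × L²_loc(U)` of elements `(F n, Δ (F n))` of the graph
of `Δ`. -/
def IsLocalLaplacian {μ : Measure X} (Δ : Lp ℂ 2 μ →ₗ.[ℂ] Lp ℂ 2 μ) (U : Set X) (f g : X → ℂ) :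
    Prop :=
  ∃ F : ℕ → Δ.domain, ∀ x ∈ U, ∃ V ∈ 𝓝 x,
    Tendsto (fun n => eLpNorm (fun s => (F n : Lp ℂ 2 μ) s - f s) 2 (μ.restrict V)) atTop (𝓝 0) ∧
    Tendsto (fun n => eLpNorm (fun s => (Δ (F n)) s - g s) 2 (μ.restrict V)) atTop (𝓝 0)

end OneSpace

/-! ### Symbols on `(0,∞)^N` -/

/-- The open orthant `(0,∞)^N`. -/
def posOrthant (N : ℕ) : Set (Fin N → ℝ) := {l | ∀ k, 0 < l k}

/-- The mixed partial derivative `∂^α = ∂_1^{α_1} ⋯ ∂_N^{α_N}`. -/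
def mixedPartial {N : ℕ} (α : Fin N → ℕ) (p : (Fin N → ℝ) → ℂ) : (Fin N → ℝ) → ℂ :=
  (List.finRange N).foldr
    (fun k g => (fun (f : (Fin N → ℝ) → ℂ) l => lineDeriv ℝ f l (Pi.single k 1))^[α k] g) p

/-- The symbol class `S⁰` on `(0,∞)^N` (Marcinkiewicz condition). -/
def IsSymbolZero {N : ℕ} (p : (Fin N → ℝ) → ℂ) : Prop :=
  ContDiffOn ℝ ∞ p (posOrthant N) ∧
  ∀ α : Fin N → ℕ, ∃ C : ℝ, ∀ l ∈ posOrthant N, (∏ k, l k ^ α k) * ‖mixedPartial α p l‖ ≤ C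

/-! ### Product spaces -/

section Products

variable {N : ℕ} {X : Fin N → Type*} [∀ k, MetricSpace (X k)] [∀ k, MeasurableSpace (X k)]
  {μ : ∀ k, Measure (X k)}

/-- `w` is the tensor product `w(x) = u_1(x_1) ⋯ u_N(x_N)`. -/
def IsTensor (u : ∀ k, Lp ℂ 2 (μ k)) (w : Lp ℂ 2 (Measure.pi μ)) : Prop :=
  ∀ᵐ x ∂(Measure.pi μ), w x = ∏ k, u k (x k)

/-- `F` is the joint spectral resolution built from the `E k`:
`F(s_1 × ⋯ × s_N) (u_1 × ⋯ × u_N) = E_1(s_1) u_1 × ⋯ × E_N(s_N) u_N`. -/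
def IsJointResolution (E : ∀ k, ProjectionValuedMeasure ℝ (Lp ℂ 2 (μ k)))
    (F : ProjectionValuedMeasure (Fin N → ℝ) (Lp ℂ 2 (Measure.pi μ))) : Prop :=
  ∀ s : Fin N → Set ℝ, (∀ k, MeasurableSet (s k)) →
    ∀ (u : ∀ k, Lp ℂ 2 (μ k)) (w : Lp ℂ 2 (Measure.pi μ)), IsTensor u w →
      IsTensor (fun k => (E k).proj (s k) (u k)) (F.proj (Set.univ.pi s) w)

/-- `T` is the operator `p(-Δ_1, …, -Δ_N) = ∫_{(0,∞)^N} p(λ) dF(λ)`, with `F` the joint spectral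
resolution of `(-Δ_1, …, -Δ_N)`. -/
def IsJointMultiplier (Δ : ∀ k, Lp ℂ 2 (μ k) →ₗ.[ℂ] Lp ℂ 2 (μ k)) (p : (Fin N → ℝ) → ℂ)
    (T : Lp ℂ 2 (Measure.pi μ) →L[ℂ] Lp ℂ 2 (Measure.pi μ)) : Prop :=
  ∃ E : ∀ k, ProjectionValuedMeasure ℝ (Lp ℂ 2 (μ k)),
    (∀ k, (E k).IsSpectralResolution (-(Δ k))) ∧
    ∃ F : ProjectionValuedMeasure (Fin N → ℝ) (Lp ℂ 2 (Measure.pi μ)),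
      IsJointResolution E F ∧ F.IsIntegralOn (posOrthant N) p T

/-- `(x, y)` is off the diagonal: `x` and `y` differ in every coordinate. -/
def OffDiag (x y : ∀ k, X k) : Prop := ∀ k, x k ≠ y k

/-- `T` is given off the diagonal by integration against `K`: for `u` in `L¹ ∩ L²`,
`(T u)(x) = ∫ K(x,y) u(y) dμ(y)`, absolutely convergent, for almost every `x` that is at positive
distance, in each coordinate, from the (essential) support of `u`. -/
def HasOffDiagKernel (T : Lp ℂ 2 (Measure.pi μ) →L[ℂ] Lp ℂ 2 (Measure.pi μ))
    (K : (∀ k, X k) → (∀ k, X k) → ℂ) : Prop :=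
  Measurable (fun z : (∀ k, X k) × (∀ k, X k) => K z.1 z.2) ∧
  ∀ u : Lp ℂ 2 (Measure.pi μ), Integrable u (Measure.pi μ) →
    ∀ᵐ x ∂(Measure.pi μ),
      (∃ ε > 0, ∀ᵐ y ∂(Measure.pi μ), u y ≠ 0 → ∀ k, ε ≤ dist (x k) (y k)) →
        Integrable (fun y => K x y * u y) (Measure.pi μ) ∧
        T u x = ∫ y, K x y * u y ∂(Measure.pi μ)

/-- `K` is smooth off the diagonal, with derivatives
`D a b = Δ_{x,1}^{a_1} ⋯ Δ_{x,N}^{a_N} Δ_{y,1}^{b_1} ⋯ Δ_{y,N}^{b_N} K`: off the diagonal, `D 0 0`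
is `K`, and each `D a b` is locally in the domain of the Laplacian with respect to each of the
variables `x_i`, `y_j` (the other variables being fixed), with Laplacian the next derivative. -/
def IsSmoothOffDiagWith (Δ : ∀ k, Lp ℂ 2 (μ k) →ₗ.[ℂ] Lp ℂ 2 (μ k))
    (K : (∀ k, X k) → (∀ k, X k) → ℂ)
    (D : (Fin N → ℕ) → (Fin N → ℕ) → (∀ k, X k) → (∀ k, X k) → ℂ) : Prop :=
  (∀ x y, OffDiag x y → D 0 0 x y = K x y) ∧
  (∀ a b, Measurable (fun z : (∀ k, X k) × (∀ k, X k) => D a b z.1 z.2)) ∧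
  (∀ a b i x y, OffDiag x y →
    IsLocalLaplacian (Δ i) {s | s ≠ y i}
      (fun s => D a b (Function.update x i s) y)
      (fun s => D (a + Pi.single i 1) b (Function.update x i s) y)) ∧
  (∀ a b j x y, OffDiag x y →
    IsLocalLaplacian (Δ j) {s | s ≠ x j}
      (fun s => D a b x (Function.update y j s))
      (fun s => D a (b + Pi.single j 1) x (Function.update y j s)))

end Products

end

set_option linter.unusedSectionVars false

/-! The symbol is resolved into blocks whose kernels are finite combinations of heat kernels at
positive real times. Let T_n be the Chebyshev polynomials and ψ_n(s) = T_n(2e^{-s} - 1) e^{-2s} (1 -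
e^{-s}). On the orthant p(λ) = Σ_{j,n} c_{j,n} ∏_k ψ_{|n_k|}(2^{-j_k} λ_k), the sum being over j, n
in ℤ^N, and |c_{j,n}| ≤ C_L ∏_k (1+|n_k|)^{-L} for every L, uniformly in j.

The expansion comes from cutting p dyadically in each variable and substituting e^{-s} = cos²(πθ), 0
< θ < 1/2. Then T_n(2e^{-s} - 1) = cos(2πnθ), so dividing a dyadic piece by the weights e^{-2s}(1 -
e^{-s}) and expanding it in a cosine series gives the blocks. The hypothesis on p is invariant under
dilations of each variable, so integration by parts yields decay in n that does not see j
(`exists_norm_oscInt_le`, `hasSum_symCoeff`).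

The kernel of ψ_n(-tΔ) has two bounds. The Chebyshev coefficients are at most 7^n, so the heat
kernel bound gives off-diagonal decay at an exponential cost in n (`norm_chebKernel_le`). On the
other hand |T_n| ≤ 1 on [-1,1]; placing T_n between two heat operators that map L¹ to L² and L² to
L^∞ gives a bound by a multiple of t^{-d/(d+1)} with no loss in n (`ae_norm_chebKernel_le`). The
minimum of the two has decay of any order in R^{d+1}/t at only a polynomial cost in n
(`exists_min_one_exp_le`), which the coefficients absorb.

With ρ = R^{d+1}, summing over scales gives Σ_j 2^{jβ} min(1, (2^j ρ)^{-M}) ≤ C ρ^{-β} for M > β > 0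
(`exists_sumBdd_dyadic`). For β = b + d/(d+1) this is R^{-b(d+1)} R^{-d}: both the size estimate (b
= 0) and the estimates for iterated Laplacians.

The iterated Laplacians are given by the same series for (-1)^{|a|} λ^a p; a factor λ_i becomes
2^{j_i} times a factor s in the bump function. With all variables but one fixed, the sum over n at a
single scale j lies in the domain of Δ, because one heat factor has been reserved for a slice
h_t(·,y) in L². The finite sums over j converge locally uniformly off the diagonal, hence in L²_loc,
together with their Laplacians (`isLocalLaplacian_slice`).

Operators are handled through unitary maps to L² spaces on which the spectral measures act by
multiplication (`exists_representation`, `exists_tensor_isometryEquiv`). Pointwise bounded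
convergence of symbols then gives strong convergence of operators, and a subsequence converges
almost everywhere; this links the operator with the pointwise series for its kernel
(`hasOffDiagKernel_derivKernel`). -/

noncomputable section

/-! ### Multiplication operators on `L²` -/

section MulOp

variable {Ω : Type*} [MeasurableSpace Ω]

/-- `m` is measurable and bounded. -/
def IsBddMeas (m : Ω → ℂ) : Prop := Measurable m ∧ ∃ C : ℝ, ∀ x, ‖m x‖ ≤ C

namespace IsBddMeas

variable {m m' : Ω → ℂ}

theorem const (c : ℂ) : IsBddMeas (fun _ : Ω => c) := ⟨measurable_const, ‖c‖, fun _ => le_rfl⟩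

theorem add (h : IsBddMeas m) (h' : IsBddMeas m') : IsBddMeas (fun x => m x + m' x) := by
  obtain ⟨hm, C, hC⟩ := h
  obtain ⟨hm', C', hC'⟩ := h'
  exact ⟨hm.add hm', C + C', fun x => (norm_add_le _ _).trans (add_le_add (hC x) (hC' x))⟩

theorem mul (h : IsBddMeas m) (h' : IsBddMeas m') : IsBddMeas (fun x => m x * m' x) := by
  obtain ⟨hm, C, hC⟩ := h
  obtain ⟨hm', C', hC'⟩ := h'
  refine ⟨hm.mul hm', C * C', fun x => ?_⟩
  rw [norm_mul]
  exact mul_le_mul (hC x) (hC' x) (norm_nonneg _) ((norm_nonneg _).trans (hC x))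

theorem const_mul (h : IsBddMeas m) (c : ℂ) : IsBddMeas (fun x => c * m x) := (const c).mul h

theorem sub (h : IsBddMeas m) (h' : IsBddMeas m') : IsBddMeas (fun x => m x - m' x) := by
  simpa [sub_eq_add_neg] using h.add (h'.const_mul (-1))

theorem sum {ι : Type*} {s : Finset ι} {m : ι → Ω → ℂ} (h : ∀ i ∈ s, IsBddMeas (m i)) :
    IsBddMeas (fun x => ∑ i ∈ s, m i x) := by
  classical
  induction s using Finset.induction_on with
  | empty => simpa using const (Ω := Ω) 0
  | insert a s ha ih =>
    simp only [Finset.sum_insert ha]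
    exact (h a (Finset.mem_insert_self a s)).add
      (ih fun i hi => h i (Finset.mem_insert_of_mem hi))

theorem prod {ι : Type*} {s : Finset ι} {m : ι → Ω → ℂ} (h : ∀ i ∈ s, IsBddMeas (m i)) :
    IsBddMeas (fun x => ∏ i ∈ s, m i x) := by
  classical
  induction s using Finset.induction_on with
  | empty => simpa using const (Ω := Ω) 1
  | insert a s ha ih =>
    simp only [Finset.prod_insert ha]
    exact (h a (Finset.mem_insert_self a s)).mul
      (ih fun i hi => h i (Finset.mem_insert_of_mem hi))

theorem comp {Λ : Type*} [MeasurableSpace Λ] (h : IsBddMeas m) {g : Λ → Ω} (hg : Measurable g) :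
    IsBddMeas (fun x => m (g x)) := by
  obtain ⟨hm, C, hC⟩ := h
  exact ⟨hm.comp hg, C, fun x => hC _⟩

end IsBddMeas

theorem isBddMeas_indicator {s : Set Ω} (hs : MeasurableSet s) {m : Ω → ℂ} (hm : IsBddMeas m) :
    IsBddMeas (s.indicator m) := by
  obtain ⟨h, C, hC⟩ := hm
  exact ⟨h.indicator hs, C, fun x => (norm_indicator_le_norm_self _ _).trans (hC x)⟩

theorem isBddMeas_indicator_one {s : Set Ω} (hs : MeasurableSet s) :
    IsBddMeas (s.indicator (fun _ => (1 : ℂ))) := isBddMeas_indicator hs (IsBddMeas.const 1)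

variable {ν : Measure Ω}

theorem memLp_bdd_mul {m : Ω → ℂ} (hm : Measurable m) {C : ℝ} (hC : ∀ x, ‖m x‖ ≤ C)
    {f : Ω → ℂ} (hf : MemLp f 2 ν) : MemLp (fun x => m x * f x) 2 ν :=
  hf.of_le_mul (c := C) (hm.aestronglyMeasurable.mul hf.1) (by
    filter_upwards with x
    rw [norm_mul]
    exact mul_le_mul_of_nonneg_right (hC x) (norm_nonneg _))

open Classical in
/-- Multiplication by the bounded measurable function `m` on `L²`. -/
def mulOp (ν : Measure Ω) (m : Ω → ℂ) : Lp ℂ 2 ν →L[ℂ] Lp ℂ 2 ν :=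
  if h : IsBddMeas m then
    LinearMap.mkContinuous
      { toFun := fun f => (memLp_bdd_mul h.1 h.2.choose_spec (Lp.memLp f)).toLp _
        map_add' := fun f g => by
          rw [← MemLp.toLp_add]
          apply MemLp.toLp_congr
          filter_upwards [Lp.coeFn_add f g] with x hx
          rw [hx]
          simp [mul_add]
        map_smul' := fun c f => by
          rw [RingHom.id_apply, ← MemLp.toLp_const_smul]
          apply MemLp.toLp_congr
          filter_upwards [Lp.coeFn_smul c f] with x hx
          simp only [hx, Pi.smul_apply, smul_eq_mul]
          ring }
      h.2.choose (fun f => by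
        apply Lp.norm_le_mul_norm_of_ae_le_mul
        filter_upwards [MemLp.coeFn_toLp (memLp_bdd_mul h.1 h.2.choose_spec (Lp.memLp f))]
          with x hx
        simp only [LinearMap.coe_mk, AddHom.coe_mk]
        rw [hx, norm_mul]
        exact mul_le_mul_of_nonneg_right (h.2.choose_spec x) (norm_nonneg _))
  else 0

theorem mulOp_coe {m : Ω → ℂ} (hm : IsBddMeas m) (f : Lp ℂ 2 ν) :
    mulOp ν m f =ᵐ[ν] fun x => m x * f x := by
  rw [mulOp, dif_pos hm]
  exact MemLp.coeFn_toLp (memLp_bdd_mul hm.1 hm.2.choose_spec (Lp.memLp f))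

theorem norm_mulOp_apply_le {m : Ω → ℂ} (hm : IsBddMeas m) {C : ℝ} (hC : ∀ x, ‖m x‖ ≤ C)
    (f : Lp ℂ 2 ν) : ‖mulOp ν m f‖ ≤ C * ‖f‖ := by
  apply Lp.norm_le_mul_norm_of_ae_le_mul
  filter_upwards [mulOp_coe hm f] with x hx
  rw [hx, norm_mul]
  exact mul_le_mul_of_nonneg_right (hC x) (norm_nonneg _)

theorem mulOp_add {m m' : Ω → ℂ} (hm : IsBddMeas m) (hm' : IsBddMeas m') :
    mulOp ν (fun x => m x + m' x) = mulOp ν m + mulOp ν m' := by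
  ext1 f
  apply Lp.ext
  filter_upwards [mulOp_coe hm f, mulOp_coe hm' f, mulOp_coe (hm.add hm') f,
    Lp.coeFn_add (mulOp ν m f) (mulOp ν m' f)] with x h1 h2 h3 h4
  rw [add_apply, h4, h3, Pi.add_apply, h1, h2]
  ring

theorem mulOp_mul {m m' : Ω → ℂ} (hm : IsBddMeas m) (hm' : IsBddMeas m') :
    mulOp ν (fun x => m x * m' x) = mulOp ν m * mulOp ν m' := by
  ext1 f
  apply Lp.ext
  filter_upwards [mulOp_coe hm (mulOp ν m' f), mulOp_coe hm' f, mulOp_coe (hm.mul hm') f]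
    with x h1 h2 h3
  change _ = mulOp ν m (mulOp ν m' f) x
  rw [h3, h1, h2]
  ring

theorem mulOp_const (c : ℂ) : mulOp ν (fun _ => c) = c • 1 := by
  ext1 f
  apply Lp.ext
  filter_upwards [mulOp_coe (IsBddMeas.const c) f, Lp.coeFn_smul c f] with x h1 h2
  change _ = (c • f) x
  rw [h1, h2]
  simp

theorem mulOp_const_mul {m : Ω → ℂ} (hm : IsBddMeas m) (c : ℂ) :
    mulOp ν (fun x => c * m x) = c • mulOp ν m := by
  rw [mulOp_mul (IsBddMeas.const c) hm, mulOp_const]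
  simp

theorem mulOp_sum {ι : Type*} {s : Finset ι} {m : ι → Ω → ℂ} (h : ∀ i ∈ s, IsBddMeas (m i)) :
    mulOp ν (fun x => ∑ i ∈ s, m i x) = ∑ i ∈ s, mulOp ν (m i) := by
  classical
  induction s using Finset.induction_on with
  | empty => simp [mulOp_const]
  | insert a s ha ih =>
    simp only [Finset.sum_insert ha]
    have h1 : ∀ i ∈ s, IsBddMeas (m i) := fun i hi => h i (Finset.mem_insert_of_mem hi)
    rw [mulOp_add (h a (Finset.mem_insert_self a s)) (IsBddMeas.sum h1), ih h1]

theorem L2_inner_eq (f g : Lp ℂ 2 ν) :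
    inner ℂ f g = ∫ x, (starRingEnd ℂ) (f x) * g x ∂ν := by
  rw [L2.inner_def]
  refine integral_congr_ae (Eventually.of_forall fun x => ?_)
  simp [RCLike.inner_apply, mul_comm]

theorem inner_mulOp {m : Ω → ℂ} (hm : IsBddMeas m) (f g : Lp ℂ 2 ν) :
    inner ℂ f (mulOp ν m g) = ∫ x, (starRingEnd ℂ) (f x) * (m x * g x) ∂ν := by
  rw [L2_inner_eq]
  refine integral_congr_ae ?_
  filter_upwards [mulOp_coe hm g] with x hx
  rw [hx]

theorem inner_mulOp_left {m : Ω → ℂ} (hm : IsBddMeas m) (hr : ∀ x, (starRingEnd ℂ) (m x) = m x)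
    (f g : Lp ℂ 2 ν) : inner ℂ (mulOp ν m f) g = inner ℂ f (mulOp ν m g) := by
  rw [inner_mulOp hm, L2_inner_eq]
  refine integral_congr_ae ?_
  filter_upwards [mulOp_coe hm f] with x hx
  rw [hx, map_mul, hr]
  ring

theorem norm_sq_eq_integral (f : Lp ℂ 2 ν) : ‖f‖ ^ 2 = ∫ x, ‖f x‖ ^ 2 ∂ν := by
  have h : inner ℂ f f = ((‖f‖ : ℂ)) ^ 2 := inner_self_eq_norm_sq_to_K f
  rw [L2_inner_eq] at h
  have h2 : ∫ x, (starRingEnd ℂ) (f x) * f x ∂ν = ((∫ x, ‖f x‖ ^ 2 ∂ν : ℝ) : ℂ) := by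
    rw [← integral_complex_ofReal]
    refine integral_congr_ae (Eventually.of_forall fun x => ?_)
    simp [Complex.conj_mul']
  rw [h2] at h
  exact_mod_cast h.symm

theorem integrable_norm_sq (f : Lp ℂ 2 ν) : Integrable (fun x => ‖f x‖ ^ 2) ν :=
  (memLp_two_iff_integrable_sq_norm (Lp.memLp f).1).1 (Lp.memLp f)

/-- Dominated convergence with majorant (C + C')²|f|². Strong convergence obtained this way is the
mode in which all series of multipliers are summed. -/
theorem tendsto_mulOp {ι : Type*} {l : Filter ι} [l.IsCountablyGenerated]
    {m : ι → Ω → ℂ} {m' : Ω → ℂ} (hm : ∀ i, IsBddMeas (m i)) (hm' : IsBddMeas m') {C : ℝ}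
    (hC : ∀ i x, ‖m i x‖ ≤ C) (hlim : ∀ x, Tendsto (fun i => m i x) l (𝓝 (m' x)))
    (f : Lp ℂ 2 ν) : Tendsto (fun i => mulOp ν (m i) f) l (𝓝 (mulOp ν m' f)) := by
  obtain ⟨-, C', hC'⟩ := id hm'
  rw [tendsto_iff_norm_sub_tendsto_zero]
  have key : Tendsto (fun i => ‖mulOp ν (m i) f - mulOp ν m' f‖ ^ 2) l (𝓝 0) := by
    have h1 : ∀ i, ‖mulOp ν (m i) f - mulOp ν m' f‖ ^ 2
        = ∫ x, ‖m i x - m' x‖ ^ 2 * ‖f x‖ ^ 2 ∂ν := by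
      intro i
      rw [norm_sq_eq_integral]
      refine integral_congr_ae ?_
      filter_upwards [mulOp_coe (hm i) f, mulOp_coe hm' f,
        Lp.coeFn_sub (mulOp ν (m i) f) (mulOp ν m' f)] with x h1 h2 h3
      rw [h3, Pi.sub_apply, h1, h2, ← sub_mul, norm_mul, mul_pow]
    simp_rw [h1]
    have h2 : ∫ x, (0 : ℝ) ∂ν = 0 := by simp
    rw [← h2]
    refine tendsto_integral_filter_of_dominated_convergence
      (fun x => (C + C') ^ 2 * ‖f x‖ ^ 2) ?_ ?_ ?_ ?_
    · refine Eventually.of_forall fun i => ?_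
      exact (((hm i).1.sub hm'.1).norm.pow_const 2).aestronglyMeasurable.mul
        (integrable_norm_sq f).1
    · refine Eventually.of_forall fun i => Eventually.of_forall fun x => ?_
      rw [Real.norm_of_nonneg (by positivity)]
      have : ‖m i x - m' x‖ ≤ C + C' := (norm_sub_le _ _).trans (add_le_add (hC i x) (hC' x))
      gcongr
    · exact (integrable_norm_sq f).const_mul _
    · refine Eventually.of_forall fun x => ?_
      have h3 := (tendsto_iff_norm_sub_tendsto_zero.1 (hlim x))
      have h4 := (h3.pow 2).mul_const (‖f x‖ ^ 2)
      simpa using h4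
  have h5 := key.sqrt
  simpa [Real.sqrt_sq] using h5

theorem memLp_of_ae_mul {m : Ω → ℂ} {f : Lp ℂ 2 ν} (hm : Measurable m)
    (h : Integrable (fun x => ‖m x‖ ^ 2 * ‖f x‖ ^ 2) ν) : MemLp (fun x => m x * f x) 2 ν := by
  refine (memLp_two_iff_integrable_sq_norm (hm.aestronglyMeasurable.mul (Lp.memLp f).1)).2 ?_
  simpa [mul_pow] using h

end MulOp

/-! ### Multiplication operators in a spectral representation -/

section SpecOp

variable {Ω : Type*} [MeasurableSpace Ω] {ν : Measure Ω} {H : Type*} [NormedAddCommGroup H]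
  [InnerProductSpace ℂ H]

/-- The operator on `H` that becomes multiplication by `m` under `U`. -/
def specOp (U : Lp ℂ 2 ν ≃ₗᵢ[ℂ] H) (m : Ω → ℂ) : H →L[ℂ] H :=
  (U.toContinuousLinearEquiv : Lp ℂ 2 ν →L[ℂ] H) ∘L mulOp ν m ∘L
    (U.symm.toContinuousLinearEquiv : H →L[ℂ] Lp ℂ 2 ν)

variable (U : Lp ℂ 2 ν ≃ₗᵢ[ℂ] H)

theorem specOp_apply (m : Ω → ℂ) (u : H) : specOp U m u = U (mulOp ν m (U.symm u)) := rfl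

theorem symm_specOp (m : Ω → ℂ) (u : H) : U.symm (specOp U m u) = mulOp ν m (U.symm u) := by
  simp [specOp_apply]

theorem specOp_add {m m' : Ω → ℂ} (hm : IsBddMeas m) (hm' : IsBddMeas m') :
    specOp U (fun x => m x + m' x) = specOp U m + specOp U m' := by
  ext u; simp [specOp_apply, mulOp_add hm hm']

theorem specOp_mul {m m' : Ω → ℂ} (hm : IsBddMeas m) (hm' : IsBddMeas m') :
    specOp U (fun x => m x * m' x) = specOp U m * specOp U m' := by
  ext u; simp [specOp_apply, mulOp_mul hm hm']

theorem specOp_const_mul {m : Ω → ℂ} (hm : IsBddMeas m) (c : ℂ) :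
    specOp U (fun x => c * m x) = c • specOp U m := by
  ext u; simp [specOp_apply, mulOp_const_mul hm c]

theorem specOp_sum {ι : Type*} {s : Finset ι} {m : ι → Ω → ℂ} (h : ∀ i ∈ s, IsBddMeas (m i)) :
    specOp U (fun x => ∑ i ∈ s, m i x) = ∑ i ∈ s, specOp U (m i) := by
  ext u
  simp [specOp_apply, mulOp_sum h, map_sum]

theorem specOp_one : specOp U (fun _ => 1) = 1 := by
  ext u; simp [specOp_apply, mulOp_const]

theorem norm_specOp_apply_le {m : Ω → ℂ} (hm : IsBddMeas m) {C : ℝ} (hC : ∀ x, ‖m x‖ ≤ C)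
    (u : H) : ‖specOp U m u‖ ≤ C * ‖u‖ := by
  rw [specOp_apply, U.norm_map]
  simpa using norm_mulOp_apply_le hm hC (U.symm u)

theorem tendsto_specOp {ι : Type*} {l : Filter ι} [l.IsCountablyGenerated]
    {m : ι → Ω → ℂ} {m' : Ω → ℂ} (hm : ∀ i, IsBddMeas (m i)) (hm' : IsBddMeas m') {C : ℝ}
    (hC : ∀ i x, ‖m i x‖ ≤ C) (hlim : ∀ x, Tendsto (fun i => m i x) l (𝓝 (m' x)))
    (u : H) : Tendsto (fun i => specOp U (m i) u) l (𝓝 (specOp U m' u)) :=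
  (U.continuous.tendsto _).comp (tendsto_mulOp hm hm' hC hlim (U.symm u))

theorem inner_symm_eq (u v : H) : inner ℂ (U.symm u) (U.symm v) = inner ℂ u v := by
  simp

theorem inner_specOp_left {m : Ω → ℂ} (hm : IsBddMeas m)
    (hr : ∀ x, (starRingEnd ℂ) (m x) = m x) (u v : H) :
    inner ℂ (specOp U m u) v = inner ℂ u (specOp U m v) := by
  rw [← inner_symm_eq U, ← inner_symm_eq U u, symm_specOp, symm_specOp,
    inner_mulOp_left hm hr]

theorem inner_specOp {m : Ω → ℂ} (hm : IsBddMeas m) (u : H) :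
    inner ℂ u (specOp U m u) = ∫ x, m x * ((‖U.symm u x‖ ^ 2 : ℝ) : ℂ) ∂ν := by
  rw [← inner_symm_eq U, symm_specOp, inner_mulOp hm]
  refine integral_congr_ae (Eventually.of_forall fun x => ?_)
  have : (starRingEnd ℂ) (U.symm u x) * (U.symm u x) = ((‖U.symm u x‖ ^ 2 : ℝ) : ℂ) := by
    simp [Complex.conj_mul']
  simp only
  rw [← this]
  ring

end SpecOp

/-! ### Isometries prescribed on total sets -/

section Gram

variable {H₁ H₂ : Type*} [NormedAddCommGroup H₁] [InnerProductSpace ℂ H₁] [CompleteSpace H₁]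
  [NormedAddCommGroup H₂] [InnerProductSpace ℂ H₂] [CompleteSpace H₂]

theorem dense_span_of_orthogonal {ι : Type*} (a : ι → H₁)
    (h : ∀ f : H₁, (∀ i, inner ℂ (a i) f = 0) → f = 0) :
    (Submodule.span ℂ (Set.range a)).topologicalClosure = ⊤ := by
  rw [Submodule.topologicalClosure_eq_top_iff, Submodule.eq_bot_iff]
  intro f hf
  refine h f fun i => ?_
  exact (Submodule.mem_orthogonal _ _).1 hf _ (Submodule.subset_span ⟨i, rfl⟩)

/-- Equal Gram matrices make Σ c_i a_i ↦ Σ c_i b_i norm preserving. Totality of `a` extends it by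
density, and totality of `b` forces the closed range to be everything. It serves both for the
spectral representation and for tensor products. -/
theorem exists_isometryEquiv_of_inner_eq {ι : Type*} (a : ι → H₁) (b : ι → H₂)
    (hab : ∀ i j, inner ℂ (a i) (a j) = inner ℂ (b i) (b j))
    (ha : ∀ f : H₁, (∀ i, inner ℂ (a i) f = 0) → f = 0)
    (hb : ∀ f : H₂, (∀ i, inner ℂ (b i) f = 0) → f = 0) :
    ∃ V : H₁ ≃ₗᵢ[ℂ] H₂, ∀ i, V (a i) = b i := by
  let e := Finsupp.linearCombination ℂ a
  let f := Finsupp.linearCombination ℂ b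
  have hinner : ∀ x y, inner ℂ (e x) (e y) = inner ℂ (f x) (f y) := by
    intro x y
    simp only [e, f, Finsupp.linearCombination_apply, Finsupp.sum, sum_inner, inner_sum,
      inner_smul_left, inner_smul_right, hab]
  have hnorm : ∀ x, ‖f x‖ = ‖e x‖ := by
    intro x
    rw [@norm_eq_sqrt_re_inner ℂ, @norm_eq_sqrt_re_inner ℂ, hinner]
  have hdense : DenseRange e := by
    have h1 := dense_span_of_orthogonal a ha
    rw [← Finsupp.range_linearCombination, ← Submodule.dense_iff_topologicalClosure_eq_top] at h1
    exact h1
  have hle : ∀ x, ‖f x‖ ≤ 1 * ‖e x‖ := fun x => by rw [hnorm, one_mul]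
  let V := f.extendOfNorm e
  have hV : ∀ x, V (e x) = f x := LinearMap.extendOfNorm_eq hdense ⟨1, hle⟩
  have hVn : ∀ x, ‖V x‖ = ‖x‖ := by
    intro x
    refine hdense.induction (P := fun x => ‖V x‖ = ‖x‖) ?_
      (isClosed_eq (by fun_prop) (by fun_prop)) x
    rintro _ ⟨y, rfl⟩
    rw [hV, hnorm]
  let W : H₁ →ₗᵢ[ℂ] H₂ := ⟨V.toLinearMap, hVn⟩
  have hVa : ∀ i, W (a i) = b i := by
    intro i
    have := hV (Finsupp.single i 1)
    simp only [e, f, Finsupp.linearCombination_single, one_smul] at this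
    exact this
  have hsurj : Function.Surjective W := by
    suffices LinearMap.range W.toLinearMap = ⊤ from LinearMap.range_eq_top.1 this
    rw [eq_top_iff, ← dense_span_of_orthogonal b hb]
    refine Submodule.topologicalClosure_minimal _ ?_ ?_
    · rw [Submodule.span_le]
      rintro _ ⟨i, rfl⟩
      exact ⟨a i, hVa i⟩
    · have : IsClosed (Set.range W) := W.isometry.isClosedEmbedding.isClosed_range
      exact this
  exact ⟨LinearIsometryEquiv.ofSurjective W hsurj, fun i => by simpa using hVa i⟩

end Gram

/-! ### Uniqueness from integrals -/

section Uniqueness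

variable {Ω : Type*}

/-- The measurable sets over which the integral vanishes form a Dynkin class; `hu` is what gives
closure under complements. -/
theorem ae_eq_zero_of_piSystem {m0 : MeasurableSpace Ω} {μ : Measure Ω} {C : Set (Set Ω)}
    (hgen : m0 = MeasurableSpace.generateFrom C)
    (hC : IsPiSystem C) {f : Ω → ℂ} (hf : Integrable f μ) (hu : ∫ x, f x ∂μ = 0)
    (h : ∀ s ∈ C, ∫ x in s, f x ∂μ = 0) : f =ᵐ[μ] 0 := by
  refine Integrable.ae_eq_zero_of_forall_setIntegral_eq_zero hf fun s hs hs' => ?_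
  clear hs'
  induction s, hs using MeasurableSpace.induction_on_inter hgen hC with
  | empty => simp
  | basic t ht => exact h t ht
  | compl t ht ih =>
    have := integral_add_compl ht hf
    rw [ih, hu, zero_add] at this
    exact this
  | iUnion s hd hs ih =>
    rw [integral_iUnion hs hd hf.integrableOn]
    simp [ih]

end Uniqueness

/-! ### Projection-valued measures in a spectral representation -/

section Representation

variable {Ω Λ : Type*} [MeasurableSpace Ω] [MeasurableSpace Λ] {ν : Measure Ω} {H : Type*}
  [NormedAddCommGroup H] [InnerProductSpace ℂ H]

theorem hasSum_indicator_iUnion_one {Ω : Type*} {s : ℕ → Set Ω} (hd : Pairwise (Function.onFun Disjoint s))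
    (x : Ω) : HasSum (fun n => (s n).indicator (fun _ => (1 : ℂ)) x)
      ((⋃ n, s n).indicator (fun _ => (1 : ℂ)) x) := by
  by_cases hx : x ∈ ⋃ n, s n
  · obtain ⟨n, hn⟩ := mem_iUnion.1 hx
    have h1 : ∀ m, m ≠ n → (s m).indicator (fun _ => (1 : ℂ)) x = 0 := by
      intro m hm
      exact indicator_of_notMem (fun h => (hd hm).le_bot ⟨h, hn⟩) _
    have := hasSum_single n h1
    rw [indicator_of_mem hn] at this
    rwa [indicator_of_mem hx]
  · have h1 : ∀ m, (s m).indicator (fun _ => (1 : ℂ)) x = 0 := fun m =>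
      indicator_of_notMem (fun h => hx (mem_iUnion.2 ⟨m, h⟩)) _
    simp only [h1, indicator_of_notMem hx]
    exact hasSum_zero

theorem norm_sum_indicator_one_le {Ω : Type*} {s : ℕ → Set Ω} (hd : Pairwise (Function.onFun Disjoint s))
    (F : Finset ℕ) (x : Ω) : ‖∑ n ∈ F, (s n).indicator (fun _ => (1 : ℂ)) x‖ ≤ 1 := by
  have h := Finset.indicator_biUnion_apply F s (f := fun _ => (1 : ℂ))
    (fun i _ j _ hij => hd hij) x
  rw [← h]
  exact (norm_indicator_le_norm_self _ _).trans (by simp)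

/-- The projection-valued measure `s ↦ 1_s(g)` in the representation `U`. -/
def pvmOfRep (U : Lp ℂ 2 ν ≃ₗᵢ[ℂ] H) (g : Ω → Λ) (hg : Measurable g) :
    ProjectionValuedMeasure Λ H where
  proj s := specOp U ((g ⁻¹' s).indicator fun _ => 1)
  symm s hs u v := inner_specOp_left U (isBddMeas_indicator_one (hg hs))
    (fun x => by by_cases hx : x ∈ g ⁻¹' s <;> simp [hx]) u v
  inter s t hs ht := by
    rw [← specOp_mul U (isBddMeas_indicator_one (hg hs)) (isBddMeas_indicator_one (hg ht))]
    congr 1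
    ext x
    by_cases hx : g x ∈ s <;> by_cases hy : g x ∈ t <;> simp [indicator, hx, hy]
  univ := by
    rw [preimage_univ, indicator_univ, specOp_one]
  iUnion s hs hd u := by
    have hd' : Pairwise (Function.onFun Disjoint fun n => g ⁻¹' (s n)) := fun i j hij =>
      (hd hij).preimage g
    have hm : ∀ n, IsBddMeas ((g ⁻¹' (s n)).indicator fun _ => (1 : ℂ)) := fun n =>
      isBddMeas_indicator_one (hg (hs n))
    have h := tendsto_specOp U (l := (atTop : Filter (Finset ℕ))) (C := 1)
      (m := fun F x => ∑ n ∈ F, (g ⁻¹' (s n)).indicator (fun _ => (1 : ℂ)) x)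
      (m' := (⋃ n, g ⁻¹' (s n)).indicator fun _ => (1 : ℂ))
      (fun F => IsBddMeas.sum fun n _ => hm n)
      (isBddMeas_indicator_one (MeasurableSet.iUnion fun n => hg (hs n)))
      (fun F x => norm_sum_indicator_one_le hd' F x)
      (fun x => hasSum_indicator_iUnion_one hd' x) u
    rw [preimage_iUnion]
    refine h.congr fun F => ?_
    rw [specOp_sum U fun n _ => hm n, sum_apply]

/-- Under `U`, the projection-valued measure `E` is `s ↦ 1_s(g)`. -/
def Represents (U : Lp ℂ 2 ν ≃ₗᵢ[ℂ] H) (g : Ω → Λ) (E : ProjectionValuedMeasure Λ H) : Prop :=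
  ∀ s, MeasurableSet s → E.proj s = specOp U ((g ⁻¹' s).indicator fun _ => 1)

theorem represents_pvmOfRep (U : Lp ℂ 2 ν ≃ₗᵢ[ℂ] H) (g : Ω → Λ) (hg : Measurable g) :
    Represents U g (pvmOfRep U g hg) := fun _ _ => rfl

theorem scalarMeasure_apply (E : ProjectionValuedMeasure Λ H) (u : H) {s : Set Λ}
    (hs : MeasurableSet s) : E.scalarMeasure u s = ENNReal.ofReal (‖E.proj s u‖ ^ 2) :=
  Measure.ofMeasurable_apply s hs

instance isFiniteMeasure_scalarMeasure (E : ProjectionValuedMeasure Λ H) (u : H) :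
    IsFiniteMeasure (E.scalarMeasure u) :=
  ⟨by rw [scalarMeasure_apply E u MeasurableSet.univ]; exact ENNReal.ofReal_lt_top⟩

/-- Under `U` the vector E(s)u becomes 1_s(g) times the function representing u, so its squared norm
is an integral over the preimage of s. -/
theorem Represents.scalarMeasure_eq {U : Lp ℂ 2 ν ≃ₗᵢ[ℂ] H} {g : Ω → Λ} (hg : Measurable g)
    {E : ProjectionValuedMeasure Λ H} (h : Represents U g E) (u : H) :
    E.scalarMeasure u = (ν.withDensity fun x => ENNReal.ofReal (‖U.symm u x‖ ^ 2)).map g := by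
  ext s hs
  rw [scalarMeasure_apply E u hs, Measure.map_apply hg hs, withDensity_apply _ (hg hs), h s hs,
    specOp_apply, U.norm_map, norm_sq_eq_integral,
    ← ofReal_integral_eq_lintegral_ofReal (integrable_norm_sq _).integrableOn
      (Eventually.of_forall fun x => by positivity), ← integral_indicator (hg hs)]
  congr 1
  refine integral_congr_ae ?_
  filter_upwards [mulOp_coe (isBddMeas_indicator_one (hg hs)) (U.symm u)] with x hx
  rw [hx]
  by_cases hx : x ∈ g ⁻¹' s <;> simp [hx]

theorem Represents.integral_scalarMeasure {U : Lp ℂ 2 ν ≃ₗᵢ[ℂ] H} {g : Ω → Λ} (hg : Measurable g)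
    {E : ProjectionValuedMeasure Λ H} (h : Represents U g E) (u : H) {A : Set Λ}
    (hA : MeasurableSet A) {f : Λ → ℂ} (hf : Measurable (A.indicator f)) :
    ∫ l in A, f l ∂(E.scalarMeasure u) =
      ∫ x, A.indicator f (g x) * ((‖U.symm u x‖ ^ 2 : ℝ) : ℂ) ∂ν := by
  have hm : AEMeasurable (fun x => ENNReal.ofReal (‖U.symm u x‖ ^ 2)) ν :=
    ((Lp.stronglyMeasurable (U.symm u)).measurable.norm.pow_const 2).ennreal_ofReal.aemeasurable
  rw [← integral_indicator hA, h.scalarMeasure_eq hg, integral_map hg.aemeasurable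
    hf.aestronglyMeasurable, integral_withDensity_eq_integral_toReal_smul₀ hm
      (Eventually.of_forall fun x => ENNReal.ofReal_lt_top)]
  refine integral_congr_ae (Eventually.of_forall fun x => ?_)
  simp only
  rw [ENNReal.toReal_ofReal (by positivity), Complex.real_smul, mul_comm]

theorem Represents.isIntegralOn {U : Lp ℂ 2 ν ≃ₗᵢ[ℂ] H} {g : Ω → Λ} (hg : Measurable g)
    {E : ProjectionValuedMeasure Λ H} (h : Represents U g E) {A : Set Λ}
    (hA : MeasurableSet A) {f : Λ → ℂ} (hf : IsBddMeas (A.indicator f)) :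
    E.IsIntegralOn A f (specOp U fun x => A.indicator f (g x)) := by
  intro u
  rw [h.integral_scalarMeasure hg u hA hf.1, inner_specOp U (hf.comp hg)]

/-- Complex polarization. It is the reason why the quadratic form in `IsIntegralOn` determines the
operator. -/
theorem clm_ext_of_inner_self {T S : H →L[ℂ] H} (h : ∀ u, inner ℂ u (T u) = inner ℂ u (S u)) :
    T = S := by
  have : (T : H →ₗ[ℂ] H) = S := by
    rw [← ext_inner_map]
    intro x
    have := congrArg (starRingEnd ℂ) (h x)
    simpa using this
  exact ContinuousLinearMap.coe_injective this

theorem Represents.eq_of_isIntegralOn {U : Lp ℂ 2 ν ≃ₗᵢ[ℂ] H} {g : Ω → Λ} (hg : Measurable g)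
    {E : ProjectionValuedMeasure Λ H} (h : Represents U g E) {A : Set Λ}
    (hA : MeasurableSet A) {f : Λ → ℂ} (hf : IsBddMeas (A.indicator f)) {T : H →L[ℂ] H}
    (hT : E.IsIntegralOn A f T) : T = specOp U fun x => A.indicator f (g x) :=
  clm_ext_of_inner_self fun u => (hT u).trans (h.isIntegralOn hg hA hf u).symm

end Representation

/-! ### Existence of spectral representations -/

section Existence

variable {Λ : Type*} [MeasurableSpace Λ] {H : Type*} [NormedAddCommGroup H]
  [InnerProductSpace ℂ H]

namespace ProjectionValuedMeasure

variable (E : ProjectionValuedMeasure Λ H)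

theorem proj_proj {s t : Set Λ} (hs : MeasurableSet s) (ht : MeasurableSet t) (u : H) :
    E.proj s (E.proj t u) = E.proj (s ∩ t) u := by
  rw [E.inter s t hs ht]; rfl

/-- The closed invariant subspace generated by the first `n` terms of the sequence `u`. -/
def cyclicSpan (u : ℕ → H) (n : ℕ) : Submodule ℂ H :=
  (Submodule.span ℂ {w | ∃ i < n, ∃ s, MeasurableSet s ∧ w = E.proj s (u i)}).topologicalClosure

theorem cyclicSpan_induction {u : ℕ → H} {n : ℕ} {K : Submodule ℂ H} (hK : IsClosed (K : Set H))
    (h : ∀ i < n, ∀ s, MeasurableSet s → E.proj s (u i) ∈ K) : E.cyclicSpan u n ≤ K := by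
  refine Submodule.topologicalClosure_minimal _ ?_ hK
  rw [Submodule.span_le]
  rintro _ ⟨i, hi, s, hs, rfl⟩
  exact h i hi s hs

theorem isClosed_cyclicSpan (u : ℕ → H) (n : ℕ) : IsClosed (E.cyclicSpan u n : Set H) :=
  Submodule.isClosed_topologicalClosure _

theorem proj_mem_cyclicSpan (u : ℕ → H) {i n : ℕ} (hi : i < n) {s : Set Λ}
    (hs : MeasurableSet s) : E.proj s (u i) ∈ E.cyclicSpan u n :=
  Submodule.le_topologicalClosure _ (Submodule.subset_span ⟨i, hi, s, hs, rfl⟩)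

theorem cyclicSpan_mono (u : ℕ → H) {m n : ℕ} (h : m ≤ n) :
    E.cyclicSpan u m ≤ E.cyclicSpan u n :=
  E.cyclicSpan_induction (E.isClosed_cyclicSpan u n) fun _ hi _ hs =>
    E.proj_mem_cyclicSpan u (hi.trans_le h) hs

theorem proj_apply_mem_cyclicSpan (u : ℕ → H) (n : ℕ) {t : Set Λ} (ht : MeasurableSet t) {w : H}
    (hw : w ∈ E.cyclicSpan u n) : E.proj t w ∈ E.cyclicSpan u n := by
  have : E.cyclicSpan u n ≤ (E.cyclicSpan u n).comap (E.proj t : H →ₗ[ℂ] H) := by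
    refine E.cyclicSpan_induction ((E.isClosed_cyclicSpan u n).preimage (E.proj t).continuous) ?_
    intro i hi s hs
    change E.proj t (E.proj s (u i)) ∈ E.cyclicSpan u n
    rw [E.proj_proj ht hs]
    exact E.proj_mem_cyclicSpan u hi (ht.inter hs)
  exact this hw

/-- Gram–Schmidt on a dense sequence, with closed invariant subspaces in place of lines: `v n` is
the part of `u n` orthogonal to the cyclic span of the earlier terms. Some `v n` may vanish, which
does no harm. -/
theorem exists_cyclic_decomposition [CompleteSpace H] [TopologicalSpace.SeparableSpace H] :
    ∃ v : ℕ → H, (∀ i j, i ≠ j → ∀ s t, MeasurableSet s → MeasurableSet t →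
        inner ℂ (E.proj s (v i)) (E.proj t (v j)) = 0) ∧
      ∀ f : H, (∀ i s, MeasurableSet s → inner ℂ (E.proj s (v i)) f = 0) → f = 0 := by
  let u := TopologicalSpace.denseSeq H
  have hcl : ∀ n, CompleteSpace (E.cyclicSpan u n) := fun n =>
    (E.isClosed_cyclicSpan u n).completeSpace_coe
  let v : ℕ → H := fun n => u n - (E.cyclicSpan u n).starProjection (u n)
  have hperp : ∀ n, ∀ w ∈ E.cyclicSpan u n, inner ℂ w (v n) = 0 := fun n w hw =>
    (Submodule.mem_orthogonal _ _).1 (Submodule.sub_starProjection_mem_orthogonal (u n)) w hw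
  have hunit : ∀ w : H, E.proj Set.univ w = w := fun w => by rw [E.univ]; rfl
  have hmem : ∀ n, v n ∈ E.cyclicSpan u (n + 1) := fun n => by
    refine Submodule.sub_mem _ ?_ (E.cyclicSpan_mono u n.le_succ
      (Submodule.starProjection_apply_mem _ _))
    simpa only [hunit] using E.proj_mem_cyclicSpan u n.lt_succ_self MeasurableSet.univ
  have hlt : ∀ i j, i < j → ∀ s t, MeasurableSet s → MeasurableSet t →
      inner ℂ (E.proj s (v i)) (E.proj t (v j)) = 0 := by
    intro i j hij s t hs ht
    rw [← E.symm t ht]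
    exact hperp j _ (E.proj_apply_mem_cyclicSpan u j ht (E.proj_apply_mem_cyclicSpan u j hs
      (E.cyclicSpan_mono u hij (hmem i))))
  refine ⟨v, ?_, ?_⟩
  · intro i j hij s t hs ht
    rcases lt_or_gt_of_ne hij with h | h
    · exact hlt i j h s t hs ht
    · rw [← inner_conj_symm, hlt j i h t s ht hs, map_zero]
  · intro f hf
    have hK : IsClosed ((LinearMap.ker (innerSL ℂ f : H →ₗ[ℂ] ℂ) : Submodule ℂ H) : Set H) :=
      isClosed_singleton.preimage (innerSL ℂ f).continuous
    have hKm : ∀ w : H, w ∈ LinearMap.ker (innerSL ℂ f : H →ₗ[ℂ] ℂ) ↔ inner ℂ w f = 0 := by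
      intro w
      rw [LinearMap.mem_ker]
      change inner ℂ f w = 0 ↔ _
      exact inner_eq_zero_symm
    -- Strong induction: `u n` is `v n` plus an element of the cyclic span of the earlier terms, and
    -- `f` is already orthogonal to that invariant subspace.
    have hall : ∀ n, ∀ s, MeasurableSet s → inner ℂ (E.proj s (u n)) f = 0 := by
      intro n
      induction n using Nat.strong_induction_on with
      | _ n ih =>
        intro s hs
        have h1 : E.cyclicSpan u n ≤ LinearMap.ker (innerSL ℂ f : H →ₗ[ℂ] ℂ) :=
          E.cyclicSpan_induction hK fun i hi t ht => (hKm _).2 (ih i hi t ht)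
        have h2 : u n = v n + (E.cyclicSpan u n).starProjection (u n) := by simp [v]
        rw [h2, map_add, inner_add_left, hf n s hs, zero_add]
        exact (hKm _).1 (h1 (E.proj_apply_mem_cyclicSpan u n hs
          (Submodule.starProjection_apply_mem _ _)))
    have hz : ∀ w, inner ℂ w f = 0 := by
      intro w
      refine (TopologicalSpace.denseRange_denseSeq H).induction (P := fun w => inner ℂ w f = 0)
        ?_ (isClosed_eq (by fun_prop) (by fun_prop)) w
      rintro _ ⟨n, rfl⟩
      simpa only [hunit] using hall n Set.univ MeasurableSet.univ
    exact inner_self_eq_zero.1 (hz f)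

theorem inner_proj_proj (u : H) {s t : Set Λ} (hs : MeasurableSet s) (ht : MeasurableSet t) :
    inner ℂ (E.proj s u) (E.proj t u) = ((E.scalarMeasure u).real (s ∩ t) : ℂ) := by
  rw [E.symm s hs, E.proj_proj hs ht, E.inner_proj (hs.inter ht), measureReal_def,
    scalarMeasure_apply E u (hs.inter ht), ENNReal.toReal_ofReal (by positivity)]

/-- The cyclic subspace of each `v n` is a copy of L² of its scalar measure. Stacking these copies
over ℕ gives ν, and the isometry is the one that sends the indicator of {n} × s to E(s) v_n. -/
theorem exists_representation [CompleteSpace H] [TopologicalSpace.SeparableSpace H] :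
    ∃ ν : Measure (ℕ × Λ), SigmaFinite ν ∧ ∃ U : Lp ℂ 2 ν ≃ₗᵢ[ℂ] H, Represents U Prod.snd E := by
  obtain ⟨v, hv1, hv2⟩ := E.exists_cyclic_decomposition
  let ν : Measure (ℕ × Λ) := Measure.sum fun n => (E.scalarMeasure (v n)).map (Prod.mk n)
  have hν : ∀ (n : ℕ) (s : Set Λ), MeasurableSet s →
      ν ({n} ×ˢ s) = E.scalarMeasure (v n) s := by
    intro n s hs
    have hms : MeasurableSet (({n} : Set ℕ) ×ˢ s) := (measurableSet_singleton n).prod hs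
    rw [Measure.sum_apply _ hms, tsum_eq_single n]
    · rw [Measure.map_apply measurable_prodMk_left hms]
      congr 1
      ext x; simp
    · intro m hm
      rw [Measure.map_apply measurable_prodMk_left hms]
      have : Prod.mk m ⁻¹' (({n} : Set ℕ) ×ˢ s) = ∅ := by
        ext x; simp [hm]
      rw [this, measure_empty]
  have hfin : ∀ (n : ℕ) (s : Set Λ), MeasurableSet s → ν ({n} ×ˢ s) ≠ ⊤ := fun n s hs => by
    rw [hν n s hs]; exact measure_ne_top _ _
  have hσ : SigmaFinite ν := by
    refine ⟨⟨⟨fun n => {n} ×ˢ Set.univ, fun _ => trivial, fun n =>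
      (hfin n _ MeasurableSet.univ).lt_top, ?_⟩⟩⟩
    ext ⟨n, x⟩
    simp
  let a : ℕ × {s : Set Λ // MeasurableSet s} → Lp ℂ 2 ν := fun i =>
    indicatorConstLp 2 ((measurableSet_singleton i.1).prod i.2.2) (hfin i.1 _ i.2.2) (1 : ℂ)
  let b : ℕ × {s : Set Λ // MeasurableSet s} → H := fun i => E.proj i.2.1 (v i.1)
  have hinter : ∀ (n m : ℕ) (s t : Set Λ), n ≠ m →
      (({n} : Set ℕ) ×ˢ s) ∩ (({m} : Set ℕ) ×ˢ t) = ∅ := by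
    intro n m s t hnm
    rw [Set.prod_inter_prod, Set.singleton_inter_eq_empty.2 (by simpa using hnm), Set.empty_prod]
  have hab : ∀ i j, inner ℂ (a i) (a j) = inner ℂ (b i) (b j) := by
    rintro ⟨n, s, hs⟩ ⟨m, t, ht⟩
    rw [L2.inner_indicatorConstLp_one]
    have h1 : ∫ x in ({n} : Set ℕ) ×ˢ s, a (m, ⟨t, ht⟩) x ∂ν
        = (ν.real ((({m} : Set ℕ) ×ˢ t) ∩ (({n} : Set ℕ) ×ˢ s)) : ℂ) := by
      rw [setIntegral_indicatorConstLp ((measurableSet_singleton n).prod hs)]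
      simp
    rw [h1]
    by_cases hnm : n = m
    · subst hnm
      simp only [b]
      rw [E.inner_proj_proj _ hs ht, Set.prod_inter_prod, Set.inter_self, measureReal_def,
        hν n _ (ht.inter hs), measureReal_def, Set.inter_comm]
    · simp only [b]
      rw [hv1 n m hnm s t hs ht, hinter m n t s (Ne.symm hnm)]
      simp
  have ha : ∀ f : Lp ℂ 2 ν, (∀ i, inner ℂ (a i) f = 0) → f = 0 := by
    intro f hf
    have h0 : ∀ (n : ℕ) (s : Set Λ), MeasurableSet s → ∫ x in ({n} : Set ℕ) ×ˢ s, f x ∂ν = 0 := by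
      intro n s hs
      have := hf (n, ⟨s, hs⟩)
      rwa [L2.inner_indicatorConstLp_one] at this
    have h1 : ∀ n : ℕ, f =ᵐ[ν.restrict (({n} : Set ℕ) ×ˢ Set.univ)] 0 := by
      intro n
      have hfm : IsFiniteMeasure (ν.restrict (({n} : Set ℕ) ×ˢ (Set.univ : Set Λ))) :=
        ⟨by rw [Measure.restrict_apply_univ]; exact (hfin n _ MeasurableSet.univ).lt_top⟩
      refine ae_eq_zero_of_piSystem generateFrom_prod.symm isPiSystem_prod
        (((Lp.memLp f).restrict _).integrable one_le_two) (h0 n _ MeasurableSet.univ) ?_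
      rintro _ ⟨A, hA, s, hs, rfl⟩
      rw [Measure.restrict_restrict (MeasurableSet.prod (show MeasurableSet A from hA) hs), Set.prod_inter_prod,
        Set.inter_univ]
      by_cases hn : n ∈ A
      · rw [Set.inter_singleton_of_mem hn]
        exact h0 n s hs
      · rw [Set.inter_singleton_eq_empty.2 hn]
        simp
    have h2 : (⋃ n : ℕ, ({n} : Set ℕ) ×ˢ (Set.univ : Set Λ)) = Set.univ := by
      ext ⟨n, x⟩; simp
    apply Lp.ext
    have h3 : f =ᵐ[ν] (0 : ℕ × Λ → ℂ) := by
      have h4 := (ae_restrict_iUnion_iff (μ := ν) (fun n : ℕ => ({n} : Set ℕ) ×ˢ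
        (Set.univ : Set Λ)) (fun x => f x = 0)).2 h1
      rwa [h2, Measure.restrict_univ] at h4
    exact h3.trans (Lp.coeFn_zero _ _ _).symm
  obtain ⟨U, hU⟩ := exists_isometryEquiv_of_inner_eq a b hab ha
    (fun f hf => hv2 f fun i s hs => hf (i, ⟨s, hs⟩))
  refine ⟨ν, hσ, U, fun s hs => ?_⟩
  have hms : MeasurableSet (Prod.snd ⁻¹' s : Set (ℕ × Λ)) := measurable_snd hs
  -- Both sides are continuous, so the total family `a` suffices; there multiplication of indicators
  -- mirrors E(s)E(t) = E(s ∩ t).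
  have hkey : (E.proj s) ∘L (U.toContinuousLinearEquiv : Lp ℂ 2 ν →L[ℂ] H) =
      (U.toContinuousLinearEquiv : Lp ℂ 2 ν →L[ℂ] H) ∘L
        mulOp ν ((Prod.snd ⁻¹' s).indicator fun _ => 1) := by
    refine ContinuousLinearMap.ext_on (s := Set.range a) ?_ ?_
    · rw [Submodule.dense_iff_topologicalClosure_eq_top]
      exact dense_span_of_orthogonal a ha
    · rintro _ ⟨⟨n, t, ht⟩, rfl⟩
      change E.proj s (U (a (n, ⟨t, ht⟩))) = U (mulOp ν _ (a (n, ⟨t, ht⟩)))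
      have h1 : mulOp ν ((Prod.snd ⁻¹' s).indicator fun _ => 1) (a (n, ⟨t, ht⟩))
          = a (n, ⟨s ∩ t, hs.inter ht⟩) := by
        apply Lp.ext
        filter_upwards [mulOp_coe (isBddMeas_indicator_one hms) (a (n, ⟨t, ht⟩)),
          indicatorConstLp_coeFn (p := 2) (hs := (measurableSet_singleton n).prod ht)
            (hμs := hfin n _ ht) (c := (1 : ℂ)),
          indicatorConstLp_coeFn (p := 2) (hs := (measurableSet_singleton n).prod (hs.inter ht))
            (hμs := hfin n _ (hs.inter ht)) (c := (1 : ℂ))] with x h1 h2 h3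
        rw [h1]
        simp only [a]
        rw [h2, h3]
        obtain ⟨m, x⟩ := x
        by_cases hm : m = n <;> by_cases hxs : x ∈ s <;> by_cases hxt : x ∈ t <;>
          simp [indicator, hm, hxs, hxt]
      rw [h1, hU, hU]
      exact E.proj_proj hs ht _
  ext u
  have := congrArg (fun T : Lp ℂ 2 ν →L[ℂ] H => T (U.symm u)) hkey
  simpa [specOp_apply] using this

end ProjectionValuedMeasure

end Existence

/-! ### Tensor products of `L²` functions -/

section Tensor

variable {N : ℕ} {X : Fin N → Type*} [∀ k, MeasurableSpace (X k)] {μ : ∀ k, Measure (X k)}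
  [∀ k, SigmaFinite (μ k)]

theorem ae_pi_of_ae {k : Fin N} {P : X k → Prop} (h : ∀ᵐ x ∂(μ k), P x) :
    ∀ᵐ x ∂(Measure.pi μ), P (x k) :=
  (Measure.quasiMeasurePreserving_eval μ k).ae h

theorem ae_pi_forall_of_ae {P : ∀ k, X k → Prop} (h : ∀ k, ∀ᵐ x ∂(μ k), P k x) :
    ∀ᵐ x ∂(Measure.pi μ), ∀ k, P k (x k) :=
  ae_all_iff.2 fun k => ae_pi_of_ae (h k)

theorem measurable_tensor {f : ∀ k, X k → ℂ} (hf : ∀ k, Measurable (f k)) :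
    Measurable (fun x : ∀ k, X k => ∏ k, f k (x k)) :=
  Finset.measurable_prod _ fun k _ => (hf k).comp (measurable_pi_apply k)

theorem memLp_tensor {f : ∀ k, X k → ℂ} (hf : ∀ k, Measurable (f k))
    (hf' : ∀ k, MemLp (f k) 2 (μ k)) :
    MemLp (fun x : ∀ k, X k => ∏ k, f k (x k)) 2 (Measure.pi μ) := by
  rw [memLp_two_iff_integrable_sq_norm (measurable_tensor hf).aestronglyMeasurable]
  have := Integrable.fintype_prod_dep (μ := μ) (f := fun k x => ‖f k x‖ ^ 2)
    fun k => (memLp_two_iff_integrable_sq_norm (hf' k).1).1 (hf' k)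
  refine this.congr (Eventually.of_forall fun x => ?_)
  simp [norm_prod, Finset.prod_pow]

/-- The tensor product of `L²` functions. -/
def tensorLp (u : ∀ k, Lp ℂ 2 (μ k)) : Lp ℂ 2 (Measure.pi μ) :=
  (memLp_tensor (fun k => (Lp.stronglyMeasurable (u k)).measurable)
    (fun k => Lp.memLp (u k))).toLp _

theorem tensorLp_coe (u : ∀ k, Lp ℂ 2 (μ k)) :
    tensorLp u =ᵐ[Measure.pi μ] fun x => ∏ k, u k (x k) := MemLp.coeFn_toLp _

theorem isTensor_tensorLp (u : ∀ k, Lp ℂ 2 (μ k)) : IsTensor u (tensorLp u) := tensorLp_coe u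

theorem IsTensor.eq {u : ∀ k, Lp ℂ 2 (μ k)} {w : Lp ℂ 2 (Measure.pi μ)} (h : IsTensor u w) :
    w = tensorLp u := by
  apply Lp.ext
  filter_upwards [h, tensorLp_coe u] with x h1 h2
  rw [h1, h2]

theorem inner_tensorLp (u v : ∀ k, Lp ℂ 2 (μ k)) :
    inner ℂ (tensorLp u) (tensorLp v) = ∏ k, inner ℂ (u k) (v k) := by
  simp_rw [L2_inner_eq]
  rw [← integral_fintype_prod_eq_prod (𝕜 := ℂ) (μ := μ)
    (fun k x => (starRingEnd ℂ) (u k x) * v k x)]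
  refine integral_congr_ae ?_
  filter_upwards [tensorLp_coe u, tensorLp_coe v] with x h1 h2
  rw [h1, h2, map_prod, Finset.prod_mul_distrib]

theorem iUnion_pi_spanningSets :
    (⋃ n, Set.univ.pi fun k => spanningSets (μ k) n) = Set.univ := by
  refine eq_univ_of_forall fun x => mem_iUnion.2 ?_
  refine ⟨Finset.univ.sup fun k => spanningSetsIndex (μ k) (x k), fun k _ => ?_⟩
  exact monotone_spanningSets (μ k)
    (Finset.le_sup (f := fun k => spanningSetsIndex (μ k) (x k)) (Finset.mem_univ k))
    (mem_spanningSetsIndex (μ k) (x k))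

/-- Indicators of boxes of finite measure are tensors, and boxes form a generating π-system. The
argument is run on products of spanning sets, where f is integrable. -/
theorem eq_zero_of_inner_tensorLp (f : Lp ℂ 2 (Measure.pi μ))
    (hf : ∀ u : ∀ k, Lp ℂ 2 (μ k), inner ℂ (tensorLp u) f = 0) : f = 0 := by
  have h0 : ∀ A : ∀ k, Set (X k), (∀ k, MeasurableSet (A k)) → (∀ k, μ k (A k) ≠ ⊤) →
      ∫ x in Set.univ.pi A, f x ∂(Measure.pi μ) = 0 := by
    intro A hA hA'
    rw [← hf fun k => indicatorConstLp 2 (hA k) (hA' k) (1 : ℂ), L2_inner_eq,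
      ← integral_indicator (MeasurableSet.univ_pi hA)]
    refine integral_congr_ae ?_
    filter_upwards [tensorLp_coe fun k => indicatorConstLp 2 (hA k) (hA' k) (1 : ℂ),
      ae_pi_forall_of_ae fun k => indicatorConstLp_coeFn (p := 2) (hs := hA k) (hμs := hA' k)
        (c := (1 : ℂ))] with x h1 h2
    rw [h1]
    simp only [h2]
    by_cases hx : x ∈ Set.univ.pi A
    · have : ∀ k, x k ∈ A k := fun k => hx k (mem_univ k)
      simp [hx, this]
    · rw [indicator_of_notMem hx]
      obtain ⟨k, hk⟩ : ∃ k, x k ∉ A k := by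
        by_contra! h
        exact hx fun k _ => h k
      rw [Finset.prod_eq_zero (Finset.mem_univ k) (indicator_of_notMem hk _)]
      simp
  have hfinS : ∀ n k, μ k (spanningSets (μ k) n) ≠ ⊤ := fun n k =>
    (measure_spanningSets_lt_top (μ k) n).ne
  have h1 : ∀ n, ∀ᵐ x ∂((Measure.pi μ).restrict (Set.univ.pi fun k => spanningSets (μ k) n)),
      f x = 0 := by
    intro n
    have hfin : IsFiniteMeasure
        ((Measure.pi μ).restrict (Set.univ.pi fun k => spanningSets (μ k) n)) := by
      refine ⟨?_⟩
      rw [Measure.restrict_apply_univ, Measure.pi_pi]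
      exact ENNReal.prod_lt_top fun k _ => measure_spanningSets_lt_top (μ k) n
    refine ae_eq_zero_of_piSystem generateFrom_pi.symm isPiSystem_pi
      (((Lp.memLp f).restrict _).integrable one_le_two)
      (h0 _ (fun k => measurableSet_spanningSets (μ k) n) (hfinS n)) ?_
    rintro _ ⟨s, hs, rfl⟩
    have hs' : ∀ k, MeasurableSet (s k) := fun k => hs k (mem_univ k)
    rw [Measure.restrict_restrict (MeasurableSet.univ_pi hs'), ← Set.pi_inter_distrib]
    exact h0 _ (fun k => (hs' k).inter (measurableSet_spanningSets (μ k) n)) fun k =>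
      measure_inter_ne_top_of_right_ne_top (hfinS n k)
  apply Lp.ext
  have h3 : ∀ᵐ x ∂(Measure.pi μ), f x = 0 := by
    have h4 := (ae_restrict_iUnion_iff (μ := Measure.pi μ)
      (fun n => Set.univ.pi fun k => spanningSets (μ k) n) (fun x => f x = 0)).2 h1
    rwa [iUnion_pi_spanningSets, Measure.restrict_univ] at h4
  filter_upwards [h3, Lp.coeFn_zero ℂ 2 (Measure.pi μ)] with x hx hx'
  rw [hx, hx', Pi.zero_apply]

variable {Ω : Fin N → Type*} [∀ k, MeasurableSpace (Ω k)] {ν : ∀ k, Measure (Ω k)}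
  [∀ k, SigmaFinite (ν k)]

/-- Inner products of tensors are products of inner products, so the isometries `U k` preserve the
Gram matrix of the total family of tensors. -/
theorem exists_tensor_isometryEquiv (U : ∀ k, Lp ℂ 2 (ν k) ≃ₗᵢ[ℂ] Lp ℂ 2 (μ k)) :
    ∃ V : Lp ℂ 2 (Measure.pi ν) ≃ₗᵢ[ℂ] Lp ℂ 2 (Measure.pi μ),
      ∀ f : ∀ k, Lp ℂ 2 (ν k), V (tensorLp f) = tensorLp fun k => U k (f k) := by
  refine exists_isometryEquiv_of_inner_eq (ι := ∀ k, Lp ℂ 2 (ν k)) tensorLp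
    (fun f => tensorLp fun k => U k (f k)) ?_ eq_zero_of_inner_tensorLp ?_
  · intro f g
    rw [inner_tensorLp, inner_tensorLp]
    simp
  · intro w hw
    refine eq_zero_of_inner_tensorLp w fun u => ?_
    have := hw fun k => (U k).symm (u k)
    simpa using this

theorem specOp_tensorLp {U : ∀ k, Lp ℂ 2 (ν k) ≃ₗᵢ[ℂ] Lp ℂ 2 (μ k)}
    {V : Lp ℂ 2 (Measure.pi ν) ≃ₗᵢ[ℂ] Lp ℂ 2 (Measure.pi μ)}
    (hV : ∀ f : ∀ k, Lp ℂ 2 (ν k), V (tensorLp f) = tensorLp fun k => U k (f k))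
    {m : ∀ k, Ω k → ℂ} (hm : ∀ k, IsBddMeas (m k)) (u : ∀ k, Lp ℂ 2 (μ k)) :
    specOp V (fun o => ∏ k, m k (o k)) (tensorLp u) =
      tensorLp fun k => specOp (U k) (m k) (u k) := by
  have h1 : V.symm (tensorLp u) = tensorLp fun k => (U k).symm (u k) := by
    rw [LinearIsometryEquiv.symm_apply_eq, hV]
    simp
  have h2 : mulOp (Measure.pi ν) (fun o => ∏ k, m k (o k))
      (tensorLp fun k => (U k).symm (u k)) =
      tensorLp fun k => mulOp (ν k) (m k) ((U k).symm (u k)) := by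
    apply Lp.ext
    filter_upwards [mulOp_coe (ν := Measure.pi ν)
        (IsBddMeas.prod (s := Finset.univ) fun k _ => (hm k).comp (measurable_pi_apply k))
        (tensorLp fun k => (U k).symm (u k)), tensorLp_coe fun k => (U k).symm (u k),
      tensorLp_coe fun k => mulOp (ν k) (m k) ((U k).symm (u k)),
      ae_pi_forall_of_ae fun k => mulOp_coe (hm k) ((U k).symm (u k))] with x h1 h2 h3 h4
    rw [h1, h2, h3, ← Finset.prod_mul_distrib]
    exact Finset.prod_congr rfl fun k _ => (h4 k).symm
  rw [specOp_apply, h1, h2, hV]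
  rfl

/-- The indicator of a box, pulled back coordinatewise, is a product of indicators, and product
multipliers act factor by factor on tensors. -/
theorem isJointResolution_pvmOfRep {U : ∀ k, Lp ℂ 2 (ν k) ≃ₗᵢ[ℂ] Lp ℂ 2 (μ k)}
    {V : Lp ℂ 2 (Measure.pi ν) ≃ₗᵢ[ℂ] Lp ℂ 2 (Measure.pi μ)}
    (hV : ∀ f : ∀ k, Lp ℂ 2 (ν k), V (tensorLp f) = tensorLp fun k => U k (f k))
    {g : ∀ k, Ω k → ℝ} (hg : ∀ k, Measurable (g k))
    {E : ∀ k, ProjectionValuedMeasure ℝ (Lp ℂ 2 (μ k))} (hE : ∀ k, Represents (U k) (g k) (E k))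
    (hG : Measurable fun (o : ∀ k, Ω k) k => g k (o k)) :
    IsJointResolution E (pvmOfRep V (fun o k => g k (o k)) hG) := by
  intro s hs u w hw
  rw [hw.eq]
  have h1 : (pvmOfRep V (fun o k => g k (o k)) hG).proj (Set.univ.pi s) =
      specOp V fun o => ∏ k, ((g k ⁻¹' (s k)).indicator (fun _ => (1 : ℂ))) (o k) := by
    change specOp V _ = _
    congr 1
    ext o
    by_cases ho : ∀ k, g k (o k) ∈ s k
    · simp [indicator, ho]
    · obtain ⟨k, hk⟩ := not_forall.1 ho
      rw [Finset.prod_eq_zero (Finset.mem_univ k)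
        (indicator_of_notMem (show o k ∉ g k ⁻¹' s k from hk) _),
        indicator_of_notMem (show o ∉ (fun (o : ∀ k, Ω k) k => g k (o k)) ⁻¹' Set.univ.pi s from
          fun h => hk (h k (mem_univ k)))]
  rw [h1, specOp_tensorLp hV (fun k => isBddMeas_indicator_one (hg k (hs k)))]
  have h2 : (fun k => specOp (U k) ((g k ⁻¹' s k).indicator fun _ => 1) (u k)) =
      fun k => (E k).proj (s k) (u k) := by
    ext1 k
    rw [hE k (s k) (hs k)]
  rw [h2]
  exact isTensor_tensorLp _

end Tensor

/-! ### Doubling measures -/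

section Doubling

variable {X : Type*} [MetricSpace X] [MeasurableSpace X] [BorelSpace X] {μ : Measure X}

theorem IsDoubling.sigmaFinite (h : IsDoubling μ) : SigmaFinite μ := by
  rcases isEmpty_or_nonempty X with hX | ⟨⟨x⟩⟩
  · have : μ = 0 := Measure.eq_zero_of_isEmpty μ
    rw [this]; infer_instance
  · refine ⟨⟨⟨fun n => Metric.ball x (n + 1), fun _ => trivial, fun n =>
      (h.1 x (n + 1) (by positivity)).2, ?_⟩⟩⟩
    refine eq_univ_of_forall fun y => mem_iUnion.2 ?_
    obtain ⟨n, hn⟩ := exists_nat_gt (dist y x)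
    exact ⟨n, by rw [Metric.mem_ball]; linarith⟩

/-- Take a maximal ε-separated set. Balls of radius ε/2 about its points are disjoint with positive
measure, so σ-finiteness makes the set countable, and maximality makes it ε-dense. -/
theorem IsDoubling.secondCountableTopology (h : IsDoubling μ) : SecondCountableTopology X := by
  have hσ := h.sigmaFinite
  refine Metric.secondCountable_of_almost_dense_set fun ε hε => ?_
  obtain ⟨s, hs⟩ := zorn_subset {s : Set X | s.Pairwise fun x y => ε ≤ dist x y} (by
    intro c hc hchain
    refine ⟨⋃₀ c, ?_, fun t ht => subset_sUnion_of_mem ht⟩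
    exact (pairwise_sUnion hchain.directedOn).2 fun t ht => hc ht)
  refine ⟨s, ?_, fun x => ?_⟩
  · have := Measure.countable_meas_pos_of_disjoint_iUnion (μ := μ)
      (As := fun x : s => Metric.ball (x : X) (ε / 2)) (fun x => measurableSet_ball) (by
        intro x y hxy
        refine Metric.ball_disjoint_ball ?_
        have := hs.prop x.2 y.2 (fun h => hxy (Subtype.ext h))
        simp only at this
        linarith)
    have h2 : {i : s | 0 < μ (Metric.ball (i : X) (ε / 2))} = univ :=
      eq_univ_of_forall fun x => (h.1 x (ε / 2) (by positivity)).1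
    rw [h2] at this
    exact countable_coe_iff.1 (countable_univ_iff.1 this)
  · by_contra! hx
    have hins : insert x s ∈ {s : Set X | s.Pairwise fun x y => ε ≤ dist x y} := by
      refine hs.prop.insert fun y hy _ => ⟨(hx y hy).le, ?_⟩
      rw [dist_comm]
      exact (hx y hy).le
    have := hs.le_of_ge hins (subset_insert x s) (mem_insert x s)
    have h3 := hx x this
    rw [dist_self] at h3
    exact absurd h3 (not_lt.2 hε.le)

theorem IsDoubling.exists_integrable (h : IsDoubling μ) :
    ∃ M : ℕ, ∀ x, Integrable (fun y => ((1 + dist x y) ^ M)⁻¹) μ := by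
  obtain ⟨hfin, C, hC⟩ := h
  have hball : ∀ (x : X) (k : ℕ),
      μ (Metric.ball x (2 ^ k)) ≤ (C : ℝ≥0∞) ^ k * μ (Metric.ball x 1) := by
    intro x k
    induction k with
    | zero => simp
    | succ k ih =>
      rw [pow_succ', pow_succ', mul_assoc]
      exact (hC x (2 ^ k) (by positivity)).trans (mul_le_mul_right ih _)
  -- With 2^M larger than the doubling constant, the sum over dyadic balls is dominated by a
  -- geometric series of ratio C/2^M < 1.
  obtain ⟨M, hM⟩ := pow_unbounded_of_one_lt C (one_lt_two)
  refine ⟨M, fun x => ?_⟩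
  have hmeas : Measurable fun y => ((1 + dist x y) ^ M)⁻¹ :=
    (((continuous_const.dist continuous_id).const_add 1).pow M).measurable.inv
  refine ⟨hmeas.aestronglyMeasurable, ?_⟩
  let r : ℝ≥0∞ := ((2 : ℝ≥0∞) ^ M)⁻¹ * C
  have hr : r < 1 := by
    have h2 : (C : ℝ≥0∞) < 2 ^ M := by exact_mod_cast hM
    have h3 : (2 : ℝ≥0∞) ^ M ≠ ⊤ := by simp
    calc r < ((2 : ℝ≥0∞) ^ M)⁻¹ * 2 ^ M :=
          (ENNReal.mul_lt_mul_iff_right (by simp) (by simp)).2 h2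
      _ = 1 := ENNReal.inv_mul_cancel (by simp) h3
  -- One term of the series is enough: for the least k with dist < 2^k one has 2^k ≤ 2(1 + dist),
  -- which accounts for the factor 2^M.
  have hpt : ∀ y, ‖((1 + dist x y) ^ M)⁻¹‖ₑ ≤ ∑' k : ℕ, (2 : ℝ≥0∞) ^ M * (((2 : ℝ≥0∞) ^ M)⁻¹) ^ k *
      (Metric.ball x (2 ^ k)).indicator 1 y := by
    intro y
    have hex : ∃ k : ℕ, dist y x < 2 ^ k := pow_unbounded_of_one_lt _ one_lt_two
    classical
    let k := Nat.find hex
    have hk : dist y x < 2 ^ k := Nat.find_spec hex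
    refine le_trans ?_ (ENNReal.le_tsum k)
    rw [indicator_of_mem (Metric.mem_ball.2 hk), Pi.one_apply, mul_one]
    have hreal : ((1 + dist x y) ^ M)⁻¹ ≤ 2 ^ M * (((2 : ℝ) ^ M)⁻¹) ^ k := by
      have hd : 2 ^ k ≤ 2 * (1 + dist x y) := by
        rcases Nat.eq_zero_or_pos k with h0 | h0
        · rw [h0]
          have := dist_nonneg (x := x) (y := y)
          linarith
        · have h1 : ¬ dist y x < 2 ^ (k - 1) := Nat.find_min hex (Nat.sub_lt h0 one_pos)
          obtain ⟨m, hm⟩ := Nat.exists_eq_succ_of_ne_zero h0.ne'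
          rw [hm, Nat.succ_sub_one, not_lt, dist_comm] at h1
          rw [hm, Nat.succ_eq_add_one, pow_succ]
          linarith
      have h2 : ((2 : ℝ) ^ k) ^ M ≤ 2 ^ M * (1 + dist x y) ^ M := by
        rw [← mul_pow]
        exact pow_le_pow_left₀ (by positivity) hd M
      have hpos : 0 < (1 + dist x y) ^ M := by positivity
      rw [inv_pow, ← pow_mul, mul_comm M k, pow_mul, inv_le_iff_one_le_mul₀ hpos,
        mul_assoc, mul_comm _ ((1 + dist x y) ^ M), ← mul_assoc, ← div_eq_mul_inv,
        le_div_iff₀ (by positivity), one_mul]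
      exact h2
    have hnn : 0 ≤ ((1 + dist x y) ^ M)⁻¹ := by positivity
    rw [Real.enorm_eq_ofReal hnn]
    refine (ENNReal.ofReal_le_ofReal hreal).trans (le_of_eq ?_)
    rw [ENNReal.ofReal_mul (by positivity), ENNReal.ofReal_pow (by positivity),
      ENNReal.ofReal_pow (by positivity), ENNReal.ofReal_inv_of_pos (by positivity),
      ENNReal.ofReal_pow (by positivity)]
    simp
  calc ∫⁻ y, ‖((1 + dist x y) ^ M)⁻¹‖ₑ ∂μ
      ≤ ∫⁻ y, ∑' k : ℕ, (2 : ℝ≥0∞) ^ M * (((2 : ℝ≥0∞) ^ M)⁻¹) ^ k *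
        (Metric.ball x (2 ^ k)).indicator 1 y ∂μ := lintegral_mono hpt
    _ = ∑' k : ℕ, (2 : ℝ≥0∞) ^ M * (((2 : ℝ≥0∞) ^ M)⁻¹) ^ k * μ (Metric.ball x (2 ^ k)) := by
        rw [lintegral_tsum fun k => by
          exact ((measurable_one.indicator measurableSet_ball).const_mul _).aemeasurable]
        congr 1
        ext k
        rw [lintegral_const_mul _ (measurable_one.indicator measurableSet_ball),
          lintegral_indicator_one measurableSet_ball]
    _ ≤ ∑' k : ℕ, (2 : ℝ≥0∞) ^ M * μ (Metric.ball x 1) * r ^ k := by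
        refine ENNReal.tsum_le_tsum fun k => ?_
        refine (mul_le_mul_right (hball x k) _).trans (le_of_eq ?_)
        simp only [r, mul_pow]
        ring
    _ = (2 : ℝ≥0∞) ^ M * μ (Metric.ball x 1) * (1 - r)⁻¹ := by
        rw [ENNReal.tsum_mul_left, ENNReal.tsum_geometric]
    _ < ⊤ := by
        refine ENNReal.mul_lt_top (ENNReal.mul_lt_top (by simp) (hfin x 1 one_pos).2) ?_
        rw [ENNReal.inv_lt_top]
        exact tsub_pos_of_lt hr

end Doubling

/-! ### Exponential decay against polynomial growth -/

theorem exists_pow_mul_exp_le (M : ℕ) {c q : ℝ} (hc : 0 < c) (hq : 0 < q) :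
    ∃ C : ℝ, 0 < C ∧ ∀ r : ℝ, 0 ≤ r → (1 + r) ^ M * Real.exp (-(c * r ^ q)) ≤ C := by
  -- For r ≥ 1 this gives r^M ≤ (r^q)^n, and the n-th term of the exponential series bounds that;
  -- 2^M comes from 1 + r ≤ 2 max(1, r).
  obtain ⟨n, hn⟩ := exists_nat_ge ((M : ℝ) / q)
  refine ⟨2 ^ M * (1 + n.factorial / c ^ n), by positivity, fun r hr => ?_⟩
  have hexp1 : Real.exp (-(c * r ^ q)) ≤ 1 := by
    rw [Real.exp_le_one_iff]
    have := Real.rpow_nonneg hr q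
    nlinarith
  have hpos : (0 : ℝ) ≤ n.factorial / c ^ n := by positivity
  rcases le_total r 1 with h1 | h1
  · calc (1 + r) ^ M * Real.exp (-(c * r ^ q)) ≤ 2 ^ M * 1 := by
          refine mul_le_mul (pow_le_pow_left₀ (by linarith) (by linarith) M) hexp1
            (Real.exp_pos _).le (by positivity)
      _ ≤ _ := mul_le_mul_of_nonneg_left (by linarith) (by positivity)
  · have h2 : r ^ M ≤ (r ^ q) ^ n := by
      rw [← Real.rpow_natCast, ← Real.rpow_natCast, ← Real.rpow_mul hr]
      refine Real.rpow_le_rpow_of_exponent_le h1 ?_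
      rw [div_le_iff₀ hq] at hn
      linarith
    have h3 := Real.pow_div_factorial_le_exp (c * r ^ q) (by positivity) n
    have h4 : (r ^ q) ^ n * Real.exp (-(c * r ^ q)) ≤ n.factorial / c ^ n := by
      rw [div_le_iff₀ (by positivity), mul_pow] at h3
      rw [le_div_iff₀ (by positivity), Real.exp_neg, mul_assoc, inv_mul_eq_div, mul_div_assoc',
        div_le_iff₀ (Real.exp_pos _)]
      linarith
    calc (1 + r) ^ M * Real.exp (-(c * r ^ q))
        ≤ (2 ^ M * (r ^ q) ^ n) * Real.exp (-(c * r ^ q)) := by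
          refine mul_le_mul_of_nonneg_right ?_ (Real.exp_pos _).le
          calc (1 + r) ^ M ≤ (2 * r) ^ M := pow_le_pow_left₀ (by linarith) (by linarith) M
            _ = 2 ^ M * r ^ M := mul_pow _ _ _
            _ ≤ _ := mul_le_mul_of_nonneg_left h2 (by positivity)
      _ ≤ _ := by
          rw [mul_assoc]
          exact mul_le_mul_of_nonneg_left (by linarith) (by positivity)

/-! ### Kernel bounds from integrals -/

section KernelBounds

variable {X : Type*} [MeasurableSpace X] {μ : Measure X}

/-- For each complex c the real function Re(cf) is at most M|c| almost everywhere. A countable dense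
set of c handles all c at once, and c = conj f(x) gives the bound on |f(x)|. -/
theorem ae_norm_le_of_forall_setIntegral [SigmaFinite μ] {f : X → ℂ} {M : ℝ}
    (hf : ∀ s, MeasurableSet s → μ s < ⊤ → IntegrableOn f s μ)
    (h : ∀ s, MeasurableSet s → μ s < ⊤ → ‖∫ x in s, f x ∂μ‖ ≤ M * μ.real s) :
    ∀ᵐ x ∂μ, ‖f x‖ ≤ M := by
  have h1 : ∀ n c, ∀ᵐ x ∂(μ.restrict (spanningSets μ n)), (c * f x).re ≤ M * ‖c‖ := by
    intro n c
    have hS := measurableSet_spanningSets μ n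
    have hfin := measure_spanningSets_lt_top μ n
    have : IsFiniteMeasure (μ.restrict (spanningSets μ n)) := ⟨by simpa using hfin⟩
    refine ae_le_of_forall_setIntegral_le (f := fun x => (c * f x).re) (g := fun _ => M * ‖c‖)
      ((hf _ hS hfin).const_mul c).re (integrable_const _) fun s hs _ => ?_
    rw [Measure.restrict_restrict hs]
    have hfin' : μ (s ∩ spanningSets μ n) < ⊤ := (measure_mono inter_subset_right).trans_lt hfin
    have h2 : ∫ x in s ∩ spanningSets μ n, (c * f x).re ∂μ
        = (c * ∫ x in s ∩ spanningSets μ n, f x ∂μ).re := by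
      rw [← integral_const_mul]
      exact integral_re ((hf _ (hs.inter hS) hfin').const_mul c)
    rw [h2, setIntegral_const, smul_eq_mul]
    calc (c * ∫ x in s ∩ spanningSets μ n, f x ∂μ).re
        ≤ ‖c * ∫ x in s ∩ spanningSets μ n, f x ∂μ‖ := Complex.re_le_norm _
      _ ≤ ‖c‖ * (M * μ.real (s ∩ spanningSets μ n)) := by
          rw [norm_mul]
          exact mul_le_mul_of_nonneg_left (h _ (hs.inter hS) hfin') (norm_nonneg _)
      _ = _ := by ring
  have h2 : ∀ c : ℂ, ∀ᵐ x ∂μ, (c * f x).re ≤ M * ‖c‖ := by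
    intro c
    have h4 := (ae_restrict_iUnion_iff (μ := μ) (spanningSets μ)
      (fun x => (c * f x).re ≤ M * ‖c‖)).2 fun n => h1 n c
    rwa [iUnion_spanningSets, Measure.restrict_univ] at h4
  have h3 : ∀ᵐ x ∂μ, ∀ n, (TopologicalSpace.denseSeq ℂ n * f x).re
      ≤ M * ‖TopologicalSpace.denseSeq ℂ n‖ := ae_all_iff.2 fun n => h2 _
  filter_upwards [h3] with x hx
  have hall : ∀ c : ℂ, (c * f x).re ≤ M * ‖c‖ := by
    intro c
    refine (TopologicalSpace.denseRange_denseSeq ℂ).induction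
      (P := fun c => (c * f x).re ≤ M * ‖c‖) ?_ (isClosed_le (by fun_prop) (by fun_prop)) c
    rintro _ ⟨n, rfl⟩
    exact hx n
  by_cases h0 : f x = 0
  · have := hall 1
    rw [h0] at this ⊢
    simpa using this
  · have := hall (starRingEnd ℂ (f x))
    rw [Complex.conj_mul', RCLike.norm_conj] at this
    have h5 : 0 < ‖f x‖ := norm_pos_iff.2 h0
    have h6 : ((‖f x‖ : ℂ) ^ 2).re = ‖f x‖ ^ 2 := by norm_cast
    rw [h6] at this
    nlinarith

theorem norm_setIntegral_sub_le {f : X → ℂ} {b : ℝ} (hf : Measurable f) (hb : ∀ x, ‖f x‖ ≤ b)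
    {s t : Set X} (hs : MeasurableSet s) (ht : MeasurableSet t) (hs' : μ s < ⊤) (ht' : μ t < ⊤) :
    ‖∫ x in s, f x ∂μ‖ ≤ ‖∫ x in t, f x ∂μ‖ + b * μ.real (symmDiff s t) := by
  have hint : ∀ A, μ A < ⊤ → IntegrableOn f A μ := fun A hA =>
    Measure.integrableOn_of_bounded hA.ne hf.aestronglyMeasurable (ae_of_all _ hb)
  have h1 := integral_inter_add_sdiff ht (hint s hs')
  have h2 := integral_inter_add_sdiff hs (hint t ht')
  rw [inter_comm] at h2
  have h3 : ‖∫ x in s \ t, f x ∂μ‖ ≤ b * μ.real (s \ t) :=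
    norm_setIntegral_le_of_norm_le_const ((measure_mono sdiff_subset).trans_lt hs')
      fun x _ => hb x
  have h4 : ‖∫ x in t \ s, f x ∂μ‖ ≤ b * μ.real (t \ s) :=
    norm_setIntegral_le_of_norm_le_const ((measure_mono sdiff_subset).trans_lt ht')
      fun x _ => hb x
  have h5 : μ.real (symmDiff s t) = μ.real (s \ t) + μ.real (t \ s) := by
    rw [Set.symmDiff_def]
    exact measureReal_union disjoint_sdiff_sdiff (ht.diff hs)
      (((measure_mono sdiff_subset).trans_lt hs').ne) (((measure_mono sdiff_subset).trans_lt ht').ne)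
  have h6 : ∫ x in s, f x ∂μ = ∫ x in t, f x ∂μ + ∫ x in s \ t, f x ∂μ - ∫ x in t \ s, f x ∂μ := by
    rw [← h1, ← h2]; ring
  rw [h6, h5, mul_add]
  calc _ ≤ ‖∫ x in t, f x ∂μ‖ + ‖∫ x in s \ t, f x ∂μ‖ + ‖∫ x in t \ s, f x ∂μ‖ :=
        (norm_sub_le _ _).trans (add_le_add_left (norm_add_le _ _) _)
    _ ≤ _ := by linarith

/-- The exceptional null set of x depends on B, so only countably many B can be used together.
Boundedness of each slice lets other sets be approximated in measure; the bound b itself does not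
enter the conclusion. -/
theorem ae_ae_norm_le_of_setIntegral [MeasurableSpace.CountablyGenerated X] [SigmaFinite μ]
    {K : X → X → ℂ} (hK : ∀ x, Measurable (K x)) (hb : ∀ x, ∃ b, ∀ y, ‖K x y‖ ≤ b)
    {M : ℝ} (hM : 0 ≤ M)
    (h : ∀ B, MeasurableSet B → μ B < ⊤ →
      ∀ᵐ x ∂μ, ‖∫ y in B, K x y ∂μ‖ ≤ M * μ.real B) :
    ∀ᵐ x ∂μ, ∀ᵐ y ∂μ, ‖K x y‖ ≤ M := by
  obtain ⟨𝒜, h𝒜c, h𝒜⟩ := exists_countable_measureDense μ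
  have h1 : ∀ᵐ x ∂μ, ∀ B ∈ 𝒜, μ B < ⊤ → ‖∫ y in B, K x y ∂μ‖ ≤ M * μ.real B := by
    rw [ae_ball_iff h𝒜c]
    intro B hB
    by_cases hfin : μ B < ⊤
    · filter_upwards [h B (h𝒜.measurable B hB) hfin] with x hx _ using hx
    · exact ae_of_all _ fun x h => absurd h hfin
  filter_upwards [h1] with x hx
  obtain ⟨b, hb⟩ := hb x
  refine ae_norm_le_of_forall_setIntegral (fun s hs hs' =>
    Measure.integrableOn_of_bounded hs'.ne (hK x).aestronglyMeasurable (ae_of_all _ hb))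
    fun s hs hs' => ?_
  have hb0 : 0 ≤ |b| := abs_nonneg b
  refine le_of_forall_pos_le_add fun ε hε => ?_
  obtain ⟨t, ht, htfin, hst⟩ := h𝒜.fin_meas_approx hs hs'.ne (ε / (M + |b| + 1)) (by positivity)
  have hst' : μ.real (symmDiff s t) ≤ ε / (M + |b| + 1) := by
    rw [measureReal_def]
    exact ENNReal.toReal_le_of_le_ofReal (by positivity) hst.le
  have h2 := norm_setIntegral_sub_le (μ := μ) (hK x) (fun y => (hb y).trans (le_abs_self b)) hs
    (h𝒜.measurable t ht) hs' (lt_top_iff_ne_top.2 htfin)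
  have h3 := hx t ht (lt_top_iff_ne_top.2 htfin)
  have h4 : μ.real t ≤ μ.real s + μ.real (symmDiff s t) := by
    have hsub : t ⊆ s ∪ symmDiff s t := by
      intro y hy
      by_cases hys : y ∈ s
      · exact Or.inl hys
      · exact Or.inr (Or.inr ⟨hy, hys⟩)
    have hfin2 : μ (s ∪ symmDiff s t) ≠ ⊤ :=
      ((measure_union_le _ _).trans_lt (ENNReal.add_lt_top.2
        ⟨hs', hst.trans ENNReal.ofReal_lt_top⟩)).ne
    exact (measureReal_mono hsub hfin2).trans (measureReal_union_le _ _)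
  have h5 : (M + |b|) * μ.real (symmDiff s t) ≤ ε := by
    calc (M + |b|) * μ.real (symmDiff s t) ≤ (M + |b| + 1) * (ε / (M + |b| + 1)) := by
          exact mul_le_mul (by linarith) hst' measureReal_nonneg (by positivity)
      _ = ε := by field_simp
  nlinarith

/-- This converts an estimate of the matrix elements ⟨1_A, S 1_B⟩ by M μ(A) μ(B), that is an L¹ to
L^∞ bound, into a pointwise bound on the kernel. -/
theorem ae_ae_norm_le_of_double_setIntegral [MeasurableSpace.CountablyGenerated X] [SigmaFinite μ]
    {K : X → X → ℂ} (hK : Measurable fun z : X × X => K z.1 z.2) {b : ℝ}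
    (hb : ∀ x y, ‖K x y‖ ≤ b) {M : ℝ} (hM : 0 ≤ M)
    (h : ∀ A B, MeasurableSet A → MeasurableSet B → μ A < ⊤ → μ B < ⊤ →
      ‖∫ x in A, ∫ y in B, K x y ∂μ ∂μ‖ ≤ M * μ.real A * μ.real B) :
    ∀ᵐ x ∂μ, ∀ᵐ y ∂μ, ‖K x y‖ ≤ M := by
  have hKx : ∀ x, Measurable (K x) := fun x => hK.comp measurable_prodMk_left
  refine ae_ae_norm_le_of_setIntegral hKx (fun x => ⟨b, hb x⟩) hM fun B hB hB' => ?_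
  have hsm : StronglyMeasurable fun x => ∫ y in B, K x y ∂μ :=
    hK.stronglyMeasurable.integral_prod_right'
  refine ae_norm_le_of_forall_setIntegral (fun s hs hs' =>
    Measure.integrableOn_of_bounded (M := b * μ.real B) hs'.ne hsm.aestronglyMeasurable
      (ae_of_all _ fun x => norm_setIntegral_le_of_norm_le_const hB' fun y _ => hb x y))
    fun A hA hA' => ?_
  refine (h A B hA hB hA' hB').trans (le_of_eq (by ring))

end KernelBounds

/-! ### Shifted Chebyshev polynomials and the associated symbols -/

section Chebyshev

open Polynomial

/-- The shifted Chebyshev polynomial `T_n(2x - 1)`. -/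
def shiftedT (n : ℕ) : ℝ[X] := (Chebyshev.T ℝ (n : ℤ)).comp (2 * X - 1)

theorem shiftedT_zero : shiftedT 0 = 1 := by simp [shiftedT]

theorem shiftedT_one : shiftedT 1 = 2 * X - 1 := by simp [shiftedT]

theorem shiftedT_add_two (n : ℕ) :
    shiftedT (n + 2) = 2 * (2 * X - 1) * shiftedT (n + 1) - shiftedT n := by
  simp only [shiftedT]
  push_cast
  rw [Chebyshev.T_add_two]
  simp

theorem shiftedT_add_two' (n : ℕ) :
    shiftedT (n + 2) = C 4 * (shiftedT (n + 1) * X) - C 2 * shiftedT (n + 1) - shiftedT n := by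
  rw [shiftedT_add_two]
  have h4 : (C 4 : ℝ[X]) = 4 := rfl
  have h2 : (C 2 : ℝ[X]) = 2 := rfl
  rw [h4, h2]
  ring

/-- The recursion has coefficients 4, 2 and 1, and 4·7 + 2·7 + 1 ≤ 7². -/
theorem shiftedT_bounds (n : ℕ) : (shiftedT n).natDegree ≤ n ∧
    ∀ m, |(shiftedT n).coeff m| ≤ 7 ^ n := by
  induction n using Nat.strong_induction_on with
  | _ n ih =>
    match n, ih with
    | 0, _ =>
      refine ⟨by simp [shiftedT_zero], fun m => ?_⟩
      rw [shiftedT_zero, coeff_one]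
      split_ifs <;> simp
    | 1, _ =>
      have h1 : shiftedT 1 = C 2 * X - C 1 := by rw [shiftedT_one]; rfl
      refine ⟨by rw [h1]; compute_degree, fun m => ?_⟩
      rw [h1, coeff_sub, coeff_C_mul, coeff_X, coeff_C]
      split_ifs <;> norm_num
    | n + 2, ih =>
      obtain ⟨d1, b1⟩ := ih (n + 1) (by omega)
      obtain ⟨d0, b0⟩ := ih n (by omega)
      rw [shiftedT_add_two']
      refine ⟨?_, fun m => ?_⟩
      · refine (natDegree_sub_le _ _).trans (max_le ((natDegree_sub_le _ _).trans
          (max_le ((natDegree_C_mul_le _ _).trans ?_) ((natDegree_C_mul_le _ _).trans ?_))) ?_)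
        · exact natDegree_mul_le.trans (by rw [natDegree_X]; omega)
        · omega
        · omega
      · rw [coeff_sub, coeff_sub, coeff_C_mul, coeff_C_mul]
        have hX : |(shiftedT (n + 1) * X).coeff m| ≤ 7 ^ (n + 1) := by
          cases m with
          | zero => simp
          | succ m => rw [coeff_mul_X]; exact b1 m
        have e1 := abs_le.1 hX
        have e2 := abs_le.1 (b1 m)
        have e3 := abs_le.1 (b0 m)
        have hp : (0 : ℝ) ≤ 7 ^ n := by positivity
        rw [pow_succ] at e1 e2
        rw [abs_le, pow_succ, pow_succ]
        constructor <;> linarith [e1.1, e1.2, e2.1, e2.2, e3.1, e3.2]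

theorem shiftedT_eval_eq_sum (n : ℕ) (x : ℝ) :
    (shiftedT n).eval x = ∑ m ∈ Finset.range (n + 1), (shiftedT n).coeff m * x ^ m :=
  eval_eq_sum_range' (Nat.lt_succ_of_le (shiftedT_bounds n).1) x

/-- The double angle formula. With cos² equal to e^{-s} it turns polynomials in the heat operator
into a cosine basis. -/
theorem shiftedT_eval_cos_sq (n : ℕ) (θ : ℝ) :
    (shiftedT n).eval (Real.cos θ ^ 2) = Real.cos (n * (2 * θ)) := by
  have h : (2 * X - 1 : ℝ[X]).eval (Real.cos θ ^ 2) = Real.cos (2 * θ) := by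
    rw [Real.cos_two_mul]; simp
  rw [shiftedT, eval_comp, h, Chebyshev.T_real_cos]
  simp

theorem abs_shiftedT_eval_le (n : ℕ) {x : ℝ} (h0 : 0 ≤ x) (h1 : x ≤ 1) :
    |(shiftedT n).eval x| ≤ 1 := by
  have hs : Real.sqrt x ≤ 1 := Real.sqrt_le_one.2 h1
  have hx : Real.cos (Real.arccos (Real.sqrt x)) ^ 2 = x := by
    rw [Real.cos_arccos (by linarith [Real.sqrt_nonneg x]) hs, Real.sq_sqrt h0]
  rw [← hx, shiftedT_eval_cos_sq]
  exact Real.abs_cos_le_one _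

end Chebyshev

/-! ### Heat and Chebyshev symbols -/

/-- The symbol `e^{-tλ}` on `(0,∞)`. -/
def heatSym (t : ℝ) : ℝ → ℂ := (Ioi 0).indicator fun l => Complex.exp (-((t : ℂ) * l))

theorem heatSym_of_pos (t : ℝ) {l : ℝ} (hl : 0 < l) :
    heatSym t l = ((Real.exp (-(t * l)) : ℝ) : ℂ) := by
  rw [heatSym, indicator_of_mem (mem_Ioi.2 hl)]
  push_cast
  rfl

theorem heatSym_of_nonpos (t : ℝ) {l : ℝ} (hl : l ≤ 0) : heatSym t l = 0 :=
  indicator_of_notMem (by simpa using hl) _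

theorem isBddMeas_heatSym {t : ℝ} (ht : 0 ≤ t) : IsBddMeas (heatSym t) := by
  refine ⟨Measurable.indicator (by fun_prop) measurableSet_Ioi, 1, fun l => ?_⟩
  rcases lt_or_ge 0 l with hl | hl
  · rw [heatSym_of_pos t hl, Complex.norm_real, Real.norm_of_nonneg (Real.exp_pos _).le,
      Real.exp_le_one_iff]
    nlinarith
  · rw [heatSym_of_nonpos t hl]; simp

theorem heatSym_mul (s t l : ℝ) : heatSym s l * heatSym t l = heatSym (s + t) l := by
  rcases lt_or_ge 0 l with hl | hl
  · rw [heatSym_of_pos _ hl, heatSym_of_pos _ hl, heatSym_of_pos _ hl, ← Complex.ofReal_mul,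
      ← Real.exp_add]
    ring_nf
  · simp [heatSym_of_nonpos _ hl]

/-- The symbol `T_n(2e^{-tλ} - 1)(e^{-ktλ} - e^{-(k+1)tλ})` on `(0,∞)`. -/
def chebSym (k n : ℕ) (t : ℝ) (l : ℝ) : ℂ :=
  ∑ m ∈ Finset.range (n + 1), ((shiftedT n).coeff m : ℂ) *
    (heatSym ((m + k) * t) l - heatSym ((m + k + 1) * t) l)

theorem isBddMeas_chebSym (k n : ℕ) {t : ℝ} (ht : 0 ≤ t) : IsBddMeas (chebSym k n t) :=
  IsBddMeas.sum fun _ _ => ((isBddMeas_heatSym (by positivity)).sub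
    (isBddMeas_heatSym (by positivity))).const_mul _

theorem chebSym_of_nonpos (k n : ℕ) (t : ℝ) {l : ℝ} (hl : l ≤ 0) : chebSym k n t l = 0 := by
  simp [chebSym, heatSym_of_nonpos _ hl]

theorem chebSym_of_pos (k n : ℕ) (t : ℝ) {l : ℝ} (hl : 0 < l) :
    chebSym k n t l = (((shiftedT n).eval (Real.exp (-(t * l))) *
      (Real.exp (-(t * l)) ^ k * (1 - Real.exp (-(t * l)))) : ℝ) : ℂ) := by
  rw [chebSym, shiftedT_eval_eq_sum, Finset.sum_mul]
  push_cast
  refine Finset.sum_congr rfl fun m _ => ?_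
  rw [heatSym_of_pos _ hl, heatSym_of_pos _ hl]
  have h1 : Real.exp (-((m + k) * t * l)) = Real.exp (-(t * l)) ^ m * Real.exp (-(t * l)) ^ k := by
    rw [← pow_add, ← Real.exp_nat_mul]; push_cast; ring_nf
  have h2 : Real.exp (-((m + k + 1) * t * l)) =
      Real.exp (-(t * l)) ^ m * Real.exp (-(t * l)) ^ k * Real.exp (-(t * l)) := by
    rw [← pow_add, ← pow_succ, ← Real.exp_nat_mul]; push_cast; ring_nf
  rw [h1, h2]
  push_cast
  ring

/-- Heat factors can be split off: the symbol with k = 2 is the contraction with k = 0 placed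
between two heat factors, the form required by `ae_norm_kernel_le`. -/
theorem chebSym_eq_mul_heatSym (j k n : ℕ) (t l : ℝ) :
    chebSym (k + j) n t l = heatSym (j * t) l * chebSym k n t l := by
  rw [chebSym, chebSym, Finset.mul_sum]
  refine Finset.sum_congr rfl fun m _ => ?_
  rw [mul_left_comm, mul_sub (heatSym _ _), heatSym_mul, heatSym_mul]
  push_cast
  ring_nf

theorem norm_chebSym_le (k n : ℕ) {t : ℝ} (ht : 0 ≤ t) (l : ℝ) : ‖chebSym k n t l‖ ≤ 1 := by
  rcases lt_or_ge 0 l with hl | hl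
  · have h0 := (Real.exp_pos (-(t * l))).le
    have h1 : Real.exp (-(t * l)) ≤ 1 := by
      rw [Real.exp_le_one_iff]
      nlinarith
    rw [chebSym_of_pos k n t hl, Complex.norm_real, norm_mul, norm_mul, Real.norm_eq_abs]
    have h2 : ‖Real.exp (-(t * l)) ^ k‖ ≤ 1 := by
      rw [norm_pow, Real.norm_of_nonneg h0]
      exact pow_le_one₀ h0 h1
    have h3 : ‖1 - Real.exp (-(t * l))‖ ≤ 1 := by
      rw [Real.norm_of_nonneg (by linarith)]
      linarith
    exact mul_le_one₀ (abs_shiftedT_eval_le n h0 h1) (by positivity)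
      (mul_le_one₀ h2 (by positivity) h3)
  · rw [chebSym_of_nonpos k n t hl]; simp

/-- Put z = r/(n+3). If c z^γ ≥ 2n log 14, half of the exponential absorbs (n+1)7^n ≤ 14^n and the
other half beats z^M. Otherwise z, hence r, is at most polynomial in n, so the trivial bound 1 is
already a polynomial in n times r^{-M}. -/
theorem exists_min_one_exp_le (M : ℕ) {c γ : ℝ} (hc : 0 < c) (hγ : 0 < γ) :
    ∃ C : ℝ, 0 < C ∧ ∃ A : ℕ, ∀ (n : ℕ) (r : ℝ), 0 < r →
      min 1 ((n + 1) * 7 ^ n * Real.exp (-(c * (r / (n + 3)) ^ γ))) ≤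
        C * (1 + n) ^ A * min 1 ((r ^ M)⁻¹) := by
  obtain ⟨C₁, hC₁, hexp⟩ := exists_pow_mul_exp_le M (half_pos hc) hγ
  let κ := Real.log 14
  have hκ : 0 < κ := Real.log_pos (by norm_num)
  let D := 2 * κ / c
  have hD : 0 < D := by positivity
  let C₂ := 3 ^ M * (D ^ γ⁻¹) ^ M
  have hC₂ : 0 < C₂ := by positivity
  let A₀ := ⌈γ⁻¹⌉₊
  have hA₀ : γ⁻¹ ≤ A₀ := Nat.le_ceil _
  refine ⟨1 + 3 ^ M * C₁ + C₂, by positivity, M + A₀ * M, fun n r hr => ?_⟩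
  have hn1 : (1 : ℝ) ≤ 1 + n := by linarith [(Nat.cast_nonneg n : (0 : ℝ) ≤ n)]
  have hpA : (1 : ℝ) ≤ (1 + n) ^ (M + A₀ * M) := one_le_pow₀ hn1
  have hrM : 0 < r ^ M := by positivity
  rw [mul_min_of_nonneg _ _ (by positivity)]
  refine le_min ((min_le_left _ _).trans ?_) ?_
  · rw [mul_one]
    have : (1 : ℝ) ≤ 1 + 3 ^ M * C₁ + C₂ := by
      have : 0 ≤ 3 ^ M * C₁ := by positivity
      linarith
    nlinarith
  rw [← div_eq_mul_inv, le_div_iff₀ hrM]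
  set z := r / (n + 3) with hz
  have hz0 : 0 < z := by positivity
  have hrz : r = z * (n + 3) := by rw [hz]; field_simp
  have hr3 : r ≤ 3 * (1 + n) * z := by rw [hrz]; nlinarith
  rcases le_or_gt (2 * κ * n) (c * z ^ γ) with hcase | hcase
  · have h14 : (n + 1 : ℝ) * 7 ^ n ≤ Real.exp (κ * n) := by
      have h2 : (n + 1 : ℝ) ≤ 2 ^ n := by exact_mod_cast Nat.lt_two_pow_self
      calc (n + 1 : ℝ) * 7 ^ n ≤ 2 ^ n * 7 ^ n := by gcongr
        _ = 14 ^ n := by rw [← mul_pow]; norm_num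
        _ = Real.exp (κ * n) := by
          rw [mul_comm, Real.exp_nat_mul, Real.exp_log (by norm_num)]
    have h3 : (n + 1) * 7 ^ n * Real.exp (-(c * z ^ γ)) ≤ Real.exp (-(c / 2 * z ^ γ)) := by
      calc _ ≤ Real.exp (κ * n) * Real.exp (-(c * z ^ γ)) := by gcongr
        _ = Real.exp (κ * n - c * z ^ γ) := by rw [← Real.exp_add]; ring_nf
        _ ≤ _ := Real.exp_le_exp.2 (by linarith)
    have h4 := hexp z hz0.le
    have h5 : r ^ M ≤ 3 ^ M * (1 + n) ^ M * (1 + z) ^ M := by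
      rw [← mul_pow, ← mul_pow]
      refine pow_le_pow_left₀ hr.le (hr3.trans ?_) M
      gcongr
      linarith
    calc min 1 ((n + 1) * 7 ^ n * Real.exp (-(c * z ^ γ))) * r ^ M
        ≤ Real.exp (-(c / 2 * z ^ γ)) * (3 ^ M * (1 + n) ^ M * (1 + z) ^ M) := by
          refine mul_le_mul ((min_le_right _ _).trans h3) h5 hrM.le (Real.exp_pos _).le
      _ = 3 ^ M * (1 + n) ^ M * ((1 + z) ^ M * Real.exp (-(c / 2 * z ^ γ))) := by ring
      _ ≤ 3 ^ M * (1 + n) ^ M * C₁ := by gcongr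
      _ = (3 ^ M * C₁) * (1 + n) ^ M := by ring
      _ ≤ (1 + 3 ^ M * C₁ + C₂) * (1 + n) ^ (M + A₀ * M) := by
          refine mul_le_mul ?_ (pow_le_pow_right₀ hn1 (Nat.le_add_right _ _)) (by positivity)
            (by positivity)
          linarith
  · have h1 : z ^ γ ≤ D * (1 + n) := by
      rw [show D * (1 + n) = 2 * κ * (1 + n) / c by simp only [D]; ring, le_div_iff₀ hc]
      nlinarith
    have h2 : z ≤ D ^ γ⁻¹ * (1 + n) ^ A₀ := by
      calc z = (z ^ γ) ^ γ⁻¹ := by rw [← Real.rpow_mul hz0.le, mul_inv_cancel₀ hγ.ne', Real.rpow_one]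
        _ ≤ (D * (1 + n)) ^ γ⁻¹ := Real.rpow_le_rpow (by positivity) h1 (by positivity)
        _ = D ^ γ⁻¹ * (1 + n : ℝ) ^ γ⁻¹ := Real.mul_rpow hD.le (by positivity)
        _ ≤ D ^ γ⁻¹ * (1 + n) ^ A₀ := by
          refine mul_le_mul_of_nonneg_left ?_ (by positivity)
          rw [← Real.rpow_natCast]
          exact Real.rpow_le_rpow_of_exponent_le hn1 hA₀
    have h3 : r ^ M ≤ C₂ * (1 + n) ^ (M + A₀ * M) := by
      calc r ^ M ≤ (3 * (1 + n) * (D ^ γ⁻¹ * (1 + n) ^ A₀)) ^ M := by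
            refine pow_le_pow_left₀ hr.le (hr3.trans ?_) M
            gcongr
        _ = _ := by
            simp only [C₂, mul_pow, pow_add, pow_mul]
            ring
    calc min 1 ((n + 1) * 7 ^ n * Real.exp (-(c * z ^ γ))) * r ^ M
        ≤ 1 * (C₂ * (1 + n) ^ (M + A₀ * M)) :=
          mul_le_mul (min_le_left _ _) h3 hrM.le zero_le_one
      _ ≤ (1 + 3 ^ M * C₁ + C₂) * (1 + n) ^ (M + A₀ * M) := by
          rw [one_mul]
          refine mul_le_mul_of_nonneg_right ?_ (by positivity)
          have : 0 ≤ 3 ^ M * C₁ := by positivity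
          linarith

/-! ### Heat kernels in a spectral representation -/

section HasKernel

variable {X : Type*} [MeasurableSpace X] {μ : Measure X}

theorem HasKernel.add {S S' : Lp ℂ 2 μ →L[ℂ] Lp ℂ 2 μ} {k k' : X → X → ℂ} (h : HasKernel S k)
    (h' : HasKernel S' k') : HasKernel (S + S') (fun x y => k x y + k' x y) := by
  refine ⟨h.1.add h'.1, fun u => ?_⟩
  filter_upwards [h.2 u, h'.2 u, Lp.coeFn_add (S u) (S' u)] with x h1 h2 h3
  have h4 : (fun y => (k x y + k' x y) * u y) = fun y => k x y * u y + k' x y * u y := by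
    ext y; ring
  rw [h4]
  refine ⟨h1.1.add h2.1, ?_⟩
  rw [integral_add h1.1 h2.1, ← h1.2, ← h2.2]
  exact h3

theorem HasKernel.const_smul {S : Lp ℂ 2 μ →L[ℂ] Lp ℂ 2 μ} {k : X → X → ℂ} (h : HasKernel S k)
    (c : ℂ) : HasKernel (c • S) (fun x y => c * k x y) := by
  refine ⟨h.1.const_mul c, fun u => ?_⟩
  filter_upwards [h.2 u, Lp.coeFn_smul c (S u)] with x h1 h3
  have h4 : (fun y => c * k x y * u y) = fun y => c * (k x y * u y) := by
    ext y; ring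
  rw [h4]
  refine ⟨h1.1.const_mul c, ?_⟩
  rw [integral_const_mul, ← h1.2]
  exact h3

theorem HasKernel.zero : HasKernel (0 : Lp ℂ 2 μ →L[ℂ] Lp ℂ 2 μ) (fun _ _ => 0) := by
  refine ⟨measurable_const, fun u => ?_⟩
  filter_upwards [Lp.coeFn_zero ℂ 2 μ] with x hx
  simpa using hx

theorem HasKernel.sum {ι : Type*} {s : Finset ι} {S : ι → Lp ℂ 2 μ →L[ℂ] Lp ℂ 2 μ}
    {k : ι → X → X → ℂ} (h : ∀ i ∈ s, HasKernel (S i) (k i)) :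
    HasKernel (∑ i ∈ s, S i) (fun x y => ∑ i ∈ s, k i x y) := by
  classical
  induction s using Finset.induction_on with
  | empty => simpa using HasKernel.zero
  | insert a s ha ih =>
    simp only [Finset.sum_insert ha]
    exact (h a (Finset.mem_insert_self a s)).add
      (ih fun i hi => h i (Finset.mem_insert_of_mem hi))

theorem HasKernel.congr {S : Lp ℂ 2 μ →L[ℂ] Lp ℂ 2 μ} {k k' : X → X → ℂ} (h : HasKernel S k)
    (hm : Measurable fun z : X × X => k' z.1 z.2)
    (hk : ∀ᵐ x ∂μ, ∀ᵐ y ∂μ, k' x y = k x y) : HasKernel S k' := by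
  refine ⟨hm, fun u => ?_⟩
  filter_upwards [h.2 u, hk] with x h1 h2
  have h3 : (fun y => k x y * u y) =ᵐ[μ] fun y => k' x y * u y := by
    filter_upwards [h2] with y hy
    rw [hy]
  exact ⟨h1.1.congr h3, h1.2.trans (integral_congr_ae h3)⟩

/-- The matrix elements of an operator with a kernel on indicator functions. -/
theorem HasKernel.inner_indicator {S : Lp ℂ 2 μ →L[ℂ] Lp ℂ 2 μ} {k : X → X → ℂ}
    (h : HasKernel S k) {A B : Set X} (hA : MeasurableSet A) (hB : MeasurableSet B)
    (hA' : μ A ≠ ⊤) (hB' : μ B ≠ ⊤) :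
    inner ℂ (indicatorConstLp 2 hA hA' (1 : ℂ)) (S (indicatorConstLp 2 hB hB' (1 : ℂ))) =
      ∫ x in A, ∫ y in B, k x y ∂μ ∂μ := by
  rw [L2.inner_indicatorConstLp_one]
  refine setIntegral_congr_ae hA ?_
  filter_upwards [h.2 (indicatorConstLp 2 hB hB' (1 : ℂ))] with x hx _
  rw [hx.2, ← integral_indicator hB]
  refine integral_congr_ae ?_
  filter_upwards [indicatorConstLp_coeFn (p := 2) (hs := hB) (hμs := hB') (c := (1 : ℂ))]
    with y hy
  rw [hy]
  by_cases hyB : y ∈ B <;> simp [hyB]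

end HasKernel

/-- The heat operators in the spectral representation `(U, g)` have the kernels `h t`, satisfying
a sub-Gaussian bound. -/
structure HeatModel {Ω X : Type*} [MeasurableSpace Ω] [MetricSpace X] [MeasurableSpace X]
    {ν : Measure Ω} {μ : Measure X} (U : Lp ℂ 2 ν ≃ₗᵢ[ℂ] Lp ℂ 2 μ) (g : Ω → ℝ)
    (h : ℝ → X → X → ℂ) (d γ c₁ c₂ : ℝ) : Prop where
  measurable_g : Measurable g
  doubling : IsDoubling μ
  d_pos : 0 < d
  γ_pos : 0 < γ
  c₁_pos : 0 < c₁
  c₂_pos : 0 < c₂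
  hasKernel : ∀ t, 0 < t → HasKernel (specOp U fun o => heatSym t (g o)) (h t)
  bound : ∀ t, 0 < t → ∀ x y, ‖h t x y‖ ≤ c₁ * t ^ (-(d / (d + 1))) *
      Real.exp (-(c₂ * (dist x y ^ (d + 1) / t) ^ γ))
  real : ∀ t, 0 < t → ∀ x y, (h t x y).im = 0

namespace HeatModel

variable {Ω X : Type*} [MeasurableSpace Ω] [MetricSpace X] [MeasurableSpace X] [BorelSpace X]
  {ν : Measure Ω} {μ : Measure X} {U : Lp ℂ 2 ν ≃ₗᵢ[ℂ] Lp ℂ 2 μ} {g : Ω → ℝ}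
  {h : ℝ → X → X → ℂ} {d γ c₁ c₂ : ℝ} (H : HeatModel U g h d γ c₁ c₂)

include H

theorem isBddMeas_heat {t : ℝ} (ht : 0 ≤ t) : IsBddMeas fun o => heatSym t (g o) :=
  (isBddMeas_heatSym ht).comp H.measurable_g

theorem isBddMeas_cheb (k n : ℕ) {t : ℝ} (ht : 0 ≤ t) : IsBddMeas fun o => chebSym k n t (g o) :=
  (isBddMeas_chebSym k n ht).comp H.measurable_g

theorem measurable_left {t : ℝ} (ht : 0 < t) (x : X) : Measurable (h t x) :=
  (H.hasKernel t ht).1.comp measurable_prodMk_left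

theorem measurable_right {t : ℝ} (ht : 0 < t) (y : X) : Measurable (fun x => h t x y) :=
  (H.hasKernel t ht).1.comp measurable_prodMk_right

theorem norm_le {t : ℝ} (ht : 0 < t) (x y : X) : ‖h t x y‖ ≤ c₁ * t ^ (-(d / (d + 1))) := by
  refine (H.bound t ht x y).trans ?_
  have h1 : Real.exp (-(c₂ * (dist x y ^ (d + 1) / t) ^ γ)) ≤ 1 := by
    rw [Real.exp_le_one_iff]
    have : 0 ≤ c₂ * (dist x y ^ (d + 1) / t) ^ γ := by
      have := H.c₂_pos
      positivity
    linarith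
  have h2 : 0 ≤ c₁ * t ^ (-(d / (d + 1))) := by
    have := H.c₁_pos
    positivity
  exact mul_le_of_le_one_right h2 h1

/-- At a fixed time the bound decays like exp(-c R^{(d+1)γ}), faster than any power of R, while
doubling makes a suitable negative power integrable. This is how the slices become integrable and
square integrable. -/
theorem exists_majorant {t : ℝ} (ht : 0 < t) : ∃ C : ℝ, ∃ M : ℕ,
    (∀ x, Integrable (fun y => ((1 + dist x y) ^ M)⁻¹) μ) ∧
    ∀ x y, ‖h t x y‖ ≤ C * ((1 + dist x y) ^ M)⁻¹ := by
  obtain ⟨M, hM⟩ := H.doubling.exists_integrable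
  have hd := H.d_pos
  have hγ := H.γ_pos
  have hc₁ := H.c₁_pos
  have hc₂ := H.c₂_pos
  obtain ⟨C, hC, hle⟩ := exists_pow_mul_exp_le M (c := c₂ / t ^ γ) (q := (d + 1) * γ)
    (by positivity) (by positivity)
  refine ⟨c₁ * t ^ (-(d / (d + 1))) * C, M, hM, fun x y => (H.bound t ht x y).trans ?_⟩
  rw [mul_assoc (c₁ * t ^ (-(d / (d + 1))))]
  refine mul_le_mul_of_nonneg_left ?_ (by positivity)
  rw [← div_eq_mul_inv, le_div_iff₀ (by positivity), mul_comm]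
  refine le_trans (le_of_eq ?_) (hle (dist x y) dist_nonneg)
  rw [Real.div_rpow (by positivity) ht.le, ← Real.rpow_mul dist_nonneg]
  ring_nf

theorem integrable_left {t : ℝ} (ht : 0 < t) (x : X) : Integrable (h t x) μ := by
  obtain ⟨C, M, hM, hle⟩ := H.exists_majorant ht
  exact ((hM x).const_mul C).mono' (H.measurable_left ht x).aestronglyMeasurable
    (ae_of_all _ (hle x))

theorem integrable_right {t : ℝ} (ht : 0 < t) (y : X) : Integrable (fun x => h t x y) μ := by
  obtain ⟨C, M, hM, hle⟩ := H.exists_majorant ht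
  refine ((hM y).const_mul C).mono' (H.measurable_right ht y).aestronglyMeasurable
    (ae_of_all _ fun x => ?_)
  rw [dist_comm]
  exact hle x y

theorem memLp_two_of_bdd {f : X → ℂ} {b : ℝ} (hb : ∀ x, ‖f x‖ ≤ b)
    (hf : Integrable f μ) : MemLp f 2 μ := by
  rw [memLp_two_iff_integrable_sq_norm hf.1]
  refine (hf.norm.const_mul b).mono' (hf.1.norm.pow 2) (ae_of_all _ fun x => ?_)
  rw [Real.norm_of_nonneg (by positivity), pow_two]
  exact mul_le_mul_of_nonneg_right (hb x) (norm_nonneg _)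

theorem memLp_left {t : ℝ} (ht : 0 < t) (x : X) : MemLp (h t x) 2 μ :=
  H.memLp_two_of_bdd (H.norm_le ht x) (H.integrable_left ht x)

theorem memLp_right {t : ℝ} (ht : 0 < t) (y : X) : MemLp (fun x => h t x y) 2 μ :=
  H.memLp_two_of_bdd (fun x => H.norm_le ht x y) (H.integrable_right ht y)

theorem measurable_comp {s t : ℝ} (hs : 0 < s) (ht : 0 < t) :
    Measurable fun z : X × X => ∫ w, h s z.1 w * h t w z.2 ∂μ := by
  have hσ := H.doubling.sigmaFinite
  have h1 : Measurable fun q : (X × X) × X => h s q.1.1 q.2 * h t q.2 q.1.2 :=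
    ((H.hasKernel s hs).1.comp (f := fun q : (X × X) × X => (q.1.1, q.2)) (by fun_prop)).mul
      ((H.hasKernel t ht).1.comp (f := fun q : (X × X) × X => (q.2, q.1.2)) (by fun_prop))
  exact h1.stronglyMeasurable.integral_prod_right'.measurable

theorem norm_comp_le {s t : ℝ} (hs : 0 < s) (ht : 0 < t) (x y : X) :
    ‖∫ w, h s x w * h t w y ∂μ‖ ≤ (∫ w, ‖h s x w‖ ∂μ) * (c₁ * t ^ (-(d / (d + 1)))) := by
  rw [← integral_mul_const]
  refine norm_integral_le_of_norm_le ((H.integrable_left hs x).norm.mul_const _)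
    (ae_of_all _ fun w => ?_)
  rw [norm_mul]
  exact mul_le_mul_of_nonneg_left (H.norm_le ht w y) (norm_nonneg _)

/-- The semigroup property of the kernels. -/
theorem ae_kernel_add {s t : ℝ} (hs : 0 < s) (ht : 0 < t) :
    ∀ᵐ x ∂μ, ∀ᵐ y ∂μ, h (s + t) x y = ∫ w, h s x w * h t w y ∂μ := by
  have hσ := H.doubling.sigmaFinite
  have hsc := H.doubling.secondCountableTopology
  have hst : 0 < s + t := by positivity
  -- A kernel bound with M = 0 is almost everywhere equality; it is tested by applying both sides of
  -- the semigroup law to an indicator.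
  have key : ∀ᵐ x ∂μ, ∀ᵐ y ∂μ, ‖h (s + t) x y - ∫ w, h s x w * h t w y ∂μ‖ ≤ 0 := by
    refine ae_ae_norm_le_of_setIntegral
      (K := fun x y => h (s + t) x y - ∫ w, h s x w * h t w y ∂μ) (fun x => ?_) (fun x => ?_)
      le_rfl fun B hB hB' => ?_
    · exact (H.measurable_left hst x).sub ((H.measurable_comp hs ht).comp measurable_prodMk_left)
    · exact ⟨_, fun y => (norm_sub_le _ _).trans
        (add_le_add (H.norm_le hst x y) (H.norm_comp_le hs ht x y))⟩
    have hfin : IsFiniteMeasure (μ.restrict B) := ⟨by simpa using hB'⟩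
    let u : Lp ℂ 2 μ := indicatorConstLp 2 hB hB'.ne (1 : ℂ)
    have hu : ∀ k : X → ℂ, ∫ y, k y * u y ∂μ = ∫ y in B, k y ∂μ := by
      intro k
      rw [← integral_indicator hB]
      refine integral_congr_ae ?_
      filter_upwards [indicatorConstLp_coeFn (p := 2) (hs := hB) (hμs := hB'.ne) (c := (1 : ℂ))]
        with y hy
      simp only [u]
      rw [hy]
      by_cases hyB : y ∈ B <;> simp [hyB]
    have hop : specOp U (fun o => heatSym (s + t) (g o)) u =
        specOp U (fun o => heatSym s (g o)) (specOp U (fun o => heatSym t (g o)) u) := by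
      have := specOp_mul U (H.isBddMeas_heat hs.le) (H.isBddMeas_heat ht.le)
      simp only [heatSym_mul] at this
      rw [this]
      rfl
    filter_upwards [(H.hasKernel _ hst).2 u, (H.hasKernel s hs).2
      (specOp U (fun o => heatSym t (g o)) u)] with x h1 h2
    have hint : Integrable (Function.uncurry fun w y => h s x w * h t w y)
        (μ.prod (μ.restrict B)) := by
      have h3 : Integrable (fun z : X × X => ‖h s x z.1‖ * (c₁ * t ^ (-(d / (d + 1)))))
          (μ.prod (μ.restrict B)) :=
        (H.integrable_left hs x).norm.mul_prod (integrable_const _)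
      refine h3.mono' ?_ (ae_of_all _ fun z => ?_)
      · exact (((H.measurable_left hs x).comp measurable_fst).mul
          (H.hasKernel t ht).1).aestronglyMeasurable
      · simp only [Function.uncurry, norm_mul]
        exact mul_le_mul_of_nonneg_left (H.norm_le ht _ _) (norm_nonneg _)
    have h4 : ∫ y in B, h (s + t) x y ∂μ = ∫ y in B, ∫ w, h s x w * h t w y ∂μ ∂μ := by
      rw [← hu (h (s + t) x), ← h1.2, hop, h2.2, ← integral_integral_swap hint]
      refine integral_congr_ae ?_
      filter_upwards [(H.hasKernel t ht).2 u] with w hw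
      rw [hw.2, hu, integral_const_mul]
    have h5 : IntegrableOn (h (s + t) x) B μ := (H.integrable_left hst x).integrableOn
    have h6 : IntegrableOn (fun y => ∫ w, h s x w * h t w y ∂μ) B μ :=
      Measure.integrableOn_of_bounded hB'.ne
        ((H.measurable_comp hs ht).comp measurable_prodMk_left).aestronglyMeasurable
        (ae_of_all _ fun y => H.norm_comp_le hs ht x y)
    rw [integral_sub h5 h6, h4, sub_self]
    simp
  filter_upwards [key] with x hx
  filter_upwards [hx] with y hy
  exact sub_eq_zero.1 (norm_le_zero_iff.1 hy)

/-- The semigroup law read in x for fixed y: the slice of the kernel at time s + t is the heat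
operator at time s applied to the slice at time t. The exceptional sets are exchanged by Fubini. -/
theorem ae_kernel_add_apply {s t : ℝ} (hs : 0 < s) (ht : 0 < t) :
    ∀ᵐ y ∂μ, ∀ᵐ x ∂μ, h (s + t) x y =
      specOp U (fun o => heatSym s (g o)) ((H.memLp_right ht y).toLp _) x := by
  have hσ := H.doubling.sigmaFinite
  have hst : 0 < s + t := by positivity
  have h1 := H.ae_kernel_add hs ht
  rw [Measure.ae_ae_comm (p := fun x y => h (s + t) x y = ∫ w, h s x w * h t w y ∂μ)
    (measurableSet_eq_fun (H.hasKernel _ hst).1 (H.measurable_comp hs ht))] at h1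
  filter_upwards [h1] with y hy
  filter_upwards [hy, (H.hasKernel s hs).2 ((H.memLp_right ht y).toLp _)] with x h2 h3
  rw [h2, h3.2]
  refine integral_congr_ae ?_
  filter_upwards [(H.memLp_right ht y).coeFn_toLp] with w hw
  rw [hw]

/-- Self-adjointness gives Hermitian symmetry, and reality of the kernel removes the conjugate. -/
theorem ae_kernel_symm {t : ℝ} (ht : 0 < t) : ∀ᵐ x ∂μ, ∀ᵐ y ∂μ, h t x y = h t y x := by
  have hσ := H.doubling.sigmaFinite
  have hsc := H.doubling.secondCountableTopology
  have hm := (H.hasKernel t ht).1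
  have hm' : Measurable fun z : X × X => h t z.2 z.1 := hm.comp measurable_swap
  have key : ∀ᵐ x ∂μ, ∀ᵐ y ∂μ, ‖h t x y - h t y x‖ ≤ 0 := by
    refine ae_ae_norm_le_of_double_setIntegral (K := fun x y => h t x y - h t y x) (hm.sub hm')
      (fun x y => (norm_sub_le _ _).trans (add_le_add (H.norm_le ht x y) (H.norm_le ht y x)))
      le_rfl fun A B hA hB hA' hB' => ?_
    have hfA : IsFiniteMeasure (μ.restrict A) := ⟨by simpa using hA'⟩
    have hfB : IsFiniteMeasure (μ.restrict B) := ⟨by simpa using hB'⟩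
    have hi1 : Integrable (fun z : X × X => h t z.1 z.2) ((μ.restrict A).prod (μ.restrict B)) :=
      Integrable.of_bound hm.aestronglyMeasurable _ (ae_of_all _ fun z => H.norm_le ht _ _)
    have hi2 : Integrable (fun z : X × X => h t z.2 z.1) ((μ.restrict A).prod (μ.restrict B)) :=
      Integrable.of_bound hm'.aestronglyMeasurable _ (ae_of_all _ fun z => H.norm_le ht _ _)
    have e1 := (H.hasKernel t ht).inner_indicator hA hB hA'.ne hB'.ne
    have e2 := (H.hasKernel t ht).inner_indicator hB hA hB'.ne hA'.ne
    have e3 : ∫ x in A, ∫ y in B, h t x y ∂μ ∂μ = ∫ x in A, ∫ y in B, h t y x ∂μ ∂μ := by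
      rw [← e1, ← inner_specOp_left U (H.isBddMeas_heat ht.le), ← inner_conj_symm, e2,
        ← integral_integral_swap hi2, ← integral_conj]
      · refine integral_congr_ae (ae_of_all _ fun x => ?_)
        simp only
        rw [← integral_conj]
        refine integral_congr_ae (ae_of_all _ fun y => ?_)
        exact Complex.conj_eq_iff_im.2 (H.real t ht y x)
      · intro o
        rcases lt_or_ge 0 (g o) with hl | hl
        · rw [heatSym_of_pos _ hl, Complex.conj_ofReal]
        · rw [heatSym_of_nonpos _ hl, map_zero]
    have e4 : ∫ x in A, ∫ y in B, (h t x y - h t y x) ∂μ ∂μ =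
        ∫ x in A, ∫ y in B, h t x y ∂μ ∂μ - ∫ x in A, ∫ y in B, h t y x ∂μ ∂μ :=
      integral_integral_sub hi1 hi2
    rw [e4, e3, sub_self]
    simp
  filter_upwards [key] with x hx
  filter_upwards [hx] with y hy
  exact sub_eq_zero.1 (norm_le_zero_iff.1 hy)

/-- ‖e^{tΔ}1_A‖² = ⟨1_A, e^{2tΔ}1_A⟩, bounded by the supremum of the kernel at time 2t: the L¹ to L²
bound on indicators. -/
theorem norm_heat_indicator_sq_le {t : ℝ} (ht : 0 < t) {A : Set X} (hA : MeasurableSet A)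
    (hA' : μ A < ⊤) :
    ‖specOp U (fun o => heatSym t (g o)) (indicatorConstLp 2 hA hA'.ne (1 : ℂ))‖ ^ 2 ≤
      c₁ * (t + t) ^ (-(d / (d + 1))) * μ.real A ^ 2 := by
  have htt : 0 < t + t := by positivity
  have h1 := (H.hasKernel _ htt).inner_indicator hA hA hA'.ne hA'.ne
  have h2 := specOp_mul U (H.isBddMeas_heat ht.le) (H.isBddMeas_heat ht.le)
  simp only [heatSym_mul] at h2
  set u : Lp ℂ 2 μ := indicatorConstLp 2 hA hA'.ne (1 : ℂ)
  have hreal : ∀ o, (starRingEnd ℂ) (heatSym t (g o)) = heatSym t (g o) := by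
    intro o
    rcases lt_or_ge 0 (g o) with hl | hl
    · rw [heatSym_of_pos _ hl, Complex.conj_ofReal]
    · rw [heatSym_of_nonpos _ hl, map_zero]
  have h3 : inner ℂ u (specOp U (fun o => heatSym (t + t) (g o)) u) =
      ((‖specOp U (fun o => heatSym t (g o)) u‖ : ℂ)) ^ 2 := by
    rw [h2, ContinuousLinearMap.mul_def, ContinuousLinearMap.comp_apply,
      ← inner_specOp_left U (H.isBddMeas_heat ht.le) hreal, inner_self_eq_norm_sq_to_K]
    rfl
  rw [h1] at h3
  have h4 := congrArg norm h3
  rw [norm_pow, Complex.norm_real, norm_norm] at h4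
  rw [← h4]
  have h5 : ∀ x, ‖∫ y in A, h (t + t) x y ∂μ‖ ≤ c₁ * (t + t) ^ (-(d / (d + 1))) * μ.real A :=
    fun x => norm_setIntegral_le_of_norm_le_const hA' fun y _ => H.norm_le htt x y
  refine (norm_setIntegral_le_of_norm_le_const hA' fun x _ => h5 x).trans (le_of_eq (by ring))

/-- By Cauchy–Schwarz the matrix element of heat·b·heat on 1_A, 1_B is at most ‖e^{tΔ}1_A‖
‖e^{tΔ}1_B‖. Nothing about b enters except its supremum; `hkB` is only qualitative. -/
theorem ae_norm_kernel_le {t : ℝ} (ht : 0 < t) {b : Ω → ℂ} (hb : IsBddMeas b)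
    (hb1 : ∀ o, ‖b o‖ ≤ 1) {k : X → X → ℂ}
    (hk : HasKernel (specOp U fun o => heatSym t (g o) * (b o * heatSym t (g o))) k) {B : ℝ}
    (hkB : ∀ x y, ‖k x y‖ ≤ B) :
    ∀ᵐ x ∂μ, ∀ᵐ y ∂μ, ‖k x y‖ ≤ c₁ * (t + t) ^ (-(d / (d + 1))) := by
  have hσ := H.doubling.sigmaFinite
  have hsc := H.doubling.secondCountableTopology
  have hc := H.c₁_pos
  set M := c₁ * (t + t) ^ (-(d / (d + 1)))
  have hM : 0 ≤ M := by positivity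
  refine ae_ae_norm_le_of_double_setIntegral hk.1 hkB hM fun A B hA hB hA' hB' => ?_
  rw [← hk.inner_indicator hA hB hA'.ne hB'.ne]
  have hh := H.isBddMeas_heat ht.le
  have hreal : ∀ o, (starRingEnd ℂ) (heatSym t (g o)) = heatSym t (g o) := by
    intro o
    rcases lt_or_ge 0 (g o) with hl | hl
    · rw [heatSym_of_pos _ hl, Complex.conj_ofReal]
    · rw [heatSym_of_nonpos _ hl, map_zero]
  rw [specOp_mul U hh (hb.mul hh), specOp_mul U hb hh, ContinuousLinearMap.mul_def,
    ContinuousLinearMap.comp_apply, ← inner_specOp_left U hh hreal, ContinuousLinearMap.mul_def,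
    ContinuousLinearMap.comp_apply]
  refine (norm_inner_le_norm _ _).trans ?_
  have h1 : ∀ {A : Set X} (hA : MeasurableSet A) (hA' : μ A < ⊤),
      ‖specOp U (fun o => heatSym t (g o)) (indicatorConstLp 2 hA hA'.ne (1 : ℂ))‖ ≤
        Real.sqrt M * μ.real A := by
    intro A hA hA'
    refine le_of_sq_le_sq ?_ (by positivity)
    rw [mul_pow, Real.sq_sqrt hM]
    exact H.norm_heat_indicator_sq_le ht hA hA'
  have h2 := norm_specOp_apply_le U hb hb1
    (specOp U (fun o => heatSym t (g o)) (indicatorConstLp 2 hB hB'.ne (1 : ℂ)))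
  rw [one_mul] at h2
  calc _ ≤ (Real.sqrt M * μ.real A) * (Real.sqrt M * μ.real B) :=
        mul_le_mul (h1 hA hA') (h2.trans (h1 hB hB')) (norm_nonneg _) (by positivity)
    _ = (Real.sqrt M * Real.sqrt M) * μ.real A * μ.real B := by ring
    _ = _ := by rw [Real.mul_self_sqrt hM]

end HeatModel

/-! ### Kernels of the Chebyshev multipliers -/

theorem specOp_sub {Ω H : Type*} [MeasurableSpace Ω] {ν : Measure Ω} [NormedAddCommGroup H]
    [InnerProductSpace ℂ H] (U : Lp ℂ 2 ν ≃ₗᵢ[ℂ] H) {m m' : Ω → ℂ} (hm : IsBddMeas m)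
    (hm' : IsBddMeas m') : specOp U (fun x => m x - m' x) = specOp U m - specOp U m' := by
  have h1 := specOp_add U hm (hm'.const_mul (-1))
  rw [specOp_const_mul U hm'] at h1
  simpa [sub_eq_add_neg] using h1

theorem HasKernel.sub {X : Type*} [MeasurableSpace X] {μ : Measure X}
    {S S' : Lp ℂ 2 μ →L[ℂ] Lp ℂ 2 μ} {k k' : X → X → ℂ} (h : HasKernel S k)
    (h' : HasKernel S' k') : HasKernel (S - S') (fun x y => k x y - k' x y) := by
  simpa [sub_eq_add_neg] using h.add (h'.const_smul (-1))

/-- The kernel with symbol `chebSym 2 n t`. -/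
def chebKernel {X : Type*} (h : ℝ → X → X → ℂ) (n : ℕ) (t : ℝ) (x y : X) : ℂ :=
  ∑ m ∈ Finset.range (n + 1), ((shiftedT n).coeff m : ℂ) *
    (h ((m + (2 : ℕ)) * t) x y - h ((m + (2 : ℕ) + 1) * t) x y)

namespace HeatModel

variable {Ω X : Type*} [MeasurableSpace Ω] [MetricSpace X] [MeasurableSpace X] [BorelSpace X]
  {ν : Measure Ω} {μ : Measure X} {U : Lp ℂ 2 ν ≃ₗᵢ[ℂ] Lp ℂ 2 μ} {g : Ω → ℝ}
  {h : ℝ → X → X → ℂ} {d γ c₁ c₂ : ℝ} (H : HeatModel U g h d γ c₁ c₂)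

include H

theorem hasKernel_cheb (n : ℕ) {t : ℝ} (ht : 0 < t) :
    HasKernel (specOp U fun o => chebSym 2 n t (g o)) (chebKernel h n t) := by
  have hb : ∀ {a : ℝ}, 0 ≤ a → IsBddMeas fun o => heatSym (a * t) (g o) := fun ha =>
    H.isBddMeas_heat (by positivity)
  have h1 : (specOp U fun o => chebSym 2 n t (g o)) = ∑ m ∈ Finset.range (n + 1),
      ((shiftedT n).coeff m : ℂ) • (specOp U (fun o => heatSym ((m + (2 : ℕ)) * t) (g o)) -
        specOp U fun o => heatSym ((m + (2 : ℕ) + 1) * t) (g o)) := by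
    simp only [chebSym]
    rw [specOp_sum U fun m _ => ((hb (by positivity)).sub (hb (by positivity))).const_mul _]
    refine Finset.sum_congr rfl fun m _ => ?_
    rw [specOp_const_mul U ((hb (by positivity)).sub (hb (by positivity))),
      specOp_sub U (hb (by positivity)) (hb (by positivity))]
  rw [h1]
  exact HasKernel.sum fun m _ => ((H.hasKernel _ (by positivity)).sub
    (H.hasKernel _ (by positivity))).const_smul _

/-- In the heat kernel bound the power of time decreases and the exponential increases, so all times
between t and bt share one bound. -/
theorem norm_kernel_scaled_le {t : ℝ} (ht : 0 < t) {a b : ℝ} (ha : 1 ≤ a) (hab : a ≤ b)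
    (x y : X) : ‖h (a * t) x y‖ ≤ c₁ * t ^ (-(d / (d + 1))) *
      Real.exp (-(c₂ * (dist x y ^ (d + 1) / t / b) ^ γ)) := by
  have ha0 : 0 < a := by linarith
  have hd := H.d_pos
  have hγ := H.γ_pos
  have hc₁ := H.c₁_pos
  have hc₂ := H.c₂_pos
  refine (H.bound _ (by positivity) x y).trans ?_
  have h1 : (a * t) ^ (-(d / (d + 1))) ≤ t ^ (-(d / (d + 1))) :=
    Real.rpow_le_rpow_of_nonpos ht (by nlinarith) (by
      have : 0 ≤ d / (d + 1) := by positivity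
      linarith)
  have h2 : dist x y ^ (d + 1) / t / b ≤ dist x y ^ (d + 1) / (a * t) := by
    rw [div_div, mul_comm a t]
    gcongr
  have hb0 : 0 < b := by linarith
  gcongr

/-- There are n + 1 terms with coefficients at most 7^n, each a difference of heat kernels at times
between 2t and (n+3)t. -/
theorem norm_chebKernel_le (n : ℕ) {t : ℝ} (ht : 0 < t) (x y : X) :
    ‖chebKernel h n t x y‖ ≤ 2 * c₁ * t ^ (-(d / (d + 1))) *
      ((n + 1) * 7 ^ n * Real.exp (-(c₂ * (dist x y ^ (d + 1) / t / (n + 3)) ^ γ))) := by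
  set B := c₁ * t ^ (-(d / (d + 1))) *
    Real.exp (-(c₂ * (dist x y ^ (d + 1) / t / (n + 3)) ^ γ)) with hB
  have hterm : ∀ m ∈ Finset.range (n + 1), ‖((shiftedT n).coeff m : ℂ) *
      (h ((m + (2 : ℕ)) * t) x y - h ((m + (2 : ℕ) + 1) * t) x y)‖ ≤ 7 ^ n * (2 * B) := by
    intro m hm
    have hmn : (m : ℝ) ≤ n := by exact_mod_cast Nat.lt_succ_iff.1 (Finset.mem_range.1 hm)
    have hm0 : (0 : ℝ) ≤ m := Nat.cast_nonneg m
    rw [norm_mul, Complex.norm_real, Real.norm_eq_abs]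
    refine mul_le_mul ((shiftedT_bounds n).2 m) ?_ (norm_nonneg _) (by positivity)
    have e1 := H.norm_kernel_scaled_le ht (a := m + (2 : ℕ)) (b := n + 3)
      (by push_cast; linarith) (by push_cast; linarith) x y
    have e2 := H.norm_kernel_scaled_le ht (a := m + (2 : ℕ) + 1) (b := n + 3)
      (by push_cast; linarith) (by push_cast; linarith) x y
    calc _ ≤ B + B := (norm_sub_le _ _).trans (add_le_add e1 e2)
      _ = 2 * B := by ring
  calc ‖chebKernel h n t x y‖ ≤ ∑ m ∈ Finset.range (n + 1), 7 ^ n * (2 * B) :=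
        norm_sum_le_of_le _ hterm
    _ = _ := by
      rw [Finset.sum_const, Finset.card_range, nsmul_eq_mul, hB]
      push_cast
      ring

theorem norm_chebKernel_le_const (n : ℕ) {t : ℝ} (ht : 0 < t) (x y : X) :
    ‖chebKernel h n t x y‖ ≤ 2 * c₁ * t ^ (-(d / (d + 1))) * ((n + 1) * 7 ^ n) := by
  have hc₁ := H.c₁_pos
  have hc₂ := H.c₂_pos
  refine (H.norm_chebKernel_le n ht x y).trans ?_
  have : Real.exp (-(c₂ * (dist x y ^ (d + 1) / t / (n + 3)) ^ γ)) ≤ 1 := by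
    rw [Real.exp_le_one_iff, neg_nonpos]
    positivity
  refine mul_le_mul_of_nonneg_left ?_ (by positivity)
  exact mul_le_of_le_one_right (by positivity) this

/-- No growth in n, because the Chebyshev factor is a contraction between two heat operators. The
factor 2 is not needed here; it matches `norm_chebKernel_le` so that a common constant factors out
of the minimum. -/
theorem ae_norm_chebKernel_le (n : ℕ) {t : ℝ} (ht : 0 < t) :
    ∀ᵐ x ∂μ, ∀ᵐ y ∂μ, ‖chebKernel h n t x y‖ ≤ 2 * c₁ * t ^ (-(d / (d + 1))) := by
  have hd := H.d_pos
  have hc₁ := H.c₁_pos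
  have hk := H.hasKernel_cheb n ht
  have hsym : (fun o => chebSym 2 n t (g o)) =
      fun o => heatSym t (g o) * (chebSym 0 n t (g o) * heatSym t (g o)) := by
    ext o
    have e1 := chebSym_eq_mul_heatSym 1 1 n t (g o)
    have e2 := chebSym_eq_mul_heatSym 1 0 n t (g o)
    simp only [Nat.cast_one, one_mul, zero_add] at e1 e2
    rw [show (2 : ℕ) = 1 + 1 from rfl, e1, e2]
    ring
  rw [hsym] at hk
  have key := H.ae_norm_kernel_le ht (H.isBddMeas_cheb 0 n ht.le)
    (fun o => norm_chebSym_le 0 n ht.le _) hk (H.norm_chebKernel_le_const n ht)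
  filter_upwards [key] with x hx
  filter_upwards [hx] with y hy
  refine hy.trans ?_
  have h1 : (t + t) ^ (-(d / (d + 1))) ≤ t ^ (-(d / (d + 1))) :=
    Real.rpow_le_rpow_of_nonpos ht (by linarith) (by
      have : 0 ≤ d / (d + 1) := by positivity
      linarith)
  have h2 : 0 ≤ t ^ (-(d / (d + 1))) := by positivity
  nlinarith

theorem memLp_chebKernel (n : ℕ) {t : ℝ} (ht : 0 < t) (x : X) :
    MemLp (chebKernel h n t x) 2 μ := by
  have : chebKernel h n t x = fun y => ∑ m ∈ Finset.range (n + 1), ((shiftedT n).coeff m : ℂ) *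
    (h ((m + (2 : ℕ)) * t) x y - h ((m + (2 : ℕ) + 1) * t) x y) := rfl
  rw [this]
  exact memLp_finsetSum _ fun m _ => ((H.memLp_left (by positivity) x).sub
    (H.memLp_left (by positivity) x)).const_mul _

/-- One heat factor is spent on producing the L² vector h_t(·,y), which lowers the weight index from
2 to 1. That vector does not depend on n, so slices with different n can later be summed as
multipliers applied to one vector. -/
theorem chebKernel_slice (n : ℕ) {t : ℝ} (ht : 0 < t) {y : X}
    (hy : ∀ m : ℕ, ∀ᵐ x ∂μ, h ((m + 1) * t + t) x y =
      specOp U (fun o => heatSym ((m + 1) * t) (g o)) ((H.memLp_right ht y).toLp _) x) :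
    (fun x => chebKernel h n t x y) =ᵐ[μ]
      specOp U (fun o => chebSym 1 n t (g o)) ((H.memLp_right ht y).toLp _) := by
  set η := (H.memLp_right ht y).toLp _
  have hb : ∀ {a : ℝ}, 0 ≤ a → IsBddMeas fun o => heatSym (a * t) (g o) := fun ha =>
    H.isBddMeas_heat (by positivity)
  have h1 : specOp U (fun o => chebSym 1 n t (g o)) η = ∑ m ∈ Finset.range (n + 1),
      ((shiftedT n).coeff m : ℂ) • (specOp U (fun o => heatSym ((m + (1 : ℕ)) * t) (g o)) η -
        specOp U (fun o => heatSym ((m + (1 : ℕ) + 1) * t) (g o)) η) := by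
    simp only [chebSym]
    rw [specOp_sum U fun m _ => ((hb (by positivity)).sub (hb (by positivity))).const_mul _,
      sum_apply]
    refine Finset.sum_congr rfl fun m _ => ?_
    rw [specOp_const_mul U ((hb (by positivity)).sub (hb (by positivity))),
      specOp_sub U (hb (by positivity)) (hb (by positivity))]
    rfl
  rw [h1]
  filter_upwards [Lp.coeFn_finsetSum (Finset.range (n + 1)) fun m =>
      ((shiftedT n).coeff m : ℂ) • (specOp U (fun o => heatSym ((m + (1 : ℕ)) * t) (g o)) η -
        specOp U (fun o => heatSym ((m + (1 : ℕ) + 1) * t) (g o)) η),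
    ae_all_iff.2 hy,
    ae_all_iff.2 fun m : ℕ => Lp.coeFn_smul ((shiftedT n).coeff m : ℂ)
      (specOp U (fun o => heatSym ((m + (1 : ℕ)) * t) (g o)) η -
        specOp U (fun o => heatSym ((m + (1 : ℕ) + 1) * t) (g o)) η),
    ae_all_iff.2 fun m : ℕ => Lp.coeFn_sub (specOp U (fun o => heatSym ((m + (1 : ℕ)) * t) (g o)) η)
      (specOp U (fun o => heatSym ((m + (1 : ℕ) + 1) * t) (g o)) η)] with x h2 h3 h4 h5
  rw [h2, Finset.sum_apply]
  refine Finset.sum_congr rfl fun m _ => ?_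
  rw [h4 m, Pi.smul_apply, h5 m, Pi.sub_apply, smul_eq_mul]
  have e1 := h3 m
  have e2 := h3 (m + 1)
  rw [show (((m : ℝ) + 1) * t + t) = ((m + (2 : ℕ)) * t) by push_cast; ring] at e1
  rw [show ((((m + 1 : ℕ) : ℝ) + 1) * t + t) = ((m + (2 : ℕ) + 1) * t) by push_cast; ring] at e2
  rw [e1, e2]
  push_cast
  rfl

/-- The bounds and the symmetry hold only almost everywhere, but they are needed at every point.
Setting the kernels to zero off a suitable symmetric conull set secures them everywhere without
changing the operators; t = 2^{-j} and the index n enters through |n|. -/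
theorem exists_kernel_family : ∃ κ : ℤ → ℤ → X → X → ℂ,
    (∀ n j, Measurable fun z : X × X => κ n j z.1 z.2) ∧
    (∀ n j x y, κ n j x y = κ n j y x) ∧
    (∀ n j x, MemLp (κ n j x) 2 μ) ∧
    (∀ n j, HasKernel (specOp U fun o => chebSym 2 n.natAbs (2 ^ (-j)) (g o)) (κ n j)) ∧
    (∀ M : ℕ, ∃ C : ℝ, 0 < C ∧ ∃ A : ℕ, ∀ n j x y, x ≠ y → ‖κ n j x y‖ ≤
      C * (1 + n.natAbs) ^ A * ((2 : ℝ) ^ j) ^ (d / (d + 1)) *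
        min 1 (((2 : ℝ) ^ j * dist x y ^ (d + 1)) ^ M)⁻¹) ∧
    (∀ j y, ∃ η : Lp ℂ 2 μ, ∀ n, (fun x => κ n j x y) =ᵐ[μ]
      specOp U (fun o => chebSym 1 n.natAbs (2 ^ (-j)) (g o)) η) := by
  have hσ := H.doubling.sigmaFinite
  have hc₁ := H.c₁_pos
  have ht : ∀ j : ℤ, (0 : ℝ) < 2 ^ (-j) := fun j => by positivity
  let K : ℤ → ℤ → X → X → ℂ := fun n j => chebKernel h n.natAbs (2 ^ (-j))
  have hKm : ∀ n j, Measurable fun z : X × X => K n j z.1 z.2 := fun n j =>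
    (H.hasKernel_cheb n.natAbs (ht j)).1
  -- The good pairs, for all n and j at once; countability of the indices keeps this set conull. It
  -- is closed under exchanging x and y.
  let G : Set (X × X) := {z | ∀ n j, ‖K n j z.1 z.2‖ ≤
    2 * c₁ * ((2 : ℝ) ^ (-j)) ^ (-(d / (d + 1))) ∧ K n j z.1 z.2 = K n j z.2 z.1}
  have hGm : MeasurableSet G := by
    have : G = ⋂ n, ⋂ j, {z : X × X | ‖K n j z.1 z.2‖ ≤
        2 * c₁ * ((2 : ℝ) ^ (-j)) ^ (-(d / (d + 1)))} ∩ {z | K n j z.1 z.2 = K n j z.2 z.1} := by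
      ext z; simp [G]
    rw [this]
    exact MeasurableSet.iInter fun n => MeasurableSet.iInter fun j =>
      (measurableSet_le (hKm n j).norm measurable_const).inter
        (measurableSet_eq_fun (hKm n j) ((hKm n j).comp measurable_swap))
  have hGsymm : ∀ x y, (x, y) ∈ G → (y, x) ∈ G := fun x y hxy n j =>
    ⟨(hxy n j).2 ▸ (hxy n j).1, (hxy n j).2.symm⟩
  have hGae : ∀ᵐ x ∂μ, ∀ᵐ y ∂μ, (x, y) ∈ G := by
    have e1 : ∀ᵐ x ∂μ, ∀ n j, ∀ᵐ y ∂μ, ‖K n j x y‖ ≤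
        2 * c₁ * ((2 : ℝ) ^ (-j)) ^ (-(d / (d + 1))) :=
      ae_all_iff.2 fun n => ae_all_iff.2 fun j => H.ae_norm_chebKernel_le n.natAbs (ht j)
    have e2 : ∀ᵐ x ∂μ, ∀ (j : ℤ) (m : ℕ), ∀ᵐ y ∂μ,
        h ((m + 1) * 2 ^ (-j)) x y = h ((m + 1) * 2 ^ (-j)) y x :=
      ae_all_iff.2 fun j => ae_all_iff.2 fun m => H.ae_kernel_symm (by positivity)
    filter_upwards [e1, e2] with x h1 h2
    have h1' := ae_all_iff.2 fun n => ae_all_iff.2 fun j => h1 n j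
    have h2' := ae_all_iff.2 fun j => ae_all_iff.2 fun m => h2 j m
    filter_upwards [h1', h2'] with y h3 h4 n j
    refine ⟨h3 n j, ?_⟩
    refine Finset.sum_congr rfl fun m _ => ?_
    have e3 := h4 j (m + 1)
    have e4 := h4 j (m + 2)
    push_cast at e3 e4 ⊢
    rw [show (m : ℝ) + 1 + 1 = m + 2 by ring] at e3
    rw [e3, e4]
  have hYae : ∀ᵐ y ∂μ, (∀ᵐ x ∂μ, (x, y) ∈ G) ∧ ∀ (j : ℤ) (m : ℕ), ∀ᵐ x ∂μ,
      h ((m + 1) * 2 ^ (-j) + 2 ^ (-j)) x y =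
        specOp U (fun o => heatSym ((m + 1) * 2 ^ (-j)) (g o))
          ((H.memLp_right (ht j) y).toLp _) x := by
    have e2 : ∀ᵐ y ∂μ, ∀ (j : ℤ) (m : ℕ), ∀ᵐ x ∂μ,
      h ((m + 1) * 2 ^ (-j) + 2 ^ (-j)) x y =
        specOp U (fun o => heatSym ((m + 1) * 2 ^ (-j)) (g o))
          ((H.memLp_right (ht j) y).toLp _) x :=
      ae_all_iff.2 fun j => ae_all_iff.2 fun m => H.ae_kernel_add_apply (by positivity) (ht j)
    filter_upwards [hGae, e2] with y h1 h2
    refine ⟨?_, h2⟩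
    filter_upwards [h1] with x hx using hGsymm _ _ hx
  -- A measurable conull set of y for which almost every (x, y) is good and the semigroup law holds
  -- for the slice; the truncation to Y × Y makes every surviving slice legitimate.
  obtain ⟨Y, hYm, hYsub, hYfull⟩ : ∃ Y : Set X, MeasurableSet Y ∧
      (∀ y ∈ Y, (∀ᵐ x ∂μ, (x, y) ∈ G) ∧ ∀ (j : ℤ) (m : ℕ), ∀ᵐ x ∂μ,
      h ((m + 1) * 2 ^ (-j) + 2 ^ (-j)) x y =
        specOp U (fun o => heatSym ((m + 1) * 2 ^ (-j)) (g o))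
          ((H.memLp_right (ht j) y).toLp _) x) ∧ ∀ᵐ y ∂μ, y ∈ Y := by
    obtain ⟨t, ht1, ht2, ht3⟩ := exists_measurable_superset_of_null (ae_iff.1 hYae)
    refine ⟨tᶜ, ht2.compl, fun y hy => ?_, compl_mem_ae_iff.2 ht3⟩
    by_contra hc
    exact hy (ht1 hc)
  let G' : Set (X × X) := G ∩ (Y ×ˢ Y)
  have hG'm : MeasurableSet G' := hGm.inter (hYm.prod hYm)
  have hG'symm : ∀ x y, (x, y) ∈ G' ↔ (y, x) ∈ G' := fun x y =>
    ⟨fun hz => ⟨hGsymm _ _ hz.1, hz.2.2, hz.2.1⟩, fun hz => ⟨hGsymm _ _ hz.1, hz.2.2, hz.2.1⟩⟩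
  classical
  let κ : ℤ → ℤ → X → X → ℂ := fun n j x y => G'.indicator (fun z => K n j z.1 z.2) (x, y)
  have hκK : ∀ n j x y, (x, y) ∈ G' → κ n j x y = K n j x y := fun n j x y hz =>
    indicator_of_mem hz _
  have hκ0 : ∀ n j x y, (x, y) ∉ G' → κ n j x y = 0 := fun n j x y hz =>
    indicator_of_notMem hz _
  refine ⟨κ, fun n j => (hKm n j).indicator hG'm, fun n j x y => ?_, fun n j x => ?_,
    fun n j => ?_, fun M => ?_, fun j y => ?_⟩
  · by_cases hz : (x, y) ∈ G'
    · rw [hκK n j x y hz, hκK n j y x ((hG'symm x y).1 hz), (hz.1 n j).2]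
    · rw [hκ0 n j x y hz, hκ0 n j y x fun hz' => hz ((hG'symm x y).2 hz')]
  · have : κ n j x = (Prod.mk x ⁻¹' G').indicator (K n j x) := rfl
    rw [this]
    exact (H.memLp_chebKernel n.natAbs (ht j) x).indicator (measurable_prodMk_left hG'm)
  · refine (H.hasKernel_cheb n.natAbs (ht j)).congr ((hKm n j).indicator hG'm) ?_
    filter_upwards [hYfull, hGae] with x hx hx'
    filter_upwards [hYfull, hx'] with y hy hy'
    exact hκK n j x y ⟨hy', hx, hy⟩
  · obtain ⟨C, hC, A, hle⟩ := exists_min_one_exp_le M H.c₂_pos H.γ_pos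
    refine ⟨2 * c₁ * C, by positivity, A, fun n j x y hxy => ?_⟩
    have hdist : 0 < dist x y := dist_pos.2 hxy
    have ht' : ((2 : ℝ) ^ (-j)) ^ (-(d / (d + 1))) = ((2 : ℝ) ^ j) ^ (d / (d + 1)) := by
      rw [zpow_neg, Real.inv_rpow (by positivity), ← Real.rpow_neg (by positivity), neg_neg]
    have hr : dist x y ^ (d + 1) / (2 : ℝ) ^ (-j) = (2 : ℝ) ^ j * dist x y ^ (d + 1) := by
      rw [zpow_neg, div_inv_eq_mul, mul_comm]
    by_cases hz : (x, y) ∈ G'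
    · rw [hκK n j x y hz]
      have e1 := (hz.1 n j).1
      have e2 := H.norm_chebKernel_le n.natAbs (ht j) x y
      simp only at e1
      rw [ht'] at e1 e2
      rw [hr] at e2
      have e3 := hle n.natAbs ((2 : ℝ) ^ j * dist x y ^ (d + 1)) (by positivity)
      calc ‖K n j x y‖ ≤ 2 * c₁ * ((2 : ℝ) ^ j) ^ (d / (d + 1)) * min 1 ((n.natAbs + 1) *
            7 ^ n.natAbs * Real.exp (-(c₂ *
              ((2 : ℝ) ^ j * dist x y ^ (d + 1) / (n.natAbs + 3)) ^ γ))) := by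
            rw [mul_min_of_nonneg _ _ (by positivity), mul_one]
            exact le_min e1 e2
        _ ≤ 2 * c₁ * ((2 : ℝ) ^ j) ^ (d / (d + 1)) * (C * (1 + n.natAbs) ^ A *
            min 1 (((2 : ℝ) ^ j * dist x y ^ (d + 1)) ^ M)⁻¹) :=
            mul_le_mul_of_nonneg_left e3 (by positivity)
        _ = _ := by ring
    · rw [hκ0 n j x y hz, norm_zero]
      positivity
  · by_cases hy : y ∈ Y
    · refine ⟨(H.memLp_right (ht j) y).toLp _, fun n => ?_⟩
      obtain ⟨hy1, hy2⟩ := hYsub y hy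
      refine EventuallyEq.trans ?_ (H.chebKernel_slice n.natAbs (ht j) (hy2 j))
      filter_upwards [hYfull, hy1] with x hx hx'
      exact hκK n j x y ⟨hx', hx, hy⟩
    -- For y outside Y the truncated slice is identically zero, so the zero vector represents it.
    · refine ⟨0, fun n => ?_⟩
      rw [map_zero]
      filter_upwards [Lp.coeFn_zero ℂ 2 μ] with x hx
      rw [hx]
      exact hκ0 n j x y fun hz => hy hz.2.2

end HeatModel

/-! ### Mixed partial derivatives on the orthant -/

section MixedPartial

variable {N : ℕ}

theorem isOpen_posOrthant : IsOpen (posOrthant N) := by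
  have : posOrthant N = Set.univ.pi fun _ => Ioi (0 : ℝ) := by ext; simp [posOrthant]
  rw [this]
  exact isOpen_set_pi finite_univ fun _ _ => isOpen_Ioi

theorem measurableSet_posOrthant : MeasurableSet (posOrthant N) :=
  isOpen_posOrthant.measurableSet

/-- The partial derivative in the `k`-th coordinate. -/
def partialDeriv (k : Fin N) (f : (Fin N → ℝ) → ℂ) : (Fin N → ℝ) → ℂ :=
  fun l => lineDeriv ℝ f l (Pi.single k 1)

theorem mixedPartial_eq_foldr (α : Fin N → ℕ) (p : (Fin N → ℝ) → ℂ) :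
    mixedPartial α p = (List.finRange N).foldr (fun k g => (partialDeriv k)^[α k] g) p := rfl

section Smooth

variable {s : Set (Fin N → ℝ)} {f g : (Fin N → ℝ) → ℂ}

theorem partialDeriv_eqOn_fderiv (hs : IsOpen s) (hf : ContDiffOn ℝ ∞ f s) (k : Fin N) :
    EqOn (partialDeriv k f) (fun l => fderiv ℝ f l (Pi.single k 1)) s := fun l hl =>
  ((hf.contDiffAt (hs.mem_nhds hl)).differentiableAt (by simp)).lineDeriv_eq_fderiv

theorem contDiffOn_partialDeriv (hs : IsOpen s) (hf : ContDiffOn ℝ ∞ f s) (k : Fin N) :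
    ContDiffOn ℝ ∞ (partialDeriv k f) s :=
  ((hf.fderiv_of_isOpen hs (by simp)).clm_apply contDiffOn_const).congr
    (partialDeriv_eqOn_fderiv hs hf k)

theorem partialDeriv_congr (hs : IsOpen s) (h : EqOn f g s) (k : Fin N) :
    EqOn (partialDeriv k f) (partialDeriv k g) s := fun l hl => by
  have : f =ᶠ[𝓝 l] g := by filter_upwards [hs.mem_nhds hl] with x hx using h hx
  exact this.lineDeriv_eq

theorem partialDeriv_comm (hs : IsOpen s) (hf : ContDiffOn ℝ ∞ f s) (k m : Fin N) :
    EqOn (partialDeriv k (partialDeriv m f)) (partialDeriv m (partialDeriv k f)) s := by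
  have key : ∀ k m : Fin N, ∀ l ∈ s, partialDeriv k (partialDeriv m f) l =
      fderiv ℝ (fderiv ℝ f) l (Pi.single k 1) (Pi.single m 1) := by
    intro k m l hl
    rw [partialDeriv_congr hs (partialDeriv_eqOn_fderiv hs hf m) k hl]
    have h1 : ContDiffOn ℝ ∞ (fderiv ℝ f) s := hf.fderiv_of_isOpen hs (by simp)
    have h2 : DifferentiableAt ℝ (fderiv ℝ f) l :=
      (h1.contDiffAt (hs.mem_nhds hl)).differentiableAt (by simp)
    have h3 := h2.hasFDerivAt.clm_apply (hasFDerivAt_const (Pi.single m (1 : ℝ)) l)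
    rw [partialDeriv, h3.differentiableAt.lineDeriv_eq_fderiv, h3.fderiv]
    simp
  intro l hl
  rw [key k m l hl, key m k l hl]
  have h1 : IsSymmSndFDerivAt ℝ f l :=
    (hf.contDiffAt (hs.mem_nhds hl)).isSymmSndFDerivAt (by simp; exact WithTop.coe_le_coe.2 (le_top : (2 : ℕ∞) ≤ ⊤))
  exact h1 _ _

theorem contDiffOn_iterate_partialDeriv (hs : IsOpen s) (hf : ContDiffOn ℝ ∞ f s) (k : Fin N)
    (n : ℕ) : ContDiffOn ℝ ∞ ((partialDeriv k)^[n] f) s := by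
  induction n with
  | zero => exact hf
  | succ n ih => rw [Function.iterate_succ_apply']; exact contDiffOn_partialDeriv hs ih k

theorem iterate_partialDeriv_congr (hs : IsOpen s) (h : EqOn f g s) (k : Fin N) (n : ℕ) :
    EqOn ((partialDeriv k)^[n] f) ((partialDeriv k)^[n] g) s := by
  induction n with
  | zero => exact h
  | succ n ih => simp only [Function.iterate_succ_apply']; exact partialDeriv_congr hs ih k

theorem partialDeriv_iterate_comm (hs : IsOpen s) (hf : ContDiffOn ℝ ∞ f s) (k m : Fin N)
    (n : ℕ) : EqOn (partialDeriv k ((partialDeriv m)^[n] f))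
      ((partialDeriv m)^[n] (partialDeriv k f)) s := by
  induction n with
  | zero => exact fun _ _ => rfl
  | succ n ih =>
    simp only [Function.iterate_succ_apply']
    exact (partialDeriv_comm hs (contDiffOn_iterate_partialDeriv hs hf m n) k m).trans
      (partialDeriv_congr hs ih m)

theorem contDiffOn_foldr_partialDeriv (hs : IsOpen s) (hf : ContDiffOn ℝ ∞ f s) (α : Fin N → ℕ)
    (L : List (Fin N)) :
    ContDiffOn ℝ ∞ (L.foldr (fun k g => (partialDeriv k)^[α k] g) f) s := by
  induction L with
  | nil => exact hf
  | cons m L ih => exact contDiffOn_iterate_partialDeriv hs ih m _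

/-- `mixedPartial` fixes an order of differentiation; symmetry of second derivatives carries the
extra derivative to the block of its own variable, which occurs once since the list has no
duplicates. -/
theorem partialDeriv_foldr (hs : IsOpen s) (hf : ContDiffOn ℝ ∞ f s) (α : Fin N → ℕ)
    (k : Fin N) (L : List (Fin N)) (hL : L.Nodup) (hk : k ∈ L) :
    EqOn (partialDeriv k (L.foldr (fun k g => (partialDeriv k)^[α k] g) f))
      (L.foldr (fun m g => (partialDeriv m)^[(α + Pi.single k 1 : Fin N → ℕ) m] g) f) s := by
  induction L with
  | nil => simp at hk
  | cons m L ih =>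
    obtain ⟨hm, hL'⟩ := List.nodup_cons.1 hL
    simp only [List.foldr_cons]
    by_cases hkm : k = m
    · subst hkm
      have h1 : L.foldr (fun m g => (partialDeriv m)^[(α + Pi.single k 1 : Fin N → ℕ) m] g) f =
          L.foldr (fun k g => (partialDeriv k)^[α k] g) f := by
        refine List.foldr_ext _ _ _ fun m hmL g => ?_
        have : m ≠ k := fun h => hm (h ▸ hmL)
        simp [this]
      rw [h1]
      simp only [Pi.add_apply, Pi.single_eq_same, Function.iterate_succ_apply']
      exact fun _ _ => rfl
    · have hkL : k ∈ L := (List.mem_cons.1 hk).resolve_left hkm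
      have h2 : (α + Pi.single k 1 : Fin N → ℕ) m = α m := by simp [Ne.symm hkm]
      rw [h2]
      exact (partialDeriv_iterate_comm hs (contDiffOn_foldr_partialDeriv hs hf α L) k m _).trans
        (iterate_partialDeriv_congr hs (ih hL' hkL) m _)

end Smooth

variable {p : (Fin N → ℝ) → ℂ}

theorem contDiffOn_mixedPartial (hp : ContDiffOn ℝ ∞ p (posOrthant N)) (α : Fin N → ℕ) :
    ContDiffOn ℝ ∞ (mixedPartial α p) (posOrthant N) :=
  contDiffOn_foldr_partialDeriv isOpen_posOrthant hp α _

theorem mixedPartial_zero (p : (Fin N → ℝ) → ℂ) : mixedPartial 0 p = p := by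
  rw [mixedPartial_eq_foldr]
  induction List.finRange N with
  | nil => rfl
  | cons m L ih => simp

theorem hasDerivAt_mixedPartial (hp : ContDiffOn ℝ ∞ p (posOrthant N)) (α : Fin N → ℕ)
    (k : Fin N) {l : Fin N → ℝ} (hl : l ∈ posOrthant N) :
    HasDerivAt (fun t => mixedPartial α p (Function.update l k t))
      (mixedPartial (α + Pi.single k 1) p l) (l k) := by
  have h1 : DifferentiableAt ℝ (mixedPartial α p) l :=
    ((contDiffOn_mixedPartial hp α).contDiffAt (isOpen_posOrthant.mem_nhds hl)).differentiableAt
      (by simp)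
  have h2 : fderiv ℝ (mixedPartial α p) l (Pi.single k 1) =
      mixedPartial (α + Pi.single k 1) p l := by
    rw [← h1.lineDeriv_eq_fderiv]
    exact partialDeriv_foldr isOpen_posOrthant hp α k _ (List.nodup_finRange N)
      (List.mem_finRange k) hl
  have h3 := HasFDerivAt.comp_hasDerivAt (l k) (f := Function.update l k)
    (by rw [Function.update_eq_self]; exact h1.hasFDerivAt) (hasDerivAt_update l k (l k))
  rw [h2] at h3
  exact h3

/-- The scale-invariant derivative `λ^α ∂^α p`. -/
def scaledPartial (α : Fin N → ℕ) (p : (Fin N → ℝ) → ℂ) (l : Fin N → ℝ) : ℂ :=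
  (∏ k, (l k : ℂ) ^ α k) * mixedPartial α p l

theorem scaledPartial_zero (p : (Fin N → ℝ) → ℂ) : scaledPartial 0 p = p := by
  ext l; simp [scaledPartial, mixedPartial_zero]

theorem continuousOn_scaledPartial (hp : ContDiffOn ℝ ∞ p (posOrthant N)) (α : Fin N → ℕ) :
    ContinuousOn (scaledPartial α p) (posOrthant N) := by
  refine ContinuousOn.mul (Continuous.continuousOn ?_) (contDiffOn_mixedPartial hp α).continuousOn
  fun_prop

theorem exists_norm_scaledPartial_le (hp : IsSymbolZero p) (α : Fin N → ℕ) :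
    ∃ C, 0 ≤ C ∧ ∀ l ∈ posOrthant N, ‖scaledPartial α p l‖ ≤ C := by
  obtain ⟨C, hC⟩ := hp.2 α
  refine ⟨max C 0, le_max_right _ _, fun l hl => le_trans ?_ (le_max_left _ _)⟩
  refine le_trans (le_of_eq ?_) (hC l hl)
  rw [scaledPartial, norm_mul, norm_prod]
  congr 1
  refine Finset.prod_congr rfl fun k _ => ?_
  rw [norm_pow, Complex.norm_real, Real.norm_of_nonneg (hl k).le]

/-- Product rule: λ_k ∂_k maps λ^α ∂^α p to α_k λ^α ∂^α p plus the term with α + e_k. The functions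
bounded by the symbol condition are thus stable under the dilation-invariant derivatives. -/
theorem hasDerivAt_scaledPartial (hp : ContDiffOn ℝ ∞ p (posOrthant N)) (α : Fin N → ℕ)
    (k : Fin N) {l : Fin N → ℝ} (hl : l ∈ posOrthant N) :
    HasDerivAt (fun t => scaledPartial α p (Function.update l k t))
      ((α k * scaledPartial α p l + scaledPartial (α + Pi.single k 1) p l) / l k) (l k) := by
  have hlk : (l k : ℂ) ≠ 0 := by exact_mod_cast (hl k).ne'
  have hA : ∀ t : ℝ, ∏ m, ((Function.update l k t m : ℝ) : ℂ) ^ α m =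
      (t : ℂ) ^ α k * ∏ m ∈ Finset.univ.erase k, (l m : ℂ) ^ α m := by
    intro t
    rw [← Finset.mul_prod_erase _ _ (Finset.mem_univ k), Function.update_self]
    congr 1
    refine Finset.prod_congr rfl fun m hm => ?_
    rw [Function.update_of_ne (Finset.ne_of_mem_erase hm)]
  have h0 := hA (l k)
  rw [Function.update_eq_self] at h0
  have h1 : ∏ m, (l m : ℂ) ^ (α + Pi.single k 1 : Fin N → ℕ) m =
      l k * ∏ m, (l m : ℂ) ^ α m := by
    simp only [Pi.add_apply, pow_add, Finset.prod_mul_distrib]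
    rw [mul_comm]
    congr 1
    rw [Finset.prod_eq_single k (fun m _ hm => by simp [hm]) (by simp)]
    simp
  set P := ∏ m ∈ Finset.univ.erase k, (l m : ℂ) ^ α m
  have h2 : HasDerivAt (fun t : ℝ => (t : ℂ) ^ α k * P)
      ((α k * (l k : ℂ) ^ (α k - 1)) * P) (l k) := by
    have := ((hasDerivAt_pow (α k) (l k : ℂ)).comp_ofReal).mul_const P
    simpa using this
  have h3 := h2.mul (hasDerivAt_mixedPartial hp α k hl)
  have h4 : (fun t => scaledPartial α p (Function.update l k t)) =
      fun t : ℝ => ((t : ℂ) ^ α k * P) * mixedPartial α p (Function.update l k t) := by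
    ext t; rw [scaledPartial, hA]
  rw [h4]
  refine h3.congr_deriv ?_
  rw [Function.update_eq_self, eq_div_iff hlk, scaledPartial, scaledPartial, h1, h0]
  rcases Nat.eq_zero_or_pos (α k) with h | h
  · simp [h]; ring
  · have : (l k : ℂ) ^ α k = (l k : ℂ) ^ (α k - 1) * l k := by
      rw [← pow_succ, Nat.sub_add_cancel h]
    rw [this]; ring

end MixedPartial

/-! ### The change of variables `e^{-s} = cos² (π θ)` and bump functions -/

section Bump

/-- The parametrization `s = -log cos² (π θ)` of `(0,∞)` by `θ ∈ (0,1/2)`. -/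
def logCos (θ : ℝ) : ℝ := -2 * Real.log (Real.cos (Real.pi * θ))

/-- The interval `(0,1/2)`. -/
def halfIoo : Set ℝ := Ioo 0 (1 / 2)

theorem isOpen_halfIoo : IsOpen halfIoo := isOpen_Ioo

theorem cos_mem_of_mem_halfIoo {θ : ℝ} (hθ : θ ∈ halfIoo) :
    0 < Real.cos (Real.pi * θ) ∧ Real.cos (Real.pi * θ) < 1 := by
  obtain ⟨h0, h1⟩ := hθ
  have hpi := Real.pi_pos
  refine ⟨Real.cos_pos_of_mem_Ioo ⟨by nlinarith, by nlinarith⟩, ?_⟩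
  rw [← Real.cos_zero]
  exact Real.cos_lt_cos_of_nonneg_of_le_pi_div_two le_rfl (by nlinarith) (by positivity)

theorem logCos_pos {θ : ℝ} (hθ : θ ∈ halfIoo) : 0 < logCos θ := by
  obtain ⟨h0, h1⟩ := cos_mem_of_mem_halfIoo hθ
  have := Real.log_neg h0 h1
  rw [logCos]; linarith

theorem exp_neg_logCos {θ : ℝ} (hθ : θ ∈ halfIoo) :
    Real.exp (-logCos θ) = Real.cos (Real.pi * θ) ^ 2 := by
  obtain ⟨h0, h1⟩ := cos_mem_of_mem_halfIoo hθ
  rw [logCos, show -(-2 * Real.log (Real.cos (Real.pi * θ))) =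
    (2 : ℕ) * Real.log (Real.cos (Real.pi * θ)) by push_cast; ring, Real.exp_nat_mul,
    Real.exp_log h0]

theorem contDiffOn_logCos : ContDiffOn ℝ ∞ logCos halfIoo := by
  refine contDiffOn_const.mul (ContDiffOn.log ?_ fun θ hθ => (cos_mem_of_mem_halfIoo hθ).1.ne')
  exact (Real.contDiff_cos.comp (contDiff_const.mul contDiff_id)).contDiffOn

theorem hasDerivAt_logCos {θ : ℝ} (hθ : θ ∈ halfIoo) : HasDerivAt logCos (deriv logCos θ) θ :=
  ((contDiffOn_logCos.contDiffAt (isOpen_halfIoo.mem_nhds hθ)).differentiableAt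
    (by simp)).hasDerivAt

/-- The inverse of `logCos`. -/
def invLogCos (s : ℝ) : ℝ := Real.arccos (Real.exp (-s / 2)) / Real.pi

theorem continuous_invLogCos : Continuous invLogCos := by
  unfold invLogCos
  exact (Real.continuous_arccos.comp (by fun_prop)).div_const _

theorem invLogCos_mem {s : ℝ} (hs : 0 < s) : invLogCos s ∈ halfIoo := by
  have h1 : Real.exp (-s / 2) < 1 := Real.exp_lt_one_iff.2 (by linarith)
  have hpi := Real.pi_pos
  refine ⟨div_pos (Real.arccos_pos.2 h1) hpi, ?_⟩
  rw [invLogCos, div_lt_iff₀ hpi]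
  have := Real.arccos_lt_pi_div_two.2 (Real.exp_pos (-s / 2))
  linarith

theorem logCos_invLogCos {s : ℝ} (hs : 0 < s) : logCos (invLogCos s) = s := by
  have h1 : Real.exp (-s / 2) < 1 := Real.exp_lt_one_iff.2 (by linarith)
  rw [logCos, invLogCos, mul_div_cancel₀ _ Real.pi_pos.ne',
    Real.cos_arccos (by linarith [Real.exp_pos (-s / 2)]) h1.le, Real.log_exp]
  ring

theorem invLogCos_logCos {θ : ℝ} (hθ : θ ∈ halfIoo) : invLogCos (logCos θ) = θ := by
  obtain ⟨h0, h1⟩ := cos_mem_of_mem_halfIoo hθ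
  have hpi := Real.pi_pos
  rw [invLogCos, logCos, show -(-2 * Real.log (Real.cos (Real.pi * θ))) / 2 =
    Real.log (Real.cos (Real.pi * θ)) by ring, Real.exp_log h0,
    Real.arccos_cos (by nlinarith [hθ.1]) (by nlinarith [hθ.2]), mul_div_cancel_left₀ _ hpi.ne']

theorem contDiff_of_forall_tsupport {ξ : ℝ → ℂ} (h : ∀ θ ∈ tsupport ξ, ContDiffAt ℝ ∞ ξ θ) :
    ContDiff ℝ ∞ ξ := by
  refine contDiff_iff_contDiffAt.2 fun θ => ?_
  by_cases hθ : θ ∈ tsupport ξ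
  · exact h θ hθ
  · exact contDiffAt_const.congr_of_eventuallyEq (notMem_tsupport_iff_eventuallyEq.1 hθ)

/-- Smooth functions with compact support in `(0,1/2)`. -/
def IsBump (ξ : ℝ → ℂ) : Prop := ContDiff ℝ ∞ ξ ∧ tsupport ξ ⊆ halfIoo

namespace IsBump

variable {ξ : ℝ → ℂ}

theorem hasCompactSupport (h : IsBump ξ) : HasCompactSupport ξ :=
  (isCompact_Icc (a := (0 : ℝ)) (b := 1 / 2)).of_isClosed_subset (isClosed_tsupport _)
    (h.2.trans Ioo_subset_Icc_self)

theorem eq_zero (h : IsBump ξ) {θ : ℝ} (hθ : θ ∉ halfIoo) : ξ θ = 0 :=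
  image_eq_zero_of_notMem_tsupport fun h' => hθ (h.2 h')

theorem eventually_eq_zero (h : IsBump ξ) {θ : ℝ} (hθ : θ ∉ halfIoo) : ∀ᶠ t in 𝓝 θ, ξ t = 0 :=
  notMem_tsupport_iff_eventuallyEq.1 fun h' => hθ (h.2 h')

theorem deriv (h : IsBump ξ) : IsBump (deriv ξ) :=
  ⟨h.1.deriv' , tsupport_deriv_subset.trans h.2⟩

theorem mul_contDiffOn (h : IsBump ξ) {r : ℝ → ℂ} (hr : ContDiffOn ℝ ∞ r halfIoo) :
    IsBump fun θ => r θ * ξ θ := by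
  have hs : tsupport (fun θ => r θ * ξ θ) ⊆ tsupport ξ := tsupport_mul_subset_right
  refine ⟨contDiff_of_forall_tsupport fun θ hθ => ?_, hs.trans h.2⟩
  exact (hr.contDiffAt (isOpen_halfIoo.mem_nhds (h.2 (hs hθ)))).mul h.1.contDiffAt

theorem integrable (h : IsBump ξ) : Integrable ξ :=
  h.1.continuous.integrable_of_hasCompactSupport h.hasCompactSupport

end IsBump

/-- The smooth cutoff `η` equal to `1` on `(-∞,1]` and to `0` on `[2,∞)`. -/
def lowCut (s : ℝ) : ℝ := Real.smoothTransition (2 - s)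

/-- The dyadic cutoff `η(s) - η(2s)`, supported in `[1/2,2]`. -/
def dyadicCut (s : ℝ) : ℝ := lowCut s - lowCut (2 * s)

theorem contDiff_lowCut : ContDiff ℝ ∞ lowCut :=
  Real.smoothTransition.contDiff.comp (contDiff_const.sub contDiff_id)

theorem lowCut_one {s : ℝ} (hs : s ≤ 1) : lowCut s = 1 :=
  Real.smoothTransition.one_of_one_le (by linarith)

theorem lowCut_zero {s : ℝ} (hs : 2 ≤ s) : lowCut s = 0 :=
  Real.smoothTransition.zero_of_nonpos (by linarith)

theorem contDiff_dyadicCut : ContDiff ℝ ∞ dyadicCut :=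
  contDiff_lowCut.sub (contDiff_lowCut.comp (contDiff_const.mul contDiff_id))

theorem dyadicCut_eq_zero {s : ℝ} (hs : s ≤ 1 / 2 ∨ 2 ≤ s) : dyadicCut s = 0 := by
  rcases hs with hs | hs
  · rw [dyadicCut, lowCut_one (by linarith), lowCut_one (by linarith), sub_self]
  · rw [dyadicCut, lowCut_zero hs, lowCut_zero (by linarith), sub_self]

/-- Telescoping. If 2^J ≤ l < 2^{J+1}, only j = J and j = J + 1 contribute, and with s = 2^{-J}l in
[1,2) the sum is η(s/2) - η(2s) = 1. -/
theorem exists_finset_dyadicCut {l : ℝ} (hl : 0 < l) : ∃ S : Finset ℤ,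
    (∀ j ∉ S, dyadicCut (2 ^ (-j) * l) = 0) ∧ ∑ j ∈ S, dyadicCut (2 ^ (-j) * l) = 1 := by
  obtain ⟨J, h1, h2⟩ := exists_mem_Ico_zpow hl (one_lt_two : (1 : ℝ) < 2)
  have hz : ∀ j : ℤ, (2 : ℝ) ^ (-j) * 2 ^ j = 1 := fun j => by
    rw [← zpow_add₀ two_ne_zero]; simp
  have hp : ∀ j : ℤ, (0 : ℝ) < 2 ^ j := fun j => by positivity
  refine ⟨{J, J + 1}, fun j hj => dyadicCut_eq_zero ?_, ?_⟩
  · simp only [Finset.mem_insert, Finset.mem_singleton, not_or] at hj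
    rcases lt_or_ge j J with h | h
    · right
      have h3 : (2 : ℝ) ^ (-j) * 2 ^ (j + 1) = 2 := by rw [← zpow_add₀ two_ne_zero]; simp
      have h4 : (2 : ℝ) ^ (j + 1) ≤ 2 ^ J := zpow_le_zpow_right₀ one_le_two (by omega)
      nlinarith [hp (-j)]
    · left
      have h3 : (2 : ℝ) ^ (-j) * 2 ^ (j - 1) = 1 / 2 := by
        rw [← zpow_add₀ two_ne_zero, show -j + (j - 1) = -1 by ring]; norm_num
      have h4 : (2 : ℝ) ^ (J + 1) ≤ 2 ^ (j - 1) := zpow_le_zpow_right₀ one_le_two (by omega)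
      nlinarith [hp (-j)]
  · rw [Finset.sum_pair (by omega), dyadicCut, dyadicCut]
    set s := (2 : ℝ) ^ (-J) * l with hs
    have h3 : (2 : ℝ) ^ (-(J + 1)) * l = s / 2 := by
      rw [neg_add, zpow_add₀ two_ne_zero, hs]; norm_num; ring
    have h4 : 1 ≤ s := by nlinarith [hp (-J), hz J]
    have h5 : s < 2 := by
      have h6 : (2 : ℝ) ^ (-J) * 2 ^ (J + 1) = 2 := by rw [← zpow_add₀ two_ne_zero]; simp
      nlinarith [hp (-J)]
    rw [h3, lowCut_zero (s := 2 * s) (by linarith), lowCut_one (s := s / 2) (by linarith),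
      show 2 * (s / 2) = s by ring]
    ring

/-- The function `φ(s) s^a / (e^{-2s} (1 - e^{-s}))` in the variable `θ`. -/
def cutBump (a : ℕ) : ℝ → ℂ := halfIoo.indicator fun θ =>
  ((dyadicCut (logCos θ) * logCos θ ^ a /
    (Real.exp (-logCos θ) ^ 2 * (1 - Real.exp (-logCos θ))) : ℝ) : ℂ)

theorem cutBump_of_mem (a : ℕ) {θ : ℝ} (hθ : θ ∈ halfIoo) :
    cutBump a θ = ((dyadicCut (logCos θ) * logCos θ ^ a /
      (Real.exp (-logCos θ) ^ 2 * (1 - Real.exp (-logCos θ))) : ℝ) : ℂ) := indicator_of_mem hθ _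

/-- The dyadic cutoff confines s to [1/2, 2], hence θ to a compact subset of (0,1/2), away from θ =
0, where 1 - e^{-s} vanishes, and from θ = 1/2, where s blows up. -/
theorem isBump_cutBump (a : ℕ) : IsBump (cutBump a) := by
  have hK : IsCompact (invLogCos '' Icc (1 / 2) 2) := isCompact_Icc.image continuous_invLogCos
  have hKs : invLogCos '' Icc (1 / 2) 2 ⊆ halfIoo := by
    rintro _ ⟨s, hs, rfl⟩
    exact invLogCos_mem (by linarith [hs.1])
  have hsupp : tsupport (cutBump a) ⊆ invLogCos '' Icc (1 / 2) 2 := by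
    refine closure_minimal (fun θ hθ => ?_) hK.isClosed
    by_cases hm : θ ∈ halfIoo
    · refine ⟨logCos θ, ?_, invLogCos_logCos hm⟩
      by_contra hc
      refine hθ ?_
      rw [cutBump_of_mem a hm, dyadicCut_eq_zero]
      · simp
      · by_contra! h
        exact hc ⟨h.1.le, h.2.le⟩
    · exact absurd (indicator_of_notMem hm _) hθ
  refine ⟨contDiff_of_forall_tsupport fun θ hθ => ?_, hsupp.trans hKs⟩
  have hm := hKs (hsupp hθ)
  have h1 : ContDiffAt ℝ ∞ logCos θ := contDiffOn_logCos.contDiffAt (isOpen_halfIoo.mem_nhds hm)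
  have h2 : ContDiffAt ℝ ∞ (fun θ => Real.exp (-logCos θ)) θ := h1.neg.exp
  have h3 : ContDiffAt ℝ ∞ (fun θ => dyadicCut (logCos θ) * logCos θ ^ a /
      (Real.exp (-logCos θ) ^ 2 * (1 - Real.exp (-logCos θ)))) θ := by
    refine ((contDiff_dyadicCut.contDiffAt.comp θ h1).mul (h1.pow a)).div
      ((h2.pow 2).mul (contDiffAt_const.sub h2)) ?_
    have : Real.exp (-logCos θ) < 1 := Real.exp_lt_one_iff.2 (by linarith [logCos_pos hm])
    have h0 := Real.exp_pos (-logCos θ)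
    exact (mul_pos (by positivity) (by linarith)).ne'
  have h4 : ContDiffAt ℝ ∞ (fun θ => ((dyadicCut (logCos θ) * logCos θ ^ a /
      (Real.exp (-logCos θ) ^ 2 * (1 - Real.exp (-logCos θ))) : ℝ) : ℂ)) θ :=
    Complex.ofRealCLM.contDiff.contDiffAt.comp θ h3
  refine h4.congr_of_eventuallyEq ?_
  filter_upwards [isOpen_halfIoo.mem_nhds hm] with t ht using cutBump_of_mem a ht

end Bump

/-! ### One-dimensional Fourier series -/

section Fourier

/-- The character `e^{-2πint}`. -/
def negChar (n : ℤ) (t : ℝ) : ℂ := Complex.exp (-(2 * Real.pi * Complex.I * n * t))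

theorem contDiff_negChar (n : ℤ) : ContDiff ℝ ∞ (negChar n) := by
  unfold negChar
  exact (contDiff_const.mul Complex.ofRealCLM.contDiff).neg.cexp

@[simp] theorem norm_negChar (n : ℤ) (t : ℝ) : ‖negChar n t‖ = 1 := by
  rw [negChar, show -(2 * Real.pi * Complex.I * n * t) =
    ((-(2 * Real.pi * n * t) : ℝ) : ℂ) * Complex.I by push_cast; ring]
  exact Complex.norm_exp_ofReal_mul_I _

theorem hasDerivAt_negChar (n : ℤ) (t : ℝ) :
    HasDerivAt (negChar n) (-(2 * Real.pi * Complex.I * n) * negChar n t) t := by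
  have h1 : HasDerivAt (fun t : ℝ => -(2 * Real.pi * Complex.I * n * (t : ℂ)))
      (-(2 * Real.pi * Complex.I * n * 1)) t :=
    ((Complex.ofRealCLM.hasDerivAt (x := t)).const_mul _).neg
  exact h1.cexp.congr_deriv (by rw [negChar]; ring)

/-- Since g lives on half a period, its Fourier series at 1 - t sums to zero. Adding that to the
series at t turns the exponentials into cosines without changing the value. -/
theorem hasSum_cos_of_summable {g : ℝ → ℂ} (hg : Continuous g) (h0 : ∀ t ∉ halfIoo, g t = 0)
    (hs : Summable fun m : ℤ => ∫ t, g t * negChar m t) {t : ℝ} (ht : t ∈ halfIoo) :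
    HasSum (fun m : ℤ => 2 * (∫ t, g t * negChar m t) * Real.cos (2 * Real.pi * (m * t))) (g t) := by
  have : Fact ((0 : ℝ) < 1) := ⟨one_pos⟩
  have hn0 : (0 : ℝ) ∉ halfIoo := by simp [halfIoo]
  have hn1 : (1 : ℝ) ∉ halfIoo := by rintro ⟨_, h⟩; norm_num at h
  let f : C(AddCircle (1 : ℝ), ℂ) := ⟨AddCircle.liftIco 1 0 g,
    AddCircle.liftIco_zero_continuous (by rw [h0 _ hn0, h0 _ hn1]) hg.continuousOn⟩
  have hco : ∀ m : ℤ, fourierCoeff f m = ∫ t, g t * negChar m t := by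
    intro m
    have h1 : fourierCoeff f m = _ := fourierCoeff_liftIco_eq (a := 0) g m
    rw [h1, fourierCoeffOn_eq_integral, intervalIntegral.integral_of_le (by norm_num),
      ← integral_indicator measurableSet_Ioc]
    simp only [zero_add, sub_zero, div_one, one_smul]
    congr 1
    ext t
    by_cases h : t ∈ Ioc (0 : ℝ) 1
    · rw [indicator_of_mem h, fourier_coe_apply, smul_eq_mul, mul_comm, negChar]
      congr 2
      push_cast
      ring
    · rw [indicator_of_notMem h, h0 t, zero_mul]
      exact fun h' => h ⟨h'.1, by linarith [h'.2]⟩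
  have hs' : Summable (fourierCoeff f) := by
    have : fourierCoeff f = fun m : ℤ => ∫ t, g t * negChar m t := funext hco
    rw [this]; exact hs
  have e1 := has_pointwise_sum_fourier_series_of_summable hs' (t : AddCircle (1 : ℝ))
  have e2 := has_pointwise_sum_fourier_series_of_summable hs' ((1 - t : ℝ) : AddCircle (1 : ℝ))
  have f1 : f (t : AddCircle (1 : ℝ)) = g t :=
    AddCircle.liftIco_zero_coe_apply ⟨ht.1.le, by linarith [ht.2]⟩
  have f2 : f ((1 - t : ℝ) : AddCircle (1 : ℝ)) = 0 := by
    have h1 : f ((1 - t : ℝ) : AddCircle (1 : ℝ)) = g (1 - t) :=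
      AddCircle.liftIco_zero_coe_apply ⟨by linarith [ht.2], by linarith [ht.1]⟩
    rw [h1, h0]
    rintro ⟨_, h⟩
    linarith [ht.2]
  rw [f1] at e1
  rw [f2] at e2
  have e3 := e1.add e2
  rw [add_zero] at e3
  refine e3.congr_fun fun m => ?_
  simp only [fourier_coe_apply, hco, smul_eq_mul]
  have h1 : Complex.exp (2 * Real.pi * Complex.I * m * ((1 - t : ℝ) : ℂ) / (1 : ℝ)) =
      Complex.exp (-(2 * Real.pi * (m * t) : ℝ) * Complex.I) := by
    rw [Complex.exp_eq_exp_iff_exists_int]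
    exact ⟨m, by push_cast; ring⟩
  have h2 : Complex.exp (2 * Real.pi * Complex.I * m * (t : ℂ) / (1 : ℝ)) =
      Complex.exp ((2 * Real.pi * (m * t) : ℝ) * Complex.I) := by
    congr 1; push_cast; ring
  rw [h1, h2, Complex.ofReal_cos, Complex.cos]
  push_cast
  ring

end Fourier

/-! ### Oscillatory integrals over the cube -/

section Cube

variable {N : ℕ}

/-- The point of the orthant with coordinates `2^{j_k} s(θ_k)`. -/
def dilVec (j : Fin N → ℤ) (θ : Fin N → ℝ) : Fin N → ℝ := fun k => 2 ^ j k * logCos (θ k)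

theorem dilVec_mem {j : Fin N → ℤ} {θ : Fin N → ℝ} (h : ∀ k, θ k ∈ halfIoo) :
    dilVec j θ ∈ posOrthant N := fun k => mul_pos (by positivity) (logCos_pos (h k))

/-- The function `q(2^j s(θ)) ∏ ξ_k(θ_k)`. -/
def cubeFn (q : (Fin N → ℝ) → ℂ) (j : Fin N → ℤ) (ξ : Fin N → ℝ → ℂ) (θ : Fin N → ℝ) : ℂ :=
  q (dilVec j θ) * ∏ k, ξ k (θ k)

variable {q : (Fin N → ℝ) → ℂ} {ξ : Fin N → ℝ → ℂ}

theorem cubeFn_eq_zero (hξ : ∀ k, IsBump (ξ k)) (j : Fin N → ℤ) {θ : Fin N → ℝ} {k : Fin N}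
    (h : θ k ∉ halfIoo) : cubeFn q j ξ θ = 0 := by
  rw [cubeFn, Finset.prod_eq_zero (Finset.mem_univ k) ((hξ k).eq_zero h), mul_zero]

theorem continuousAt_dilVec (j : Fin N → ℤ) {θ : Fin N → ℝ} (h : ∀ k, θ k ∈ halfIoo) :
    ContinuousAt (dilVec j) θ := by
  refine continuousAt_pi.2 fun k => continuousAt_const.mul ?_
  exact ContinuousAt.comp' (g := logCos) (f := fun θ : Fin N → ℝ => θ k)
    (hasDerivAt_logCos (h k)).continuousAt (continuous_apply k).continuousAt

theorem continuous_cubeFn (hq : ContinuousOn q (posOrthant N)) (hξ : ∀ k, IsBump (ξ k))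
    (j : Fin N → ℤ) : Continuous (cubeFn q j ξ) := by
  refine continuous_iff_continuousAt.2 fun θ => ?_
  by_cases h : ∀ k, θ k ∈ halfIoo
  · refine ContinuousAt.mul ?_ ?_
    · exact (hq.continuousAt (isOpen_posOrthant.mem_nhds (dilVec_mem h))).comp'
        (continuousAt_dilVec j h)
    · exact (continuous_finsetProd _ fun k _ =>
        (hξ k).1.continuous.comp (continuous_apply k)).continuousAt
  · push Not at h
    obtain ⟨k, hk⟩ := h
    refine (continuousAt_const (y := (0 : ℂ))).congr ?_
    have := (continuous_apply k).continuousAt.eventually ((hξ k).eventually_eq_zero hk)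
    filter_upwards [this] with x hx
    rw [cubeFn, Finset.prod_eq_zero (Finset.mem_univ k) hx, mul_zero]

theorem hasCompactSupport_of_cube {G : (Fin N → ℝ) → ℂ}
    (h0 : ∀ θ k, θ k ∉ halfIoo → G θ = 0) : HasCompactSupport G := by
  refine HasCompactSupport.intro (K := Icc 0 fun _ => 1 / 2) isCompact_Icc fun θ hθ => ?_
  by_contra hc
  refine hθ ⟨fun k => ?_, fun k => ?_⟩
  · by_contra h
    exact hc (h0 θ k fun h' => h h'.1.le)
  · by_contra h
    exact hc (h0 θ k fun h' => h h'.2.le)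

theorem integrable_cubeFn (hq : ContinuousOn q (posOrthant N)) (hξ : ∀ k, IsBump (ξ k))
    (j : Fin N → ℤ) : Integrable (cubeFn q j ξ) :=
  (continuous_cubeFn hq hξ j).integrable_of_hasCompactSupport
    (hasCompactSupport_of_cube fun _ _ h => cubeFn_eq_zero hξ j h)

theorem norm_integral_cubeFn_le (hξ : ∀ k, IsBump (ξ k)) {C : ℝ}
    (hC : ∀ l ∈ posOrthant N, ‖q l‖ ≤ C) (j : Fin N → ℤ) :
    ‖∫ θ, cubeFn q j ξ θ‖ ≤ C * ∫ θ : Fin N → ℝ, ∏ k, ‖ξ k (θ k)‖ := by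
  rw [← integral_const_mul]
  refine norm_integral_le_of_norm_le
    ((Integrable.fintype_prod fun k => (hξ k).integrable.norm).const_mul C)
    (Eventually.of_forall fun θ => ?_)
  rw [cubeFn, norm_mul, norm_prod]
  by_cases h : ∀ k, θ k ∈ halfIoo
  · exact mul_le_mul_of_nonneg_right (hC _ (dilVec_mem h)) (by positivity)
  · push Not at h
    obtain ⟨k, hk⟩ := h
    rw [Finset.prod_eq_zero (Finset.mem_univ k) (by rw [(hξ k).eq_zero hk, norm_zero])]
    simp

theorem prod_update_fun (ξ : Fin N → ℝ → ℂ) (k : Fin N) (ζ : ℝ → ℂ) (θ : Fin N → ℝ) :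
    ∏ m, Function.update ξ k ζ m (θ m) = ζ (θ k) * ∏ m ∈ Finset.univ.erase k, ξ m (θ m) := by
  rw [← Finset.mul_prod_erase _ _ (Finset.mem_univ k), Function.update_self]
  congr 1
  refine Finset.prod_congr rfl fun m hm => ?_
  rw [Function.update_of_ne (Finset.ne_of_mem_erase hm)]

theorem prod_update_point (ξ : Fin N → ℝ → ℂ) (k : Fin N) (t : ℝ) (θ : Fin N → ℝ) :
    ∏ m, ξ m (Function.update θ k t m) = ξ k t * ∏ m ∈ Finset.univ.erase k, ξ m (θ m) := by
  rw [← Finset.mul_prod_erase _ _ (Finset.mem_univ k), Function.update_self]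
  congr 1
  refine Finset.prod_congr rfl fun m hm => ?_
  rw [Function.update_of_ne (Finset.ne_of_mem_erase hm)]

theorem dilVec_update (j : Fin N → ℤ) (θ : Fin N → ℝ) (k : Fin N) (t : ℝ) :
    dilVec j (Function.update θ k t) = Function.update (dilVec j θ) k (2 ^ j k * logCos t) := by
  ext m
  by_cases h : m = k
  · subst h; simp [dilVec]
  · simp [dilVec, h]

/-- The logarithmic derivative of `logCos`. -/
def logCosRatio (θ : ℝ) : ℂ := ((deriv logCos θ / logCos θ : ℝ) : ℂ)

theorem contDiffOn_logCosRatio : ContDiffOn ℝ ∞ logCosRatio halfIoo := by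
  have h1 : ContDiffOn ℝ ∞ (fun θ => deriv logCos θ / logCos θ) halfIoo :=
    ((contDiffOn_logCos.deriv_of_isOpen isOpen_halfIoo (by simp))).div contDiffOn_logCos
      fun θ hθ => (logCos_pos hθ).ne'
  exact Complex.ofRealCLM.contDiff.comp_contDiffOn h1

theorem isBump_update (hξ : ∀ k, IsBump (ξ k)) (k : Fin N) {ζ : ℝ → ℂ} (hζ : IsBump ζ) :
    ∀ m, IsBump (Function.update ξ k ζ m) := by
  intro m
  by_cases h : m = k
  · subst h; simpa using hζ
  · simpa [h] using hξ m

/-- Chain rule with λ_k = 2^{j_k} s(θ_k). Only the logarithmic derivative s'/s appears, so 2^{j_k}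
cancels; this is the source of uniformity in j. The factor s'/s is absorbed into the bump. -/
theorem hasDerivAt_cubeFn {p : (Fin N → ℝ) → ℂ} (hp : ContDiffOn ℝ ∞ p (posOrthant N))
    (α : Fin N → ℕ) (hξ : ∀ k, IsBump (ξ k)) (j : Fin N → ℤ) (k : Fin N) (θ : Fin N → ℝ) :
    HasDerivAt (fun t => cubeFn (scaledPartial α p) j ξ (Function.update θ k t))
      (α k * cubeFn (scaledPartial α p) j
          (Function.update ξ k fun t => logCosRatio t * ξ k t) θ +
        cubeFn (scaledPartial (α + Pi.single k 1) p) j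
          (Function.update ξ k fun t => logCosRatio t * ξ k t) θ +
        cubeFn (scaledPartial α p) j (Function.update ξ k (deriv (ξ k))) θ) (θ k) := by
  by_cases h : ∀ m, θ m ∈ halfIoo
  · have hl := dilVec_mem (j := j) h
    have h1 : HasDerivAt (fun t => 2 ^ j k * logCos t) (2 ^ j k * deriv logCos (θ k)) (θ k) :=
      (hasDerivAt_logCos (h k)).const_mul _
    have h2 := HasDerivAt.scomp (θ k) (g₁ := fun t => scaledPartial α p
      (Function.update (dilVec j θ) k t)) (hasDerivAt_scaledPartial hp α k hl) h1
    have h3 : HasDerivAt (ξ k) (deriv (ξ k) (θ k)) (θ k) :=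
      ((hξ k).1.differentiable (by simp) _).hasDerivAt
    have h4 := h2.mul (h3.mul_const (∏ m ∈ Finset.univ.erase k, ξ m (θ m)))
    have h5 : (fun t => cubeFn (scaledPartial α p) j ξ (Function.update θ k t)) =
        ((fun t => scaledPartial α p (Function.update (dilVec j θ) k t)) ∘
          fun t => 2 ^ j k * logCos t) *
          fun t => ξ k t * ∏ m ∈ Finset.univ.erase k, ξ m (θ m) := by
      ext t
      rw [cubeFn, prod_update_point, dilVec_update]
      rfl
    rw [h5]
    refine h4.congr_deriv ?_
    simp only [cubeFn, prod_update_fun, Function.comp_apply]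
    have h6 : Function.update (dilVec j θ) k (2 ^ j k * logCos (θ k)) = dilVec j θ :=
      Function.update_eq_self _ _
    have h7 : (logCos (θ k) : ℂ) ≠ 0 := by exact_mod_cast (logCos_pos (h k)).ne'
    rw [h6, logCosRatio]
    simp only [dilVec, Complex.real_smul]
    push_cast
    have h8 : ((2 : ℂ) ^ j k) ≠ 0 := zpow_ne_zero _ two_ne_zero
    field_simp
  · push Not at h
    obtain ⟨m, hm⟩ := h
    have hr := (hξ k).mul_contDiffOn contDiffOn_logCosRatio
    rw [cubeFn_eq_zero (isBump_update hξ k hr) j hm, cubeFn_eq_zero (isBump_update hξ k hr) j hm,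
      cubeFn_eq_zero (isBump_update hξ k (hξ k).deriv) j hm]
    simp only [mul_zero, add_zero]
    refine (hasDerivAt_const (θ k) (0 : ℂ)).congr_of_eventuallyEq ?_
    by_cases hmk : m = k
    · subst hmk
      filter_upwards [(hξ m).eventually_eq_zero hm] with t ht
      rw [cubeFn, prod_update_point, ht, zero_mul, mul_zero]
    · refine Eventually.of_forall fun t => cubeFn_eq_zero hξ j (k := m) ?_
      rwa [Function.update_of_ne hmk]

/-- The integral of a partial derivative of a compactly supported function vanishes; it is obtained
as integration by parts against the constant 1. -/
theorem integral_cubeFn_deriv_eq_zero {p : (Fin N → ℝ) → ℂ} (hp : ContDiffOn ℝ ∞ p (posOrthant N))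
    (α : Fin N → ℕ) (hξ : ∀ k, IsBump (ξ k)) (j : Fin N → ℤ) (k : Fin N) :
    α k * (∫ θ, cubeFn (scaledPartial α p) j
          (Function.update ξ k fun t => logCosRatio t * ξ k t) θ) +
      (∫ θ, cubeFn (scaledPartial (α + Pi.single k 1) p) j
          (Function.update ξ k fun t => logCosRatio t * ξ k t) θ) +
      ∫ θ, cubeFn (scaledPartial α p) j (Function.update ξ k (deriv (ξ k))) θ = 0 := by
  have hr := isBump_update hξ k ((hξ k).mul_contDiffOn contDiffOn_logCosRatio)
  have hd := isBump_update hξ k (hξ k).deriv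
  have hc := continuousOn_scaledPartial hp
  have i1 := (integrable_cubeFn (hc α) hr j).const_mul (α k : ℂ)
  have i2 := integrable_cubeFn (hc (α + Pi.single k 1)) hr j
  have i3 := integrable_cubeFn (hc α) hd j
  have i12 : Integrable fun θ => α k * cubeFn (scaledPartial α p) j
      (Function.update ξ k fun t => logCosRatio t * ξ k t) θ +
      cubeFn (scaledPartial (α + Pi.single k 1) p) j
        (Function.update ξ k fun t => logCosRatio t * ξ k t) θ := i1.add i2
  rw [← integral_const_mul, ← integral_add i1 i2, ← integral_add i12 i3]
  have key := integral_bilinear_hasLineDerivAt_right_eq_neg_left_of_integrable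
    (μ := (volume : Measure (Fin N → ℝ))) (B := ContinuousLinearMap.mul ℝ ℂ)
    (f := cubeFn (scaledPartial α p) j ξ) (g := fun _ => (1 : ℂ)) (g' := fun _ => 0)
    (v := Pi.single k 1) (f' := fun θ => α k * cubeFn (scaledPartial α p) j
          (Function.update ξ k fun t => logCosRatio t * ξ k t) θ +
        cubeFn (scaledPartial (α + Pi.single k 1) p) j
          (Function.update ξ k fun t => logCosRatio t * ξ k t) θ +
        cubeFn (scaledPartial α p) j (Function.update ξ k (deriv (ξ k))) θ)
    (by simp only [ContinuousLinearMap.mul_apply', mul_one]; exact i12.add i3) (by simp)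
    (by simpa using integrable_cubeFn (hc α) hξ j)
    (fun θ _ => by
      have h1 := hasDerivAt_cubeFn hp α hξ j k θ
      have h2 : HasDerivAt (fun t : ℝ => θ k + t) 1 0 := by
        simpa using (hasDerivAt_id (0 : ℝ)).const_add (θ k)
      have h3 := HasDerivAt.scomp (0 : ℝ) (h := fun t : ℝ => θ k + t) (by simpa using h1) h2
      rw [one_smul] at h3
      refine h3.congr_of_eventuallyEq (Eventually.of_forall fun t => ?_)
      simp only [Function.comp_apply]
      congr 1
      ext m
      by_cases hm : m = k
      · subst hm; simp
      · simp [hm])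
    (fun θ _ => by simpa [HasLineDerivAt] using hasDerivAt_const (0 : ℝ) (1 : ℂ))
  simp only [ContinuousLinearMap.mul_apply', mul_zero, integral_zero, mul_one] at key
  exact neg_eq_zero.1 key.symm

/-- The oscillatory integral `∫ q(2^j s(θ)) ∏ ξ_k(θ_k) e^{-2πi n·θ} dθ`. -/
def oscInt (q : (Fin N → ℝ) → ℂ) (j n : Fin N → ℤ) (ξ : Fin N → ℝ → ℂ) : ℂ :=
  ∫ θ, cubeFn q j (fun k t => ξ k t * negChar (n k) t) θ

theorem IsBump.mul_negChar {ζ : ℝ → ℂ} (h : IsBump ζ) (n : ℤ) :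
    IsBump fun t => ζ t * negChar n t := by
  simpa only [mul_comm] using h.mul_contDiffOn (contDiff_negChar n).contDiffOn

theorem update_mul_negChar (n : Fin N → ℤ) (k : Fin N) (ζ : ℝ → ℂ) :
    Function.update (fun k t => ξ k t * negChar (n k) t) k (fun t => ζ t * negChar (n k) t) =
      fun m t => Function.update ξ k ζ m t * negChar (n m) t := by
  ext m t
  by_cases h : m = k
  · subst h; simp
  · simp [h]

theorem oscInt_by_parts {p : (Fin N → ℝ) → ℂ} (hp : ContDiffOn ℝ ∞ p (posOrthant N))
    (α : Fin N → ℕ) (hξ : ∀ k, IsBump (ξ k)) (j n : Fin N → ℤ) (k : Fin N) :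
    2 * Real.pi * Complex.I * n k * oscInt (scaledPartial α p) j n ξ =
      α k * oscInt (scaledPartial α p) j n
          (Function.update ξ k fun t => logCosRatio t * ξ k t) +
        oscInt (scaledPartial (α + Pi.single k 1) p) j n
          (Function.update ξ k fun t => logCosRatio t * ξ k t) +
        oscInt (scaledPartial α p) j n (Function.update ξ k (deriv (ξ k))) := by
  have hb : ∀ m, IsBump fun t => ξ m t * negChar (n m) t := fun m => (hξ m).mul_negChar (n m)
  have key := integral_cubeFn_deriv_eq_zero hp α hb j k
  have e1 : (fun t => logCosRatio t * (ξ k t * negChar (n k) t)) =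
      fun t => (logCosRatio t * ξ k t) * negChar (n k) t := by ext t; ring
  have e2 : deriv (fun t => ξ k t * negChar (n k) t) = fun t =>
      deriv (ξ k) t * negChar (n k) t +
        (-(2 * Real.pi * Complex.I * n k)) * (ξ k t * negChar (n k) t) := by
    ext t
    have h3 : HasDerivAt (ξ k) (deriv (ξ k) t) t :=
      ((hξ k).1.differentiable (by simp) _).hasDerivAt
    have h4 : deriv (fun t => ξ k t * negChar (n k) t) t = _ :=
      (h3.mul (hasDerivAt_negChar (n k) t)).deriv
    rw [h4]
    ring
  rw [e1, update_mul_negChar] at key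
  have hc := continuousOn_scaledPartial hp α
  have hd : ∀ m, IsBump fun t => Function.update ξ k (deriv (ξ k)) m t * negChar (n m) t :=
    fun m => (isBump_update hξ k (hξ k).deriv m).mul_negChar (n m)
  have e3 : ∫ θ, cubeFn (scaledPartial α p) j (Function.update
      (fun m t => ξ m t * negChar (n m) t) k (deriv fun t => ξ k t * negChar (n k) t)) θ =
      oscInt (scaledPartial α p) j n (Function.update ξ k (deriv (ξ k))) +
        (-(2 * Real.pi * Complex.I * n k)) * oscInt (scaledPartial α p) j n ξ := by
    rw [oscInt, oscInt, ← integral_const_mul, ← integral_add (integrable_cubeFn hc hd j)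
      ((integrable_cubeFn hc hb j).const_mul _), e2]
    congr 1
    ext θ
    rw [← update_mul_negChar]
    simp only [cubeFn, prod_update_fun]
    rw [← Finset.mul_prod_erase _ _ (Finset.mem_univ k)]
    ring
  rw [e3] at key
  simp only [oscInt] at key ⊢
  linear_combination -key

/-- The multiset lists the variables in which decay is gained, one integration by parts for each
entry. Every step leads to integrals of the same shape with another α and other bumps, so the
induction is over all of these; no constant depends on j. -/
theorem exists_norm_oscInt_le {p : (Fin N → ℝ) → ℂ} (hp : IsSymbolZero p) (ks : Multiset (Fin N)) :
    ∀ (α : Fin N → ℕ) (ξ : Fin N → ℝ → ℂ), (∀ k, IsBump (ξ k)) → ∃ C, 0 ≤ C ∧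
      ∀ j n : Fin N → ℤ, (ks.map fun k => 1 + |(n k : ℝ)|).prod *
        ‖oscInt (scaledPartial α p) j n ξ‖ ≤ C := by
  induction ks using Multiset.induction_on with
  | empty =>
    intro α ξ hξ
    obtain ⟨C, hC0, hC⟩ := exists_norm_scaledPartial_le hp α
    refine ⟨C * ∫ θ : Fin N → ℝ, ∏ k, ‖ξ k (θ k)‖, by positivity, fun j n => ?_⟩
    have := norm_integral_cubeFn_le (fun m => (hξ m).mul_negChar (n m)) hC j
    simpa [oscInt] using this
  | cons k ks ih =>
    intro α ξ hξ
    have hr := isBump_update hξ k ((hξ k).mul_contDiffOn contDiffOn_logCosRatio)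
    obtain ⟨C0, p0, h0⟩ := ih α ξ hξ
    obtain ⟨C1, p1, h1⟩ := ih α _ hr
    obtain ⟨C2, p2, h2⟩ := ih (α + Pi.single k 1) _ hr
    obtain ⟨C3, p3, h3⟩ := ih α _ (isBump_update hξ k (hξ k).deriv)
    refine ⟨C0 + (α k * C1 + C2 + C3), by positivity, fun j n => ?_⟩
    rw [Multiset.map_cons, Multiset.prod_cons]
    have hP : 0 ≤ (ks.map fun k => 1 + |(n k : ℝ)|).prod :=
      Multiset.prod_nonneg fun a ha => by
        obtain ⟨k, _, rfl⟩ := Multiset.mem_map.1 ha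
        positivity
    set P := (ks.map fun k => 1 + |(n k : ℝ)|).prod
    have key := congrArg norm (oscInt_by_parts hp.1 α hξ j n k)
    have hn : ‖(2 * Real.pi * Complex.I * n k : ℂ)‖ = 2 * Real.pi * |(n k : ℝ)| := by
      simp [abs_of_pos Real.pi_pos]
    rw [norm_mul, hn] at key
    have key2 := key.le.trans ((norm_add_le _ _).trans (add_le_add_left (norm_add_le _ _) _))
    rw [norm_mul, Complex.norm_natCast] at key2
    set I0 := ‖oscInt (scaledPartial α p) j n ξ‖
    have hI : 0 ≤ I0 := norm_nonneg _
    have h4 : |(n k : ℝ)| * I0 ≤ 2 * Real.pi * |(n k : ℝ)| * I0 := by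
      have : (1 : ℝ) ≤ 2 * Real.pi := by linarith [Real.pi_gt_three]
      have h5 : 0 ≤ |(n k : ℝ)| * I0 := by positivity
      nlinarith
    have h5 := mul_le_mul_of_nonneg_left (h4.trans key2) hP
    have h6 := mul_le_mul_of_nonneg_left (h1 j n) (Nat.cast_nonneg (α := ℝ) (α k))
    have := h0 j n
    have := h2 j n
    have := h3 j n
    nlinarith

end Cube

/-! ### Fourier series over the cube -/

section CubeFourier

/-- Continuous functions vanishing outside the cube `(0,1/2)^N`. -/
def IsCubeFn {N : ℕ} (G : (Fin N → ℝ) → ℂ) : Prop :=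
  Continuous G ∧ ∀ θ k, θ k ∉ halfIoo → G θ = 0

/-- The Fourier coefficient `∫ G(θ) e^{-2πi n·θ} dθ`. -/
def cubeCoeff {N : ℕ} (G : (Fin N → ℝ) → ℂ) (n : Fin N → ℤ) : ℂ :=
  ∫ θ, G θ * ∏ k, negChar (n k) (θ k)

variable {M : ℕ}

theorem continuous_negChar (n : ℤ) : Continuous (negChar n) := (contDiff_negChar n).continuous

theorem continuous_prod_negChar {N : ℕ} (n : Fin N → ℤ) :
    Continuous fun θ : Fin N → ℝ => ∏ k, negChar (n k) (θ k) :=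
  continuous_finsetProd _ fun k _ => (continuous_negChar _).comp (continuous_apply k)

theorem IsCubeFn.integrable {N : ℕ} {G : (Fin N → ℝ) → ℂ} (hG : IsCubeFn G) (n : Fin N → ℤ) :
    Integrable fun θ => G θ * ∏ k, negChar (n k) (θ k) :=
  (hG.1.mul (continuous_prod_negChar n)).integrable_of_hasCompactSupport
    (hasCompactSupport_of_cube fun θ k h => by rw [Pi.mul_apply, hG.2 θ k h, zero_mul])

theorem IsCubeFn.insertNth {G : (Fin (M + 1) → ℝ) → ℂ} (hG : IsCubeFn G) (i : Fin (M + 1))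
    (t : ℝ) : IsCubeFn fun θ : Fin M → ℝ => G (i.insertNth t θ) := by
  refine ⟨hG.1.comp (continuous_const.finInsertNth i continuous_id), fun θ k h => ?_⟩
  exact hG.2 _ (i.succAbove k) (by simpa using h)

/-- The Fourier coefficient with respect to all variables but the `i`-th one. -/
def sliceCoeff (G : (Fin (M + 1) → ℝ) → ℂ) (i : Fin (M + 1)) (n : Fin M → ℤ) (t : ℝ) : ℂ :=
  cubeCoeff (fun θ => G (i.insertNth t θ)) n

variable {G : (Fin (M + 1) → ℝ) → ℂ}

theorem IsCubeFn.continuous_sliceCoeff (hG : IsCubeFn G) (i : Fin (M + 1)) (n : Fin M → ℤ) :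
    Continuous (sliceCoeff G i n) := by
  have h1 : sliceCoeff G i n = fun t => ∫ θ in Icc (0 : Fin M → ℝ) fun _ => 1 / 2,
      G (i.insertNth t θ) * ∏ k, negChar (n k) (θ k) := by
    ext t
    rw [sliceCoeff, cubeCoeff, setIntegral_eq_integral_of_forall_compl_eq_zero]
    intro θ hθ
    have hc : ∀ k, θ k ∉ halfIoo → G (i.insertNth t θ) = 0 := (hG.insertNth i t).2 θ
    by_contra hne
    refine hθ ⟨fun k => ?_, fun k => ?_⟩
    · by_contra h
      exact hne (by rw [hc k fun h' => h h'.1.le, zero_mul])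
    · by_contra h
      exact hne (by rw [hc k fun h' => h h'.2.le, zero_mul])
  rw [h1]
  refine continuous_parametric_integral_of_continuous ?_ isCompact_Icc
  refine Continuous.mul (hG.1.comp (Continuous.finInsertNth (A := fun _ => ℝ) i
    continuous_fst continuous_snd)) ?_
  exact (continuous_prod_negChar n).comp continuous_snd

theorem IsCubeFn.sliceCoeff_eq_zero (hG : IsCubeFn G) (i : Fin (M + 1)) (n : Fin M → ℤ) {t : ℝ}
    (ht : t ∉ halfIoo) : sliceCoeff G i n t = 0 := by
  rw [sliceCoeff, cubeCoeff]
  refine integral_eq_zero_of_ae (Eventually.of_forall fun θ => ?_)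
  simp only [Pi.zero_apply]
  rw [hG.2 (i.insertNth t θ) i (by simpa using ht), zero_mul]

/-- Fubini: the one-dimensional coefficients of a slice coefficient are the full coefficients, so
absolute summability is inherited by each line. -/
theorem IsCubeFn.integral_sliceCoeff (hG : IsCubeFn G) (i : Fin (M + 1)) (n : Fin M → ℤ) (m : ℤ) :
    ∫ t, sliceCoeff G i n t * negChar m t = cubeCoeff G (i.insertNth m n) := by
  have hmp := (volume_preserving_piFinSuccAbove (fun _ : Fin (M + 1) => ℝ) i).symm
  have hI := hG.integrable (i.insertNth m n)
  have hI2 := (hmp.integrable_comp_emb (MeasurableEquiv.measurableEmbedding _)).2 hI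
  rw [cubeCoeff, ← hmp.integral_comp (MeasurableEquiv.measurableEmbedding _)]
  rw [Measure.volume_eq_prod] at hI2 ⊢
  refine Eq.trans ?_ (integral_prod _ hI2).symm
  congr 1
  ext t
  rw [sliceCoeff, cubeCoeff, ← integral_mul_const]
  congr 1
  ext θ
  simp only [Function.comp_apply]
  rw [i.prod_univ_succAbove]
  simp [MeasurableEquiv.piFinSuccAbove, Fin.insertNthEquiv]
  ring

theorem IsCubeFn.hasSum_slice (hG : IsCubeFn G) (hs : Summable (cubeCoeff G)) (i : Fin (M + 1))
    (n : Fin M → ℤ) {t : ℝ} (ht : t ∈ halfIoo) :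
    HasSum (fun m : ℤ => 2 * cubeCoeff G (i.insertNth m n) *
      Real.cos (2 * Real.pi * (m * t))) (sliceCoeff G i n t) := by
  have h1 : Summable fun m : ℤ => ∫ t, sliceCoeff G i n t * negChar m t := by
    simp only [hG.integral_sliceCoeff]
    refine hs.comp_injective fun a b hab => ?_
    simpa using congrFun hab i
  have h2 := hasSum_cos_of_summable (hG.continuous_sliceCoeff i n)
    (fun t ht => hG.sliceCoeff_eq_zero i n ht) h1 ht
  simpa only [hG.integral_sliceCoeff] using h2

/-- Induction on the dimension: the one-dimensional series in the first variable gives the slice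
coefficients, and the induction hypothesis sums those. Absolute summability permits the iterated
summation. -/
theorem IsCubeFn.hasSum {N : ℕ} {G : (Fin N → ℝ) → ℂ} (hG : IsCubeFn G)
    (hs : Summable (cubeCoeff G)) {θ : Fin N → ℝ} (hθ : ∀ k, θ k ∈ halfIoo) :
    HasSum (fun n : Fin N → ℤ => 2 ^ N * cubeCoeff G n *
      ∏ k, (Real.cos (2 * Real.pi * (n k * θ k)) : ℂ)) (G θ) := by
  induction N with
  | zero =>
    have h1 : ∀ n : Fin 0 → ℤ, cubeCoeff G n = G θ := by
      intro n
      rw [cubeCoeff, integral_unique]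
      simp [Measure.real, volume_pi]
      congr 1
      exact Subsingleton.elim _ _
    simp only [h1, pow_zero, one_mul, Finset.univ_eq_empty, Finset.prod_empty, mul_one]
    exact hasSum_unique (fun _ : Fin 0 → ℤ => G θ)
  | succ M ih =>
    obtain ⟨t, θ', rfl⟩ : ∃ (t : ℝ) (θ' : Fin M → ℝ), θ = (0 : Fin (M + 1)).insertNth t θ' :=
      ⟨θ 0, (0 : Fin (M + 1)).removeNth θ, (Fin.insertNth_self_removeNth _ _).symm⟩
    have ht : t ∈ halfIoo := by simpa using hθ 0
    have hθ' : ∀ k, θ' k ∈ halfIoo := fun k => by simpa using hθ k.succ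
    have hcos : ∀ {L : ℕ} (n : Fin L → ℤ) (θ : Fin L → ℝ),
        ‖∏ k, (Real.cos (2 * Real.pi * (n k * θ k)) : ℂ)‖ ≤ 1 := by
      intro L n θ
      rw [norm_prod]
      refine Finset.prod_le_one (fun _ _ => norm_nonneg _) fun k _ => ?_
      rw [Complex.norm_real]
      exact Real.abs_cos_le_one _
    let e : (Fin M → ℤ) × ℤ ≃ (Fin (M + 1) → ℤ) :=
      (Equiv.prodComm _ _).trans (Fin.insertNthEquiv (fun _ => ℤ) 0)
    have he : ∀ a, e a = (0 : Fin (M + 1)).insertNth a.2 a.1 := fun _ => rfl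
    have hs' : Summable fun a => ‖cubeCoeff G (e a)‖ := (e.summable_iff.2 hs).norm
    have hsl := hG.hasSum_slice hs 0 (ht := ht)
    have hsum : Summable (sliceCoeff G 0 · t) := by
      have h1 := hs'.mul_left 2
      refine Summable.of_norm_bounded h1.prod fun n' => ?_
      rw [← (hsl n').tsum_eq]
      have h2 : ∀ m : ℤ, ‖2 * cubeCoeff G ((0 : Fin (M + 1)).insertNth m n') *
          Real.cos (2 * Real.pi * (m * t))‖ ≤ 2 * ‖cubeCoeff G (e (n', m))‖ := by
        intro m
        rw [norm_mul, norm_mul, Complex.norm_real, he]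
        have := Real.abs_cos_le_one (2 * Real.pi * (m * t))
        rw [← Real.norm_eq_abs] at this
        simpa using mul_le_of_le_one_right (by positivity) this
      exact tsum_of_norm_bounded (h1.prod_factor n').hasSum h2
    have ih' := ih (hG.insertNth 0 t) hsum hθ'
    have hall : Summable fun a => 2 ^ (M + 1) * cubeCoeff G (e a) *
        ∏ k, (Real.cos (2 * Real.pi * (e a k *
          (0 : Fin (M + 1)).insertNth (α := fun _ => ℝ) t θ' k)) : ℂ) := by
      refine Summable.of_norm_bounded (hs'.mul_left (2 ^ (M + 1))) fun a => ?_
      rw [norm_mul, norm_mul, norm_pow, Complex.norm_ofNat]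
      exact mul_le_of_le_one_right (by positivity) (hcos _ _)
    rw [← e.hasSum_iff]
    have h3 := hall.hasSum.prod_fiberwise (g := fun n' => 2 ^ M * sliceCoeff G 0 n' t *
        ∏ k, (Real.cos (2 * Real.pi * (n' k * θ' k)) : ℂ)) fun n' => by
      have h4 := (hsl n').mul_left (2 ^ M * ∏ k, (Real.cos (2 * Real.pi * (n' k * θ' k)) : ℂ))
      have h6 : (fun m => 2 ^ (M + 1) * cubeCoeff G (e (n', m)) *
          ∏ k, (Real.cos (2 * Real.pi * (e (n', m) k *
            (0 : Fin (M + 1)).insertNth (α := fun _ => ℝ) t θ' k)) : ℂ)) = fun m : ℤ =>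
          (2 ^ M * ∏ k, (Real.cos (2 * Real.pi * (n' k * θ' k)) : ℂ)) *
            (2 * cubeCoeff G ((0 : Fin (M + 1)).insertNth m n') *
              Real.cos (2 * Real.pi * (m * t))) := by
        funext m
        rw [he, Fin.prod_univ_succ]
        simp only [Fin.insertNth_zero', Fin.cons_zero, Fin.cons_succ]
        ring
      rw [h6, mul_right_comm]
      exact h4
    have h5 := h3.unique ih'
    rw [← h5]
    exact hall.hasSum

end CubeFourier

/-! ### Bounded sums of non-negative families -/

section Sums

variable {ι κ : Type*}

/-- The family `f` is non-negative and its finite sums are bounded by `B`. -/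
def SumBdd (f : ι → ℝ) (B : ℝ) : Prop := (∀ i, 0 ≤ f i) ∧ ∀ s : Finset ι, ∑ i ∈ s, f i ≤ B

namespace SumBdd

variable {f g : ι → ℝ} {A B : ℝ}

theorem nonneg (h : SumBdd f B) : 0 ≤ B := by simpa using h.2 ∅

theorem summable (h : SumBdd f B) : Summable f := summable_of_sum_le h.1 h.2

theorem tsum_le (h : SumBdd f B) : ∑' i, f i ≤ B := h.summable.tsum_le_of_sum_le h.2

theorem of_summable (h0 : ∀ i, 0 ≤ f i) (h : Summable f) : SumBdd f (∑' i, f i) :=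
  ⟨h0, fun s => h.sum_le_tsum s fun i _ => h0 i⟩

theorem mono (h : SumBdd f B) (h0 : ∀ i, 0 ≤ g i) (hgf : ∀ i, g i ≤ f i) : SumBdd g B :=
  ⟨h0, fun s => (Finset.sum_le_sum fun i _ => hgf i).trans (h.2 s)⟩

theorem const_mul (h : SumBdd f B) {c : ℝ} (hc : 0 ≤ c) : SumBdd (fun i => c * f i) (c * B) :=
  ⟨fun i => mul_nonneg hc (h.1 i), fun s => by
    rw [← Finset.mul_sum]; exact mul_le_mul_of_nonneg_left (h.2 s) hc⟩

theorem mono_right (h : SumBdd f A) (hAB : A ≤ B) : SumBdd f B :=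
  ⟨h.1, fun s => (h.2 s).trans hAB⟩

theorem comp_injective (h : SumBdd f B) {e : κ → ι} (he : Function.Injective e) :
    SumBdd (fun a => f (e a)) B :=
  ⟨fun a => h.1 _, fun s => by
    classical
    rw [← Finset.sum_image (f := f) (s := s) (g := e) fun _ _ _ _ hab => he hab]
    exact h.2 _⟩

theorem prod {v : κ → ℝ} (hf : SumBdd f A) (hv : SumBdd v B) :
    SumBdd (fun z : ι × κ => f z.1 * v z.2) (A * B) := by
  classical
  refine ⟨fun z => mul_nonneg (hf.1 _) (hv.1 _), fun s => ?_⟩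
  calc ∑ z ∈ s, f z.1 * v z.2
      ≤ ∑ z ∈ s.image Prod.fst ×ˢ s.image Prod.snd, f z.1 * v z.2 :=
        Finset.sum_le_sum_of_subset_of_nonneg
          (fun z hz => Finset.mem_product.2 ⟨Finset.mem_image_of_mem _ hz,
            Finset.mem_image_of_mem _ hz⟩) fun z _ _ => mul_nonneg (hf.1 _) (hv.1 _)
    _ = (∑ i ∈ s.image Prod.fst, f i) * ∑ k ∈ s.image Prod.snd, v k := by
        rw [Finset.sum_mul_sum, Finset.sum_product]
    _ ≤ A * B := mul_le_mul (hf.2 _) (hv.2 _) (Finset.sum_nonneg fun _ _ => hv.1 _) hf.nonneg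

/-- A finite set of tuples lies in the product of its coordinate projections, over which the sum
factors. -/
theorem pi {α : Type*} [Fintype α] {w : α → ι → ℝ} {B : α → ℝ}
    (h : ∀ k, SumBdd (w k) (B k)) : SumBdd (fun z : α → ι => ∏ k, w k (z k)) (∏ k, B k) := by
  classical
  refine ⟨fun z => Finset.prod_nonneg fun k _ => (h k).1 _, fun s => ?_⟩
  calc ∑ z ∈ s, ∏ k, w k (z k)
      ≤ ∑ z ∈ Fintype.piFinset fun k => s.image fun z => z k, ∏ k, w k (z k) :=
        Finset.sum_le_sum_of_subset_of_nonneg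
          (fun z hz => Fintype.mem_piFinset.2 fun k => Finset.mem_image_of_mem _ hz)
          fun z _ _ => Finset.prod_nonneg fun k _ => (h k).1 _
    _ = ∏ k, ∑ i ∈ s.image fun z => z k, w k i := (Finset.prod_univ_sum _ _).symm
    _ ≤ ∏ k, B k := Finset.prod_le_prod (fun k _ => Finset.sum_nonneg fun _ _ => (h k).1 _)
        fun k _ => (h k).2 _

end SumBdd

theorem summable_int_of_nat {f : ℤ → ℝ} (h1 : Summable fun n : ℕ => f n)
    (h2 : Summable fun n : ℕ => f (-(n + 1))) : Summable f :=
  Summable.of_nat_of_neg_add_one h1 (by simpa using h2)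

theorem exists_sumBdd_inv_sq : ∃ B, SumBdd (fun n : ℤ => ((1 + |(n : ℝ)|) ^ 2)⁻¹) B := by
  refine ⟨_, SumBdd.of_summable (fun n => by positivity) (summable_int_of_nat ?_ ?_)⟩
  · have h := (summable_nat_add_iff (f := fun n : ℕ => ((n : ℝ) ^ 2)⁻¹) 1).2
      (Real.summable_nat_pow_inv.2 (by norm_num))
    refine h.congr fun n => ?_
    push_cast
    rw [abs_of_nonneg (Nat.cast_nonneg n), add_comm]
  · have h := (summable_nat_add_iff (f := fun n : ℕ => ((n : ℝ) ^ 2)⁻¹) 2).2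
      (Real.summable_nat_pow_inv.2 (by norm_num))
    refine h.congr fun n => ?_
    push_cast
    rw [abs_neg, abs_of_nonneg (by positivity)]
    ring_nf

/-- Geometric at both ends, with ratio 2^{β-M} as i → ∞ and 2^{-β} as i → -∞. The division by 2
leaves room for rounding to a power of 2 afterwards. -/
theorem summable_zpow_rpow_mul_min {β : ℝ} (hβ : 0 < β) {M : ℕ} (hM : β < M) :
    Summable fun i : ℤ => ((2 : ℝ) ^ i) ^ β * min 1 (((2 : ℝ) ^ i / 2) ^ M)⁻¹ := by
  refine summable_int_of_nat ?_ ?_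
  · have hr : (2 : ℝ) ^ (β - M) < 1 := Real.rpow_lt_one_of_one_lt_of_neg one_lt_two (by linarith)
    refine Summable.of_nonneg_of_le (fun n => by positivity) (fun n => ?_)
      ((summable_geometric_of_lt_one (by positivity) hr).mul_left ((2 : ℝ) ^ M))
    refine (mul_le_mul_of_nonneg_left (min_le_right _ _) (by positivity)).trans (le_of_eq ?_)
    rw [zpow_natCast, ← Real.rpow_natCast 2 n, ← Real.rpow_mul zero_le_two, div_pow, inv_div,
      ← Real.rpow_natCast _ M, ← Real.rpow_natCast _ M, ← Real.rpow_mul zero_le_two,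
      ← Real.rpow_natCast _ n, ← Real.rpow_mul zero_le_two, mul_div_left_comm,
      ← Real.rpow_sub zero_lt_two]
    ring_nf
  · have hr : (2 : ℝ) ^ (-β) < 1 := Real.rpow_lt_one_of_one_lt_of_neg one_lt_two (by linarith)
    refine Summable.of_nonneg_of_le (fun n => by positivity) (fun n => ?_)
      ((summable_nat_add_iff 1).2 (summable_geometric_of_lt_one (by positivity) hr))
    refine (mul_le_mul_of_nonneg_left (min_le_left _ _) (by positivity)).trans (le_of_eq ?_)
    rw [mul_one, ← Real.rpow_intCast, ← Real.rpow_mul zero_le_two, ← Real.rpow_natCast _ (n + 1),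
      ← Real.rpow_mul zero_le_two]
    push_cast
    ring_nf

/-- Choose J with 2^J ≤ 1/ρ < 2^{J+1} and shift j by J: up to the factor ρ^{-β} the sum is dominated
by the fixed series for ρ ≈ 1. -/
theorem exists_sumBdd_dyadic {β : ℝ} (hβ : 0 < β) {M : ℕ} (hM : β < M) : ∃ C, 0 ≤ C ∧ ∀ ρ : ℝ,
    0 < ρ → SumBdd (fun j : ℤ => ((2 : ℝ) ^ j) ^ β * min 1 (((2 : ℝ) ^ j * ρ) ^ M)⁻¹)
      (C * ρ ^ (-β)) := by
  have hs := SumBdd.of_summable (fun i => by positivity) (summable_zpow_rpow_mul_min hβ hM)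
  refine ⟨_, hs.nonneg, fun ρ hρ => ?_⟩
  obtain ⟨J, h1, h2⟩ := exists_mem_Ico_zpow (inv_pos.2 hρ) (one_lt_two : (1 : ℝ) < 2)
  have h3 := (hs.comp_injective (e := fun j : ℤ => j - J) fun a b hab => by simpa using hab).const_mul
    (c := ρ ^ (-β)) (by positivity)
  rw [mul_comm]
  refine h3.mono (fun i => by positivity) fun j => ?_
  have hp : ∀ j : ℤ, (0 : ℝ) < 2 ^ j := fun j => by positivity
  have e1 : (2 : ℝ) ^ j = 2 ^ (j - J) * 2 ^ J := by rw [← zpow_add₀ two_ne_zero]; simp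
  have e2 : (2 : ℝ) ^ (j - J) / 2 ≤ 2 ^ j * ρ := by
    have h4 : (2 : ℝ) ^ (J + 1) = 2 ^ J * 2 := by rw [zpow_add₀ two_ne_zero]; simp
    have h5 : 1 ≤ 2 ^ J * 2 * ρ := by
      rw [← h4]; exact ((inv_lt_iff_one_lt_mul₀ hρ).1 h2).le
    rw [e1]
    nlinarith [hp (j - J)]
  have e3 : ((2 : ℝ) ^ j) ^ β ≤ ρ ^ (-β) * ((2 : ℝ) ^ (j - J)) ^ β := by
    rw [e1, Real.mul_rpow (hp _).le (hp _).le, mul_comm, Real.rpow_neg hρ.le,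
      ← Real.inv_rpow hρ.le]
    gcongr
  rw [← mul_assoc]
  refine mul_le_mul e3 ?_ (by positivity) (by positivity)
  have := hp (j - J)
  gcongr

end Sums

/-! ### The coefficients of a symbol -/

section Coeff

variable {N : ℕ}

/-- The coefficients of the expansion of `λ^a p(λ)`; the index `z k` is the pair `(j_k, n_k)`. -/
def symCoeff (p : (Fin N → ℝ) → ℂ) (a : Fin N → ℕ) (z : Fin N → ℤ × ℤ) : ℂ :=
  2 ^ N * oscInt p (fun k => (z k).1) (fun k => (z k).2) fun k => cutBump (a k)

variable {p : (Fin N → ℝ) → ℂ}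

theorem exists_norm_symCoeff_le (hp : IsSymbolZero p) (a : Fin N → ℕ) (L : ℕ) :
    ∃ C, 0 ≤ C ∧ ∀ z, ‖symCoeff p a z‖ ≤ C * ∏ k, ((1 + |((z k).2 : ℝ)|) ^ L)⁻¹ := by
  -- Each variable is listed L times, which yields decay of order L in every n_k simultaneously.
  obtain ⟨C, hC0, hC⟩ := exists_norm_oscInt_le hp (L • (Finset.univ : Finset (Fin N)).val) 0
    (fun k => cutBump (a k)) fun k => isBump_cutBump _
  refine ⟨2 ^ N * C, by positivity, fun z => ?_⟩
  have h1 := hC (fun k => (z k).1) (fun k => (z k).2)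
  rw [scaledPartial_zero, Multiset.map_nsmul, Multiset.prod_nsmul] at h1
  have h2 : (Multiset.map (fun k => 1 + |((z k).2 : ℝ)|) (Finset.univ : Finset (Fin N)).val).prod =
    ∏ k, (1 + |((z k).2 : ℝ)|) := rfl
  rw [h2] at h1
  rw [symCoeff, norm_mul, norm_pow, Complex.norm_ofNat, mul_assoc]
  refine mul_le_mul_of_nonneg_left ?_ (by positivity)
  rw [Finset.prod_inv_distrib, Finset.prod_pow, ← div_eq_mul_inv, le_div_iff₀, mul_comm]
  · exact h1
  · exact pow_pos (Finset.prod_pos fun k _ => by positivity) _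

theorem isCubeFn_cubeFn (hp : IsSymbolZero p) (j : Fin N → ℤ) (a : Fin N → ℕ) :
    IsCubeFn (cubeFn p j fun k => cutBump (a k)) :=
  ⟨continuous_cubeFn hp.1.continuousOn (fun _ => isBump_cutBump _) j,
    fun _ _ h => cubeFn_eq_zero (fun _ => isBump_cutBump _) j h⟩

theorem symCoeff_eq_cubeCoeff (p : (Fin N → ℝ) → ℂ) (a : Fin N → ℕ) (j n : Fin N → ℤ) :
    symCoeff p a (fun k => (j k, n k)) =
      2 ^ N * cubeCoeff (cubeFn p j fun k => cutBump (a k)) n := by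
  rw [symCoeff, oscInt, cubeCoeff]
  congr 2
  ext θ
  rw [cubeFn, cubeFn, Finset.prod_mul_distrib, mul_assoc]

theorem summable_cubeCoeff (hp : IsSymbolZero p) (j : Fin N → ℤ) (a : Fin N → ℕ) :
    Summable (cubeCoeff (cubeFn p j fun k => cutBump (a k))) := by
  obtain ⟨C, hC0, hC⟩ := exists_norm_symCoeff_le hp a 2
  obtain ⟨B, hB⟩ := exists_sumBdd_inv_sq
  have h1 := ((SumBdd.pi fun _ : Fin N => hB).const_mul hC0).summable
  refine Summable.of_norm_bounded h1 fun n => ?_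
  have h2 := hC fun k => (j k, n k)
  rw [symCoeff_eq_cubeCoeff, norm_mul, norm_pow, Complex.norm_ofNat] at h2
  refine le_trans ?_ h2
  exact le_mul_of_one_le_left (norm_nonneg _) (one_le_pow₀ one_le_two)

/-- The factor `e^{-ks}(1 - e^{-s})`. -/
def expWeight (k : ℕ) (s : ℝ) : ℝ := Real.exp (-s) ^ k * (1 - Real.exp (-s))

theorem chebSym_eq_cos (k : ℕ) (m j : ℤ) {l : ℝ} (hl : 0 < l) :
    chebSym k m.natAbs (2 ^ (-j)) l =
      Real.cos (2 * Real.pi * (m * invLogCos (2 ^ (-j) * l))) * expWeight k (2 ^ (-j) * l) := by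
  have hs : (0 : ℝ) < 2 ^ (-j) * l := by positivity
  have h1 := exp_neg_logCos (invLogCos_mem hs)
  rw [logCos_invLogCos hs] at h1
  rw [chebSym_of_pos _ _ _ hl, ← expWeight, Complex.ofReal_mul]
  congr 2
  rw [h1, shiftedT_eval_cos_sq, Nat.cast_natAbs, Int.cast_abs]
  rw [show 2 * Real.pi * (m * invLogCos (2 ^ (-j) * l)) =
    m * (2 * (Real.pi * invLogCos (2 ^ (-j) * l))) by ring]
  rcases abs_cases (m : ℝ) with h | h
  · rw [h.1]
  · rw [h.1, neg_mul, Real.cos_neg]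

theorem cutBump_mul_expWeight (a : ℕ) {s : ℝ} (hs : 0 < s) :
    cutBump a (invLogCos s) * expWeight 2 s = dyadicCut s * s ^ a := by
  rw [cutBump_of_mem _ (invLogCos_mem hs), logCos_invLogCos hs, expWeight]
  have h1 : Real.exp (-s) < 1 := Real.exp_lt_one_iff.2 (by linarith)
  have h0 := Real.exp_pos (-s)
  have h2 : Real.exp (-s) ^ 2 * (1 - Real.exp (-s)) ≠ 0 :=
    (mul_pos (by positivity) (by linarith)).ne'
  rw [← Complex.ofReal_mul, div_mul_cancel₀ _ h2]
  push_cast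
  rfl

/-- At the point θ corresponding to l, the cosine series of the weighted piece is multiplied by ∏
e^{-2s}(1 - e^{-s}), which undoes the division in `cutBump` and leaves p times the dyadic cutoffs.
-/
theorem hasSum_symCoeff_fixed_scale (hp : IsSymbolZero p) (j : Fin N → ℤ) {l : Fin N → ℝ}
    (hl : l ∈ posOrthant N) :
    HasSum (fun n : Fin N → ℤ => symCoeff p 0 (fun k => (j k, n k)) *
        ∏ k, chebSym 2 (n k).natAbs (2 ^ (-j k)) (l k))
      (p l * ∏ k, (dyadicCut (2 ^ (-j k) * l k) : ℂ)) := by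
  have hs : ∀ k, 0 < 2 ^ (-j k) * l k := fun k => mul_pos (by positivity) (hl k)
  set θ : Fin N → ℝ := fun k => invLogCos (2 ^ (-j k) * l k) with hθ
  have h1 := ((isCubeFn_cubeFn hp j 0).hasSum (summable_cubeCoeff hp j 0) (θ := θ)
    fun k => invLogCos_mem (hs k)).mul_right (∏ k, (expWeight 2 (2 ^ (-j k) * l k) : ℂ))
  have h2 : dilVec j θ = l := by
    ext k
    rw [dilVec, hθ, logCos_invLogCos (hs k), ← mul_assoc, ← zpow_add₀ two_ne_zero]
    simp
  have h3 : cubeFn p j (fun k => cutBump ((0 : Fin N → ℕ) k)) θ *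
      ∏ k, (expWeight 2 (2 ^ (-j k) * l k) : ℂ) =
      p l * ∏ k, (dyadicCut (2 ^ (-j k) * l k) : ℂ) := by
    rw [cubeFn, h2, mul_assoc, ← Finset.prod_mul_distrib]
    congr 1
    refine Finset.prod_congr rfl fun k _ => ?_
    rw [cutBump_mul_expWeight _ (hs k)]
    simp
  rw [h3] at h1
  refine h1.congr_fun fun n => ?_
  rw [symCoeff_eq_cubeCoeff, mul_assoc (2 ^ N * _), ← Finset.prod_mul_distrib]
  congr 1
  exact Finset.prod_congr rfl fun k _ => chebSym_eq_cos 2 (n k) (j k) (hl k)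

/-- The blocks are not localized in frequency; decay at both ends replaces that: 1 - e^{-s} ≤ s near
zero and e^{-s} ≤ 1/s at infinity, with the Chebyshev factor at most 1. -/
theorem norm_chebSym_two_le (n : ℕ) {t l : ℝ} (ht : 0 < t) :
    ‖chebSym 2 n t l‖ ≤ if 0 < l then min (t * l) (t * l)⁻¹ else 0 := by
  split_ifs with hl
  · have hs : 0 < t * l := by positivity
    have h0 := Real.exp_pos (-(t * l))
    have h1 : Real.exp (-(t * l)) ≤ 1 := Real.exp_le_one_iff.2 (by linarith)
    rw [chebSym_of_pos _ _ _ hl, Complex.norm_real, Real.norm_eq_abs, abs_mul]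
    have h2 : 0 ≤ Real.exp (-(t * l)) ^ 2 * (1 - Real.exp (-(t * l))) :=
      mul_nonneg (by positivity) (by linarith)
    rw [abs_of_nonneg h2]
    refine (mul_le_of_le_one_left h2 (abs_shiftedT_eval_le n h0.le h1)).trans (le_min ?_ ?_)
    · have h3 : 1 - Real.exp (-(t * l)) ≤ t * l := by
        linarith [Real.add_one_le_exp (-(t * l))]
      have h4 : Real.exp (-(t * l)) ^ 2 ≤ 1 := pow_le_one₀ h0.le h1
      nlinarith
    · have h3 : Real.exp (-(t * l)) ≤ (t * l)⁻¹ := by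
        rw [Real.exp_neg]
        exact inv_anti₀ hs (by linarith [Real.add_one_le_exp (t * l)])
      refine le_trans ?_ h3
      have h5 : Real.exp (-(t * l)) ^ 2 ≤ Real.exp (-(t * l)) := by nlinarith
      nlinarith
  · rw [chebSym_of_nonpos _ _ _ (not_lt.1 hl), norm_zero]

theorem exists_sumBdd_chebSym : ∃ B, ∀ l : ℝ,
    SumBdd (fun z : ℤ × ℤ => (if 0 < l then min (2 ^ (-z.1) * l) (2 ^ (-z.1) * l)⁻¹ else 0) *
      ((1 + |(z.2 : ℝ)|) ^ 2)⁻¹) B := by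
  obtain ⟨B, hB⟩ := exists_sumBdd_inv_sq
  obtain ⟨C, hC0, hC⟩ := exists_sumBdd_dyadic one_pos (M := 2) (by norm_num)
  refine ⟨C * B, fun l => SumBdd.prod
    (f := fun j : ℤ => if 0 < l then min (2 ^ (-j) * l) (2 ^ (-j) * l)⁻¹ else 0) ?_ hB⟩
  split_ifs with hl
  -- With ρ = 1/l, β = 1 and M = 2 the dyadic summand is l·min(s, 1/s) for s = 2^{-j}l; dividing by
  -- l makes the bound independent of l.
  · have h1 := (hC l⁻¹ (inv_pos.2 hl)).const_mul (inv_pos.2 hl).le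
    rw [Real.rpow_neg_one, inv_inv, mul_comm C, inv_mul_cancel_left₀ hl.ne'] at h1
    refine h1.mono (fun j => by positivity) fun j => le_of_eq ?_
    have hj : (0 : ℝ) < 2 ^ j := by positivity
    rw [Real.rpow_one, mul_min_of_nonneg _ _ hj.le, mul_min_of_nonneg _ _ (inv_pos.2 hl).le,
      min_comm, zpow_neg]
    congr 1
    · field_simp
    · field_simp
  · exact ⟨fun _ => le_rfl, fun s => by simpa using hC0⟩

theorem exists_sumBdd_symCoeff (hp : IsSymbolZero p) : ∃ B, ∀ l : Fin N → ℝ,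
    SumBdd (fun z : Fin N → ℤ × ℤ =>
      ‖symCoeff p 0 z * ∏ k, chebSym 2 (z k).2.natAbs (2 ^ (-(z k).1)) (l k)‖) B := by
  obtain ⟨C, hC0, hC⟩ := exists_norm_symCoeff_le hp 0 2
  obtain ⟨B, hB⟩ := exists_sumBdd_chebSym
  refine ⟨C * ∏ k : Fin N, B, fun l => ?_⟩
  refine ((SumBdd.pi fun k => hB (l k)).const_mul hC0).mono (fun _ => norm_nonneg _) fun z => ?_
  rw [norm_mul, norm_prod]
  refine (mul_le_mul (hC z) (Finset.prod_le_prod (fun _ _ => norm_nonneg _) fun k _ =>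
    norm_chebSym_two_le (z k).2.natAbs (by positivity)) (by positivity) (by positivity)).trans
    (le_of_eq ?_)
  rw [mul_assoc, ← Finset.prod_mul_distrib]
  congr 1
  exact Finset.prod_congr rfl fun k _ => mul_comm _ _

/-- Absolute summability allows summing over n at fixed j, which gives p times the cutoffs, and then
over j, where the partition of unity is a finite sum. -/
theorem hasSum_symCoeff (hp : IsSymbolZero p) {l : Fin N → ℝ} (hl : l ∈ posOrthant N) :
    HasSum (fun z : Fin N → ℤ × ℤ =>
      symCoeff p 0 z * ∏ k, chebSym 2 (z k).2.natAbs (2 ^ (-(z k).1)) (l k)) (p l) := by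
  classical
  obtain ⟨B, hB⟩ := exists_sumBdd_symCoeff hp
  have hsum := (hB l).summable.of_norm
  let e : (Fin N → ℤ × ℤ) ≃ (Fin N → ℤ) × (Fin N → ℤ) := Equiv.arrowProdEquivProdArrow _ _ _
  have h1 := (e.symm.summable_iff.2 hsum).hasSum.prod_fiberwise
    fun j => hasSum_symCoeff_fixed_scale hp j hl
  choose S hS0 hS1 using fun k => exists_finset_dyadicCut (hl k)
  have h2 : HasSum (fun j : Fin N → ℤ => p l * ∏ k, (dyadicCut (2 ^ (-j k) * l k) : ℂ)) (p l) := by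
    have h3 : ∑ j ∈ Fintype.piFinset S, p l * ∏ k, (dyadicCut (2 ^ (-j k) * l k) : ℂ) = p l := by
      rw [← Finset.mul_sum, ← Finset.prod_univ_sum S fun k j => (dyadicCut (2 ^ (-j) * l k) : ℂ)]
      rw [Finset.prod_eq_one, mul_one]
      intro k _
      exact_mod_cast hS1 k
    have h4 := hasSum_sum_of_ne_finset_zero (L := .unconditional _)
      (f := fun j : Fin N → ℤ => p l * ∏ k, (dyadicCut (2 ^ (-j k) * l k) : ℂ))
      (s := Fintype.piFinset S) fun j hj => by
        obtain ⟨k, hk⟩ := not_forall.1 (mt Fintype.mem_piFinset.2 hj)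
        rw [Finset.prod_eq_zero (Finset.mem_univ k) (by rw [hS0 k _ hk, Complex.ofReal_zero]),
          mul_zero]
    rwa [h3] at h4
  have h5 := h1.unique h2
  rw [← h5, ← e.symm.hasSum_iff]
  exact (e.symm.summable_iff.2 hsum).hasSum

/-- Summing over n_i alone at a fixed scale evaluates the i-th variable at the point where s =
2^{-j}l. Raising a_i by one multiplies the bump there by the number s, so the sum is multiplied by
s. This identity is what makes Δ_i shift the index a. -/
theorem exists_hasSum_symCoeff_update (hp : IsSymbolZero p) (a : Fin N → ℕ) (i : Fin N) (j : ℤ)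
    (z : Fin N → ℤ × ℤ) {l : ℝ} (hl : 0 < l) : ∃ V : ℂ,
    HasSum (fun m : ℤ => symCoeff p a (Function.update z i (j, m)) *
      chebSym 1 m.natAbs (2 ^ (-j)) l) V ∧
    HasSum (fun m : ℤ => symCoeff p (a + Pi.single i 1) (Function.update z i (j, m)) *
      chebSym 1 m.natAbs (2 ^ (-j)) l) ((2 ^ (-j) * l : ℝ) * V) := by
  obtain _ | M := N
  · exact i.elim0
  have hs : (0 : ℝ) < 2 ^ (-j) * l := by positivity
  set t := invLogCos (2 ^ (-j) * l) with ht
  have htm : t ∈ halfIoo := invLogCos_mem hs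
  let jj : Fin (M + 1) → ℤ := Function.update (fun k => (z k).1) i j
  let n' : Fin M → ℤ := i.removeNth fun k => (z k).2
  have hz : ∀ m, Function.update z i (j, m) = fun k => (jj k, i.insertNth (α := fun _ => ℤ) m n' k) := by
    intro m
    ext1 k
    rcases eq_or_ne k i with rfl | hk
    · simp [jj]
    · obtain ⟨k, rfl⟩ := Fin.exists_succAbove_eq hk
      simp [jj, n', Fin.removeNth]
  have key : ∀ a : Fin (M + 1) → ℕ, HasSum (fun m : ℤ =>
      symCoeff p a (Function.update z i (j, m)) * chebSym 1 m.natAbs (2 ^ (-j)) l)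
      (2 ^ M * expWeight 1 (2 ^ (-j) * l) *
        sliceCoeff (cubeFn p jj fun k => cutBump (a k)) i n' t) := by
    intro a
    have h1 := ((isCubeFn_cubeFn hp jj a).hasSum_slice (summable_cubeCoeff hp jj a) i n'
      htm).mul_left (2 ^ M * (expWeight 1 (2 ^ (-j) * l) : ℂ))
    refine h1.congr_fun fun m => ?_
    rw [hz, symCoeff_eq_cubeCoeff, chebSym_eq_cos 1 m j hl, ← ht]
    ring
  refine ⟨_, key a, ?_⟩
  have h2 := key (a + Pi.single i 1)
  have h3 : sliceCoeff (cubeFn p jj fun k => cutBump ((a + Pi.single i 1 : Fin (M + 1) → ℕ) k)) i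
      n' t = (2 ^ (-j) * l : ℝ) * sliceCoeff (cubeFn p jj fun k => cutBump (a k)) i n' t := by
    rw [sliceCoeff, sliceCoeff, cubeCoeff, cubeCoeff, ← integral_const_mul]
    congr 1
    ext θ
    have h4 : ∏ k, cutBump ((a + Pi.single i 1 : Fin (M + 1) → ℕ) k)
        (i.insertNth (α := fun _ => ℝ) t θ k) =
        (2 ^ (-j) * l : ℝ) * ∏ k, cutBump (a k) (i.insertNth (α := fun _ => ℝ) t θ k) := by
      rw [i.prod_univ_succAbove, i.prod_univ_succAbove]
      simp only [Pi.add_apply, Pi.single_eq_same, Fin.insertNth_apply_same,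
        Fin.insertNth_apply_succAbove, ne_eq, Fin.succAbove_ne, not_false_eq_true,
        Pi.single_eq_of_ne, add_zero]
      rw [← mul_assoc]
      congr 1
      rw [cutBump_of_mem _ htm, cutBump_of_mem _ htm, ht, logCos_invLogCos hs,
        ← Complex.ofReal_mul]
      congr 1
      ring
    rw [cubeFn, cubeFn, h4]
    ring
  rw [h3] at h2
  convert h2 using 1
  ring

end Coeff

/-! ### The domain of an operator in a spectral representation -/

section Domain

variable {Ω H : Type*} [MeasurableSpace Ω] {ν : Measure Ω} [NormedAddCommGroup H]
  [InnerProductSpace ℂ H] {U : Lp ℂ 2 ν ≃ₗᵢ[ℂ] H} {g : Ω → ℝ}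
  {E : ProjectionValuedMeasure ℝ H} {A : H →ₗ.[ℂ] H}

theorem Represents.mem_domain_iff (hg : Measurable g) (h : Represents U g E)
    (hE : E.IsSpectralResolution A) (u : H) :
    u ∈ A.domain ↔ Integrable (fun x => g x ^ 2 * ‖U.symm u x‖ ^ 2) ν := by
  have hm : Measurable fun x => ENNReal.ofReal (‖U.symm u x‖ ^ 2) :=
    ((Lp.stronglyMeasurable (U.symm u)).measurable.norm.pow_const 2).ennreal_ofReal
  rw [hE.1, h.scalarMeasure_eq hg, integrable_map_measure (by fun_prop) hg.aemeasurable,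
    integrable_withDensity_iff_integrable_smul' hm (ae_of_all _ fun x => ENNReal.ofReal_lt_top)]
  refine integrable_congr (ae_of_all _ fun x => ?_)
  simp only [Function.comp_apply, smul_eq_mul]
  rw [ENNReal.toReal_ofReal (by positivity), mul_comm]

/-- Polarization for an operator defined only on a subspace. -/
theorem inner_eq_zero_of_inner_self {S : Submodule ℂ H} (D : S →ₗ[ℂ] H)
    (h : ∀ u : S, inner ℂ (u : H) (D u) = 0) (u v : S) : inner ℂ (u : H) (D v) = 0 := by
  have h1 := h (u + v)
  have h2 := h (u + Complex.I • v)
  simp only [Submodule.coe_add, map_add, inner_add_left, inner_add_right, h u, h v, zero_add,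
    add_zero, Submodule.coe_smul, map_smul, inner_smul_left, inner_smul_right, mul_zero,
    Complex.conj_I] at h1 h2
  have h3 : Complex.I * (inner ℂ (u : H) (D v) - inner ℂ (v : H) (D u)) = 0 := by
    linear_combination h2
  have h4 := (mul_eq_zero.1 h3).resolve_left Complex.I_ne_zero
  linear_combination (h1 + h4) / 2

theorem Represents.memLp_mul (hg : Measurable g) (h : Represents U g E)
    (hE : E.IsSpectralResolution A) (u : A.domain) :
    MemLp (fun x => (g x : ℂ) * U.symm (u : H) x) 2 ν :=
  memLp_of_ae_mul (Complex.measurable_ofReal.comp hg) (by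
    simpa using (h.mem_domain_iff hg hE u).1 u.2)

/-- The difference D between A and multiplication by g has zero quadratic form on the domain, so by
polarization its values are orthogonal to the domain. Truncations of D u lie in the domain and tend
to D u, hence D u = 0. -/
theorem Represents.apply_eq (hg : Measurable g) (h : Represents U g E)
    (hE : E.IsSpectralResolution A) (u : A.domain) :
    A u = U ((h.memLp_mul hg hE u).toLp _) := by
  let B : A.domain →ₗ[ℂ] H :=
    { toFun := fun u => U ((h.memLp_mul hg hE u).toLp _)
      map_add' := fun u v => by
        rw [← map_add, ← MemLp.toLp_add]
        congr 1
        refine MemLp.toLp_congr _ _ ?_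
        filter_upwards [Lp.coeFn_add (U.symm (u : H)) (U.symm (v : H))] with x hx
        rw [Submodule.coe_add, map_add, hx]
        simp [mul_add]
      map_smul' := fun c u => by
        rw [RingHom.id_apply, ← map_smul, ← MemLp.toLp_const_smul]
        congr 1
        refine MemLp.toLp_congr _ _ ?_
        filter_upwards [Lp.coeFn_smul c (U.symm (u : H))] with x hx
        rw [Submodule.coe_smul, map_smul, hx]
        simp [mul_left_comm] }
  let D : A.domain →ₗ[ℂ] H := A.toFun - B
  have hD : ∀ u : A.domain, inner ℂ (u : H) (D u) = 0 := by
    intro u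
    have h1 : inner ℂ (u : H) (A u) = ∫ x, (g x : ℂ) * ((‖U.symm (u : H) x‖ ^ 2 : ℝ) : ℂ) ∂ν := by
      have h2 := h.integral_scalarMeasure hg (u : H) MeasurableSet.univ
        (f := fun l : ℝ => (l : ℂ)) (by simpa using Complex.measurable_ofReal)
      simp only [indicator_univ, Measure.restrict_univ] at h2
      rw [hE.2 u, ← h2, integral_complex_ofReal]
    have h3 : inner ℂ (u : H) (B u) = ∫ x, (g x : ℂ) * ((‖U.symm (u : H) x‖ ^ 2 : ℝ) : ℂ) ∂ν := by
      change inner ℂ (u : H) (U ((h.memLp_mul hg hE u).toLp _)) = _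
      rw [← inner_symm_eq U, LinearIsometryEquiv.symm_apply_apply, L2_inner_eq]
      refine integral_congr_ae ?_
      filter_upwards [MemLp.coeFn_toLp (h.memLp_mul hg hE u)] with x hx
      rw [hx]
      have h4 : (starRingEnd ℂ) (U.symm (u : H) x) * (U.symm (u : H) x) =
        ((‖U.symm (u : H) x‖ ^ 2 : ℝ) : ℂ) := by simp [Complex.conj_mul']
      rw [← h4]
      ring
    change inner ℂ (u : H) (A u - B u) = 0
    rw [inner_sub_right, h1, h3, sub_self]
  have hD0 : D u = 0 := by
    -- Cutting to |g| ≤ n puts any vector into the domain, and the cuts converge strongly to the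
    -- identity.
    let S : ℕ → Set Ω := fun n => {x | |g x| ≤ n}
    have hS : ∀ n, MeasurableSet (S n) := fun n =>
      measurableSet_le (continuous_abs.measurable.comp hg) measurable_const
    have hdom : ∀ n, specOp U ((S n).indicator fun _ => 1) (D u) ∈ A.domain := by
      intro n
      rw [h.mem_domain_iff hg hE, symm_specOp]
      refine ((integrable_norm_sq (mulOp ν ((S n).indicator fun _ => 1)
        (U.symm (D u)))).const_mul ((n : ℝ) ^ 2)).mono'
        (((hg.pow_const 2).mul
          ((Lp.stronglyMeasurable _).measurable.norm.pow_const 2)).aestronglyMeasurable) ?_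
      filter_upwards [mulOp_coe (isBddMeas_indicator_one (hS n)) (U.symm (D u))] with x hx
      rw [Real.norm_of_nonneg (by positivity), hx]
      by_cases hxS : x ∈ S n
      · have h5 : g x ^ 2 ≤ (n : ℝ) ^ 2 := sq_le_sq' (abs_le.1 hxS).1 (abs_le.1 hxS).2
        gcongr
      · simp [hxS]
    have hlim : Tendsto (fun n => specOp U ((S n).indicator fun _ => 1) (D u)) atTop
        (𝓝 (specOp U (fun _ => 1) (D u))) := by
      refine tendsto_specOp U (C := 1) (fun n => isBddMeas_indicator_one (hS n))
        (IsBddMeas.const 1) (fun n x => (norm_indicator_le_norm_self _ _).trans (by simp))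
        (fun x => ?_) _
      obtain ⟨n, hn⟩ := exists_nat_ge |g x|
      refine tendsto_const_nhds.congr' ?_
      filter_upwards [eventually_ge_atTop n] with m hm
      have : x ∈ S m := hn.trans (Nat.cast_le.2 hm)
      rw [indicator_of_mem this]
    rw [specOp_one] at hlim
    have h6 := hlim.inner (𝕜 := ℂ) (tendsto_const_nhds (x := D u))
    have h7 : ∀ n, inner ℂ (specOp U ((S n).indicator fun _ => 1) (D u)) (D u) = 0 := fun n =>
      inner_eq_zero_of_inner_self D hD ⟨_, hdom n⟩ u
    simp only [h7] at h6
    have h8 := tendsto_nhds_unique h6 tendsto_const_nhds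
    exact inner_self_eq_zero.1 h8
  exact sub_eq_zero.1 hD0

theorem Represents.specOp_mem_domain (hg : Measurable g) (h : Represents U g E)
    (hE : E.IsSpectralResolution A) {m : Ω → ℂ} (hm : IsBddMeas m)
    (hm' : IsBddMeas fun x => (g x : ℂ) * m x) (u : H) :
    ∃ hu : specOp U m u ∈ A.domain, A ⟨specOp U m u, hu⟩ = specOp U (fun x => (g x : ℂ) * m x) u := by
  have hu : specOp U m u ∈ A.domain := by
    rw [h.mem_domain_iff hg hE, symm_specOp]
    refine (integrable_norm_sq (mulOp ν (fun x => (g x : ℂ) * m x) (U.symm u))).congr ?_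
    filter_upwards [mulOp_coe hm (U.symm u), mulOp_coe hm' (U.symm u)] with x h1 h2
    rw [h1, h2]
    simp only [norm_mul, Complex.norm_real, mul_pow, Real.norm_eq_abs, sq_abs]
    ring
  refine ⟨hu, ?_⟩
  rw [h.apply_eq hg hE, specOp_apply U (fun x => (g x : ℂ) * m x) u]
  congr 1
  apply Lp.ext
  filter_upwards [MemLp.coeFn_toLp (h.memLp_mul hg hE ⟨_, hu⟩), mulOp_coe hm (U.symm u),
    mulOp_coe hm' (U.symm u)] with x h1 h2 h3
  rw [h1, h3]
  simp only [symm_specOp]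
  rw [h2]
  ring

end Domain

/-! ### Series of measurable functions -/

section Series

theorem measurable_tsum_of_summable {ι α : Type*} [Countable ι] [MeasurableSpace α]
    {f : ι → α → ℂ} (hf : ∀ i, Measurable (f i)) (hs : ∀ x, Summable fun i => f i x) :
    Measurable fun x => ∑' i, f i x :=
  measurable_of_tendsto_metrizable' atTop (f := fun (s : Finset ι) x => ∑ i ∈ s, f i x)
    (fun s => Finset.measurable_sum s fun i _ => hf i) (tendsto_pi_nhds.2 fun x => (hs x).hasSum)

theorem exists_seq_tendsto_ae_of_tendsto_Lp {ι α : Type*} [MeasurableSpace α] {μ : Measure α}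
    {l : Filter ι} [l.NeBot] [l.IsCountablyGenerated] {v : ι → Lp ℂ 2 μ} {w : Lp ℂ 2 μ}
    (h : Tendsto v l (𝓝 w)) : ∃ ns : ℕ → ι, Tendsto ns atTop l ∧
      ∀ᵐ x ∂μ, Tendsto (fun i => v (ns i) x) atTop (𝓝 (w x)) :=
  (tendstoInMeasure_of_tendsto_Lp h).exists_seq_tendsto_ae'

theorem norm_tsum_sub_sum_le {ι : Type*} {a : ι → ℂ} {Q : ι → ℝ} (hQ : Summable Q)
    (h : ∀ i, ‖a i‖ ≤ Q i) (s : Finset ι) :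
    ‖∑' i, a i - ∑ i ∈ s, a i‖ ≤ ∑' i, Q i - ∑ i ∈ s, Q i := by
  have ha : Summable a := Summable.of_norm_bounded hQ h
  rw [← ha.sum_add_tsum_subtype_compl s, ← hQ.sum_add_tsum_subtype_compl s, add_sub_cancel_left,
    add_sub_cancel_left]
  exact tsum_of_norm_bounded (hQ.subtype _).hasSum fun i => h i

variable {Ω α : Type*} [MeasurableSpace Ω] [MeasurableSpace α] {ν : Measure Ω} {μ : Measure α}
  {ι : Type*} [Countable ι] {b : ι → Ω → ℂ} {C : ℝ}

theorem isBddMeas_tsum {Q : ι → ℝ} (hb : ∀ i, Measurable (b i)) (hQ : Summable Q)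
    (h : ∀ i o, ‖b i o‖ ≤ Q i) : IsBddMeas fun o => ∑' i, b i o :=
  ⟨measurable_tsum_of_summable hb fun o => Summable.of_norm_bounded hQ fun i => h i o,
    _, fun o => tsum_of_norm_bounded hQ.hasSum fun i => h i o⟩

theorem tendsto_specOp_sum {H : Type*} [NormedAddCommGroup H] [InnerProductSpace ℂ H]
    (U : Lp ℂ 2 ν ≃ₗᵢ[ℂ] H) (hb : ∀ i, IsBddMeas (b i))
    (h : ∀ o, SumBdd (fun i => ‖b i o‖) C) (u : H) :
    Tendsto (fun s : Finset ι => ∑ i ∈ s, specOp U (b i) u) atTop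
      (𝓝 (specOp U (fun o => ∑' i, b i o) u)) := by
  have h1 : ∀ s : Finset ι, ∑ i ∈ s, specOp U (b i) u =
      specOp U (fun o => ∑ i ∈ s, b i o) u := fun s => by
    rw [specOp_sum U fun i _ => hb i, sum_apply]
  simp only [h1]
  refine tendsto_specOp U (C := C) (fun s => IsBddMeas.sum fun i _ => hb i)
    ⟨measurable_tsum_of_summable (fun i => (hb i).1) fun o => (h o).summable.of_norm,
      C, fun o => ?_⟩ (fun s o => ?_) (fun o => ?_) u
  · exact (norm_tsum_le_tsum_norm (h o).summable).trans (h o).tsum_le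
  · exact (norm_sum_le _ _).trans ((h o).2 s)
  · exact (h o).summable.of_norm.hasSum

/-- If the terms of a series of multipliers, applied to `u`, are given by functions `f i`, then
the sum is given by the pointwise sum, where that converges. -/
theorem ae_specOp_tsum_eq (U : Lp ℂ 2 ν ≃ₗᵢ[ℂ] Lp ℂ 2 μ) (hb : ∀ i, IsBddMeas (b i))
    (h : ∀ o, SumBdd (fun i => ‖b i o‖) C) (u : Lp ℂ 2 μ) {f : ι → α → ℂ}
    (hf : ∀ i, specOp U (b i) u =ᵐ[μ] f i) :
    ∀ᵐ x ∂μ, ∀ w, HasSum (fun i => f i x) w → specOp U (fun o => ∑' i, b i o) u x = w := by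
  -- L² convergence gives pointwise convergence only along a subsequence of partial sums, which
  -- suffices because the full pointwise series already has the limit w.
  obtain ⟨ns, h1, h2⟩ := exists_seq_tendsto_ae_of_tendsto_Lp (tendsto_specOp_sum U hb h u)
  filter_upwards [h2, ae_all_iff.2 hf,
    ae_all_iff.2 fun s : Finset ι => Lp.coeFn_finsetSum s fun i => specOp U (b i) u]
    with x h3 h4 h5 w hw
  refine tendsto_nhds_unique h3 ?_
  have h6 : ∀ i, (∑ j ∈ ns i, specOp U (b j) u : Lp ℂ 2 μ) x = ∑ j ∈ ns i, f j x := fun i => by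
    rw [h5, Finset.sum_apply]
    exact Finset.sum_congr rfl fun j _ => h4 j
  simp only [h6]
  have h7 : Tendsto (fun s : Finset ι => ∑ i ∈ s, f i x) atTop (𝓝 w) := hw
  exact h7.comp h1

end Series

/-! ### Kernel families and local Laplacians of one-variable series -/

/-- `κ n j` are symmetric kernels of the multipliers `ψ_n(2^{-j} λ)`, with off-diagonal bounds;
their slices are in the range of the multipliers `b_n(2^{-j} λ)`. -/
structure IsKernelFamily {Ω X : Type*} [MeasurableSpace Ω] [MetricSpace X] [MeasurableSpace X]
    {ν : Measure Ω} {μ : Measure X} (U : Lp ℂ 2 ν ≃ₗᵢ[ℂ] Lp ℂ 2 μ) (g : Ω → ℝ) (d : ℝ)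
    (κ : ℤ → ℤ → X → X → ℂ) : Prop where
  measurable : ∀ n j, Measurable fun z : X × X => κ n j z.1 z.2
  symm : ∀ n j x y, κ n j x y = κ n j y x
  memLp : ∀ n j x, MemLp (κ n j x) 2 μ
  hasKernel : ∀ n j, HasKernel (specOp U fun o => chebSym 2 n.natAbs (2 ^ (-j)) (g o)) (κ n j)
  bound : ∀ M : ℕ, ∃ C : ℝ, 0 < C ∧ ∃ A : ℕ, ∀ n j x y, x ≠ y → ‖κ n j x y‖ ≤
    C * (1 + n.natAbs) ^ A * ((2 : ℝ) ^ j) ^ (d / (d + 1)) *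
      min 1 (((2 : ℝ) ^ j * dist x y ^ (d + 1)) ^ M)⁻¹
  slice : ∀ j y, ∃ η : Lp ℂ 2 μ, ∀ n, (fun x => κ n j x y) =ᵐ[μ]
    specOp U (fun o => chebSym 1 n.natAbs (2 ^ (-j)) (g o)) η

theorem HeatModel.exists_isKernelFamily {Ω X : Type*} [MeasurableSpace Ω] [MetricSpace X]
    [MeasurableSpace X] [BorelSpace X] {ν : Measure Ω} {μ : Measure X}
    {U : Lp ℂ 2 ν ≃ₗᵢ[ℂ] Lp ℂ 2 μ} {g : Ω → ℝ} {h : ℝ → X → X → ℂ} {d γ c₁ c₂ : ℝ}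
    (H : HeatModel U g h d γ c₁ c₂) : ∃ κ, IsKernelFamily U g d κ := by
  obtain ⟨κ, h1, h2, h3, h4, h5, h6⟩ := H.exists_kernel_family
  exact ⟨κ, h1, h2, h3, h4, h5, h6⟩

namespace IsKernelFamily

variable {Ω X : Type*} [MeasurableSpace Ω] [MetricSpace X] [MeasurableSpace X] [BorelSpace X]
  {ν : Measure Ω} {μ : Measure X} {U : Lp ℂ 2 ν ≃ₗᵢ[ℂ] Lp ℂ 2 μ} {g : Ω → ℝ} {d : ℝ}
  {κ : ℤ → ℤ → X → X → ℂ}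

/-- The kernel bound is split into a power of 1 + |n|, left for the coefficients to cancel, and a
weight summable over (j, n). The two extra powers in A + 2 pay for the sum over n. -/
theorem exists_weight (hκ : IsKernelFamily U g d κ) (hd : 0 < d) (b : ℕ) :
    ∃ (A : ℕ) (C : ℝ) (w : ℝ → ℤ × ℤ → ℝ), 0 ≤ C ∧
      (∀ ρ, 0 < ρ → SumBdd (w ρ) (C * ρ ^ (-(b + d / (d + 1))))) ∧
      (∀ ρ ρ' z, 0 < ρ → ρ ≤ ρ' → w ρ' z ≤ w ρ z) ∧
      ∀ n j x y, x ≠ y → ((2 : ℝ) ^ j) ^ b * ‖κ n j x y‖ ≤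
        (1 + |(n : ℝ)|) ^ A * w (dist x y ^ (d + 1)) (j, n) := by
  have hβ : 0 < b + d / (d + 1) := by positivity
  obtain ⟨M, hM⟩ := exists_nat_gt (b + d / (d + 1))
  obtain ⟨C, hC, A, hA⟩ := hκ.bound M
  obtain ⟨C', hC', hS⟩ := exists_sumBdd_dyadic hβ hM
  obtain ⟨B, hB⟩ := exists_sumBdd_inv_sq
  refine ⟨A + 2, C * (C' * B), fun ρ z => C * ((((2 : ℝ) ^ z.1) ^ (b + d / (d + 1)) *
    min 1 (((2 : ℝ) ^ z.1 * ρ) ^ M)⁻¹) * ((1 + |(z.2 : ℝ)|) ^ 2)⁻¹), ?_, ?_, ?_, ?_⟩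
  · have := hB.nonneg; positivity
  · intro ρ hρ
    have := ((hS ρ hρ).prod hB).const_mul hC.le
    convert this using 1
    ring
  · intro ρ ρ' z hρ hρρ'
    have : (0 : ℝ) < 2 ^ z.1 := by positivity
    dsimp only
    gcongr
  · intro n j x y hxy
    have h2 : (0 : ℝ) < 2 ^ j := by positivity
    have h3 : ((n.natAbs : ℕ) : ℝ) = |(n : ℝ)| := by rw [Nat.cast_natAbs, Int.cast_abs]
    refine (mul_le_mul_of_nonneg_left (hA n j x y hxy) (by positivity)).trans (le_of_eq ?_)
    have h4 : (1 + |(n : ℝ)|) ≠ 0 := by positivity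
    dsimp only
    rw [h3, Real.rpow_add h2, Real.rpow_natCast, pow_add]
    field_simp

theorem isBddMeas_cheb_comp (hg : Measurable g) (k n : ℕ) (j : ℤ) :
    IsBddMeas fun o => chebSym k n (2 ^ (-j)) (g o) :=
  (isBddMeas_chebSym k n (by positivity)).comp hg

/-- The multiplier `Σ_m A(j,m) b_m(2^{-j} λ)`. -/
def scaleSym (A : ℤ × ℤ → ℂ) (j : ℤ) (l : ℝ) : ℂ :=
  ∑' m : ℤ, A (j, m) * chebSym 1 m.natAbs (2 ^ (-j)) l

/-- Coefficients growing at most like `2^{jb}` and rapidly decreasing in `n`. -/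
def IsCoeff (b : ℕ) (A : ℤ × ℤ → ℂ) : Prop :=
  ∀ L : ℕ, ∃ C, 0 ≤ C ∧ ∀ j m : ℤ, ‖A (j, m)‖ ≤ C * ((2 : ℝ) ^ j) ^ b * ((1 + |(m : ℝ)|) ^ L)⁻¹

theorem IsCoeff.sumBdd {b : ℕ} {A : ℤ × ℤ → ℂ} (hA : IsCoeff b A) (j : ℤ) :
    ∃ B, SumBdd (fun m : ℤ => ‖A (j, m)‖) B := by
  obtain ⟨C, hC, h⟩ := hA 2
  obtain ⟨B, hB⟩ := exists_sumBdd_inv_sq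
  exact ⟨_, (hB.const_mul (c := C * ((2 : ℝ) ^ j) ^ b) (by positivity)).mono
    (fun _ => norm_nonneg _) fun m => h j m⟩

theorem IsCoeff.sumBdd_cheb {b : ℕ} {A : ℤ × ℤ → ℂ} (hA : IsCoeff b A) (j : ℤ) :
    ∃ B, ∀ l : ℝ, SumBdd (fun m : ℤ => ‖A (j, m) * chebSym 1 m.natAbs (2 ^ (-j)) l‖) B := by
  obtain ⟨B, hB⟩ := hA.sumBdd j
  refine ⟨B, fun l => hB.mono (fun _ => norm_nonneg _) fun m => ?_⟩
  rw [norm_mul]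
  exact mul_le_of_le_one_right (norm_nonneg _) (norm_chebSym_le _ _ (by positivity) _)

theorem IsCoeff.isBddMeas_scaleSym {b : ℕ} {A : ℤ × ℤ → ℂ} (hA : IsCoeff b A) (j : ℤ)
    (hg : Measurable g) : IsBddMeas fun o => scaleSym A j (g o) := by
  obtain ⟨B, hB⟩ := hA.sumBdd j
  refine isBddMeas_tsum (Q := fun m : ℤ => ‖A (j, m)‖) (fun m =>
    ((isBddMeas_cheb_comp hg 1 m.natAbs j).const_mul _).1) hB.summable fun m o => ?_
  rw [norm_mul]
  exact mul_le_of_le_one_right (norm_nonneg _) (norm_chebSym_le _ _ (by positivity) _)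

/-- The weights decrease in the distance, so their value at r dominates the terms for all pairs at
distance at least r; this gives locally uniform convergence off the diagonal. -/
theorem exists_majorant (hκ : IsKernelFamily U g d κ) (hd : 0 < d) {b : ℕ} {A : ℤ × ℤ → ℂ}
    (hA : IsCoeff b A) {r : ℝ} (hr : 0 < r) : ∃ Q : ℤ × ℤ → ℝ, Summable Q ∧
      ∀ z x y, r ≤ dist x y → ‖A z * κ z.2 z.1 x y‖ ≤ Q z := by
  obtain ⟨L, C', w, hC', h1, h2, h3⟩ := hκ.exists_weight hd b
  obtain ⟨C, hC, h4⟩ := hA L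
  refine ⟨fun z => C * w (r ^ (d + 1)) z, ((h1 _ (by positivity)).summable).mul_left C, ?_⟩
  rintro ⟨j, n⟩ x y hxy
  have hxy' : x ≠ y := dist_pos.1 (hr.trans_le hxy)
  rw [norm_mul]
  have h5 := h3 n j x y hxy'
  have h6 := h2 (r ^ (d + 1)) (dist x y ^ (d + 1)) (j, n) (by positivity) (by gcongr)
  have h7 : 0 < (1 + |(n : ℝ)|) ^ L := by positivity
  calc ‖A (j, n)‖ * ‖κ n j x y‖
      ≤ C * ((2 : ℝ) ^ j) ^ b * ((1 + |(n : ℝ)|) ^ L)⁻¹ * ‖κ n j x y‖ := by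
        gcongr; exact h4 j n
    _ = C * ((1 + |(n : ℝ)|) ^ L)⁻¹ * (((2 : ℝ) ^ j) ^ b * ‖κ n j x y‖) := by ring
    _ ≤ C * ((1 + |(n : ℝ)|) ^ L)⁻¹ * ((1 + |(n : ℝ)|) ^ L * w (dist x y ^ (d + 1)) (j, n)) := by
        gcongr
    _ = C * w (dist x y ^ (d + 1)) (j, n) := by field_simp
    _ ≤ C * w (r ^ (d + 1)) (j, n) := by gcongr

/-- The partial sums over the scales converge locally in `L²` off the diagonal. -/
theorem tendsto_eLpNorm_slice (hκ : IsKernelFamily U g d κ) (hd : 0 < d) (hg : Measurable g)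
    (hμ : IsDoubling μ) {b : ℕ} {A : ℤ × ℤ → ℂ} (hA : IsCoeff b A) (y : X)
    {η : ℤ → Lp ℂ 2 μ} (hη : ∀ j n, (fun x => κ n j x y) =ᵐ[μ]
      specOp U (fun o => chebSym 1 n.natAbs (2 ^ (-j)) (g o)) (η j)) {x₀ : X} {r : ℝ} (hr : 0 < r)
    (hx₀ : 2 * r ≤ dist x₀ y) :
    Tendsto (fun N : ℕ => eLpNorm (fun s => (∑ j ∈ Finset.Icc (-(N : ℤ)) N,
        specOp U (fun o => scaleSym A j (g o)) (η j) : Lp ℂ 2 μ) s -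
        ∑' z : ℤ × ℤ, A z * κ z.2 z.1 s y) 2 (μ.restrict (Metric.ball x₀ r))) atTop (𝓝 0) := by
  obtain ⟨Q, hQ, hQle⟩ := hκ.exists_majorant hd hA hr
  have hball : ∀ s ∈ Metric.ball x₀ r, r ≤ dist s y := fun s hs => by
    have := dist_triangle x₀ s y
    rw [Metric.mem_ball, dist_comm] at hs
    linarith
  have hQ1 : Summable fun j => ∑' m, Q (j, m) := hQ.prod
  set ε : ℕ → ℝ := fun N => ∑' j, ∑' m, Q (j, m) -
    ∑ j ∈ Finset.Icc (-(N : ℤ)) N, ∑' m, Q (j, m) with hε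
  have hεlim : Tendsto ε atTop (𝓝 0) := by
    have h1 : Tendsto (fun N : ℕ => ∑ j ∈ Finset.Icc (-(N : ℤ)) N, ∑' m, Q (j, m)) atTop
        (𝓝 (∑' j, ∑' m, Q (j, m))) := by
      have h2 : Tendsto (fun s : Finset ℤ => ∑ j ∈ s, ∑' m, Q (j, m)) atTop
        (𝓝 (∑' j, ∑' m, Q (j, m))) := hQ1.hasSum
      exact h2.comp Finset.tendsto_Icc_neg
    simpa [hε] using h1.const_sub (∑' j, ∑' m, Q (j, m))
  -- At one scale all slices come from the same vector `η j`, so the sum over m is a bounded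
  -- multiplier applied to it, identified with the pointwise series.
  have hpt : ∀ j, ∀ᵐ s ∂μ, ∀ w, HasSum (fun m : ℤ => A (j, m) * κ m j s y) w →
      specOp U (fun o => scaleSym A j (g o)) (η j) s = w := by
    intro j
    obtain ⟨B, hB⟩ := hA.sumBdd_cheb j
    refine ae_specOp_tsum_eq U (b := fun (m : ℤ) o => A (j, m) * chebSym 1 m.natAbs (2 ^ (-j)) (g o))
      (fun m => (isBddMeas_cheb_comp hg 1 m.natAbs j).const_mul _) (fun o => hB (g o)) (η j)
      fun m => ?_
    rw [specOp_const_mul U (isBddMeas_cheb_comp hg 1 m.natAbs j)]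
    filter_upwards [hη j m, Lp.coeFn_smul (A (j, m))
      (specOp U (fun o => chebSym 1 m.natAbs (2 ^ (-j)) (g o)) (η j))] with s h1 h2
    rw [smul_apply, h2, Pi.smul_apply, smul_eq_mul, ← h1]
  -- On the ball the error is at most the tail of the majorant over |j| > N; the finite measure of
  -- the ball then turns this uniform bound into an L² bound.
  have hbd : ∀ N : ℕ, ∀ᵐ s ∂μ.restrict (Metric.ball x₀ r),
      ‖(∑ j ∈ Finset.Icc (-(N : ℤ)) N,
        specOp U (fun o => scaleSym A j (g o)) (η j) : Lp ℂ 2 μ) s -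
        ∑' z : ℤ × ℤ, A z * κ z.2 z.1 s y‖ ≤ ε N := by
    intro N
    rw [ae_restrict_iff' Metric.isOpen_ball.measurableSet]
    filter_upwards [ae_all_iff.2 hpt, Lp.coeFn_finsetSum (Finset.Icc (-(N : ℤ)) N)
      fun j => specOp U (fun o => scaleSym A j (g o)) (η j)] with s h1 h2 hs
    have h3 : ∀ z : ℤ × ℤ, ‖A z * κ z.2 z.1 s y‖ ≤ Q z := fun z => hQle z s y (hball s hs)
    have h4 : Summable fun z : ℤ × ℤ => A z * κ z.2 z.1 s y := Summable.of_norm_bounded hQ h3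
    have h5 : ∀ j, specOp U (fun o => scaleSym A j (g o)) (η j) s =
        ∑' m : ℤ, A (j, m) * κ m j s y := fun j => h1 j _ (h4.prod_factor j).hasSum
    rw [h2, Finset.sum_apply, h4.tsum_prod, norm_sub_rev]
    simp only [h5]
    exact norm_tsum_sub_sum_le hQ1 (fun j => tsum_of_norm_bounded (hQ.prod_factor j).hasSum
      fun m => h3 (j, m)) _
  have hfin : μ.restrict (Metric.ball x₀ r) univ ≠ ⊤ := by
    rw [Measure.restrict_apply_univ]; exact (hμ.1 x₀ r hr).2.ne
  have hlim : Tendsto (fun N => μ.restrict (Metric.ball x₀ r) univ ^ (2 : ℝ≥0∞).toReal⁻¹ *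
      ENNReal.ofReal (ε N)) atTop (𝓝 0) := by
    have h1 := ENNReal.Tendsto.const_mul (a := μ.restrict (Metric.ball x₀ r) univ ^
      (2 : ℝ≥0∞).toReal⁻¹) (ENNReal.tendsto_ofReal hεlim)
      (Or.inr (ENNReal.rpow_ne_top_of_nonneg (by positivity) hfin))
    simpa using h1
  exact tendsto_of_tendsto_of_tendsto_of_le_of_le tendsto_const_nhds hlim (fun _ => zero_le)
    fun N => eLpNorm_le_of_ae_bound (hbd N)

/-- The approximants are sums over scales |j| ≤ N. Each scale lies in the domain because λ times its
symbol is, up to sign, the bounded symbol built from A'. That relation is assumed for the whole sum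
over n at a scale, not term by term, so only j is truncated. -/
theorem isLocalLaplacian_slice (hκ : IsKernelFamily U g d κ) (hd : 0 < d) (hg : Measurable g)
    (hμ : IsDoubling μ) {Δ : Lp ℂ 2 μ →ₗ.[ℂ] Lp ℂ 2 μ} {E : ProjectionValuedMeasure ℝ (Lp ℂ 2 μ)}
    (hU : Represents U g E) (hE : E.IsSpectralResolution (-Δ)) {b b' : ℕ} {A A' : ℤ × ℤ → ℂ}
    (hA : IsCoeff b A) (hA' : IsCoeff b' A')
    (hAA' : ∀ j l, 0 < l → scaleSym A' j l = -(l * scaleSym A j l)) (y : X) :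
    IsLocalLaplacian Δ {s | s ≠ y} (fun s => ∑' z : ℤ × ℤ, A z * κ z.2 z.1 s y)
      (fun s => ∑' z : ℤ × ℤ, A' z * κ z.2 z.1 s y) := by
  choose η hη using fun j => hκ.slice j y
  have hmul : ∀ j o, (g o : ℂ) * scaleSym A j (g o) = (-1 : ℂ) * scaleSym A' j (g o) := by
    intro j o
    rcases lt_or_ge 0 (g o) with h | h
    · rw [hAA' j _ h]; ring
    · simp [scaleSym, chebSym_of_nonpos _ _ _ h]
  have hb := fun j => hA.isBddMeas_scaleSym j hg
  have hb' := fun j => hA'.isBddMeas_scaleSym j hg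
  have hmem : ∀ j, ∃ hu : specOp U (fun o => scaleSym A j (g o)) (η j) ∈ (-Δ).domain,
      (-Δ) ⟨_, hu⟩ = -specOp U (fun o => scaleSym A' j (g o)) (η j) := by
    intro j
    have h1 : (fun o => (g o : ℂ) * scaleSym A j (g o)) =
        fun o => (-1 : ℂ) * scaleSym A' j (g o) := funext (hmul j)
    obtain ⟨hu, h2⟩ := hU.specOp_mem_domain hg hE (hb j) (h1 ▸ (hb' j).const_mul (-1)) (η j)
    refine ⟨hu, ?_⟩
    rw [h2, h1, specOp_const_mul U (hb' j)]
    simp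
  choose hu hΔ using hmem
  let f : ℤ → Δ.domain := fun j => ⟨specOp U (fun o => scaleSym A j (g o)) (η j), hu j⟩
  have hf : ∀ j, Δ (f j) = specOp U (fun o => scaleSym A' j (g o)) (η j) := fun j =>
    neg_injective (hΔ j)
  refine ⟨fun N => ∑ j ∈ Finset.Icc (-(N : ℤ)) N, f j, fun x hx => ?_⟩
  have hr : 0 < dist x y / 2 := half_pos (dist_pos.2 hx)
  have h1 := hκ.tendsto_eLpNorm_slice hd hg hμ hA y hη (x₀ := x) hr (by linarith)
  have h2 := hκ.tendsto_eLpNorm_slice hd hg hμ hA' y hη (x₀ := x) hr (by linarith)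
  refine ⟨Metric.ball x (dist x y / 2), Metric.ball_mem_nhds x hr, ?_, ?_⟩
  · have h3 : ∀ N : ℕ, ((∑ j ∈ Finset.Icc (-(N : ℤ)) N, f j : Δ.domain) : Lp ℂ 2 μ) =
        ∑ j ∈ Finset.Icc (-(N : ℤ)) N, specOp U (fun o => scaleSym A j (g o)) (η j) := fun N => by
      rw [Submodule.coe_sum]
    simpa only [h3] using h1
  · have h3 : ∀ N : ℕ, Δ (∑ j ∈ Finset.Icc (-(N : ℤ)) N, f j) =
        ∑ j ∈ Finset.Icc (-(N : ℤ)) N, specOp U (fun o => scaleSym A' j (g o)) (η j) := fun N => by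
      have : Δ (∑ j ∈ Finset.Icc (-(N : ℤ)) N, f j) = Δ.toFun (∑ j ∈ Finset.Icc (-(N : ℤ)) N, f j) :=
        rfl
      rw [this, map_sum]
      exact Finset.sum_congr rfl fun j _ => hf j
    simpa only [h3] using h2

end IsKernelFamily

/-! ### Tensor products of operators with kernels -/

section TensorKernel

variable {N : ℕ} {X : Fin N → Type*} [∀ k, MeasurableSpace (X k)] {μ : ∀ k, Measure (X k)}
  [∀ k, SigmaFinite (μ k)]

/-- On tensors the formula is Fubini. The slices are in L², so for fixed x the integral is a
continuous functional of u, and density extends the formula. -/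
theorem hasKernel_tensor {S : ∀ k, Lp ℂ 2 (μ k) →L[ℂ] Lp ℂ 2 (μ k)} {κ : ∀ k, X k → X k → ℂ}
    (hS : ∀ k, HasKernel (S k) (κ k)) (hκ : ∀ k x, MemLp (κ k x) 2 (μ k))
    {T : Lp ℂ 2 (Measure.pi μ) →L[ℂ] Lp ℂ 2 (Measure.pi μ)}
    (hT : ∀ u : ∀ k, Lp ℂ 2 (μ k), T (tensorLp u) = tensorLp fun k => S k (u k)) :
    HasKernel T fun x y => ∏ k, κ k (x k) (y k) := by
  have hκm : ∀ k x, Measurable (κ k x) := fun k x => (hS k).1.comp measurable_prodMk_left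
  have hmem : ∀ x : ∀ k, X k, MemLp (fun y : ∀ k, X k => ∏ k, κ k (x k) (y k)) 2
      (Measure.pi μ) := fun x => memLp_tensor (fun k => hκm k (x k)) fun k => hκ k (x k)
  have hmem' : ∀ x : ∀ k, X k, MemLp (fun y : ∀ k, X k => (starRingEnd ℂ) (∏ k, κ k (x k) (y k))) 2
      (Measure.pi μ) := fun x => (hmem x).star
  have hint : ∀ (x : ∀ k, X k) (u : Lp ℂ 2 (Measure.pi μ)),
      Integrable (fun y : ∀ k, X k => (∏ k, κ k (x k) (y k)) * u y) (Measure.pi μ) :=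
    fun x u => (hmem x).integrable_mul (Lp.memLp u)
  have hinner : ∀ x (u : Lp ℂ 2 (Measure.pi μ)), inner ℂ ((hmem' x).toLp _) u =
      ∫ y : ∀ k, X k, (∏ k, κ k (x k) (y k)) * u y ∂(Measure.pi μ) := by
    intro x u
    rw [L2_inner_eq]
    refine integral_congr_ae ?_
    filter_upwards [(hmem' x).coeFn_toLp] with y hy
    rw [hy, Complex.conj_conj]
  refine ⟨?_, fun u => ?_⟩
  · refine Finset.measurable_prod _ fun k _ => ?_
    exact (hS k).1.comp (f := fun z : (∀ k, X k) × (∀ k, X k) => (z.1 k, z.2 k)) (by fun_prop)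
  suffices h : ∀ᵐ x ∂(Measure.pi μ), T u x = inner ℂ ((hmem' x).toLp _) u by
    filter_upwards [h] with x hx
    exact ⟨hint x u, hx.trans (hinner x u)⟩
  have hspan : ∀ u ∈ Submodule.span ℂ (Set.range (tensorLp (μ := μ))),
      ∀ᵐ x ∂(Measure.pi μ), T u x = inner ℂ ((hmem' x).toLp _) u := by
    intro u hu
    induction hu using Submodule.span_induction with
    | mem u hu =>
      obtain ⟨v, rfl⟩ := hu
      rw [hT]
      filter_upwards [tensorLp_coe fun k => S k (v k), ae_pi_forall_of_ae fun k => (hS k).2 (v k)]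
        with x h1 h2
      rw [h1, hinner]
      have h3 : ∫ y : ∀ k, X k, (∏ k, κ k (x k) (y k)) * tensorLp v y ∂(Measure.pi μ) =
          ∫ y : ∀ k, X k, ∏ k, κ k (x k) (y k) * v k (y k) ∂(Measure.pi μ) := by
        refine integral_congr_ae ?_
        filter_upwards [tensorLp_coe v] with y hy
        rw [hy, Finset.prod_mul_distrib]
      rw [h3, integral_fintype_prod_eq_prod (𝕜 := ℂ) (μ := μ)
        (fun k y => κ k (x k) y * v k y)]
      exact Finset.prod_congr rfl fun k _ => (h2 k).2
    | zero =>
      filter_upwards [Lp.coeFn_zero ℂ 2 (Measure.pi μ)] with x hx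
      rw [map_zero, hx, inner_zero_right]
      rfl
    | add u v _ _ hu hv =>
      filter_upwards [hu, hv, Lp.coeFn_add (T u) (T v)] with x h1 h2 h3
      rw [map_add, h3, Pi.add_apply, h1, h2, inner_add_right]
    | smul c u _ hu =>
      filter_upwards [hu, Lp.coeFn_smul c (T u)] with x h1 h3
      rw [map_smul, h3, Pi.smul_apply, h1, inner_smul_right, smul_eq_mul]
  -- Approximation by a sequence keeps the exceptional null sets countable; a subsequence of the
  -- images converges almost everywhere.
  have hu : u ∈ (Submodule.span ℂ (Set.range (tensorLp (μ := μ)))).topologicalClosure := by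
    rw [dense_span_of_orthogonal _ eq_zero_of_inner_tensorLp]
    trivial
  rw [← SetLike.mem_coe, Submodule.topologicalClosure_coe, mem_closure_iff_seq_limit] at hu
  obtain ⟨v, hv, hlim⟩ := hu
  obtain ⟨ns, h1, h2⟩ := exists_seq_tendsto_ae_of_tendsto_Lp ((T.continuous.tendsto u).comp hlim)
  filter_upwards [h2, ae_all_iff.2 fun n => hspan (v n) (hv n)] with x h3 h4
  refine tendsto_nhds_unique h3 ?_
  simp only [Function.comp_apply, h4]
  exact (tendsto_const_nhds.inner hlim).comp h1

end TensorKernel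

/-! ### The kernel of a multiplier on a product space -/

section ProductKernel

variable {N : ℕ} {X : Fin N → Type*}

/-- The product `∏ 2^{j_k a_k} κ_{n_k, j_k}(x_k, y_k)`. -/
def prodKernel (κ : ∀ k, ℤ → ℤ → X k → X k → ℂ) (a : Fin N → ℕ) (z : Fin N → ℤ × ℤ)
    (x y : ∀ k, X k) : ℂ :=
  ∏ k, (((2 : ℝ) ^ (z k).1 : ℝ) : ℂ) ^ a k * κ k (z k).2 (z k).1 (x k) (y k)

open Classical in
/-- The kernel of `(-1)^{|a|} λ^a p(λ)` off the diagonal. -/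
def derivKernel (p : (Fin N → ℝ) → ℂ) (κ : ∀ k, ℤ → ℤ → X k → X k → ℂ) (a : Fin N → ℕ)
    (x y : ∀ k, X k) : ℂ :=
  if OffDiag x y then (-1) ^ (∑ k, a k) * ∑' z, symCoeff p a z * prodKernel κ a z x y else 0

theorem OffDiag.symm {x y : ∀ k, X k} (h : OffDiag x y) : OffDiag y x := fun k => (h k).symm

variable [∀ k, MetricSpace (X k)] [∀ k, MeasurableSpace (X k)] [∀ k, BorelSpace (X k)]
  {Ω : Fin N → Type*} [∀ k, MeasurableSpace (Ω k)] {ν : ∀ k, Measure (Ω k)}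
  {μ : ∀ k, Measure (X k)} {U : ∀ k, Lp ℂ 2 (ν k) ≃ₗᵢ[ℂ] Lp ℂ 2 (μ k)} {g : ∀ k, Ω k → ℝ}
  {d : Fin N → ℝ} {κ : ∀ k, ℤ → ℤ → X k → X k → ℂ} {p : (Fin N → ℝ) → ℂ}

theorem prodKernel_comm (hκ : ∀ k, IsKernelFamily (U k) (g k) (d k) (κ k)) (a : Fin N → ℕ)
    (z : Fin N → ℤ × ℤ) (x y : ∀ k, X k) : prodKernel κ a z x y = prodKernel κ a z y x :=
  Finset.prod_congr rfl fun k _ => by rw [(hκ k).symm]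

theorem derivKernel_comm (hκ : ∀ k, IsKernelFamily (U k) (g k) (d k) (κ k)) (a : Fin N → ℕ)
    (x y : ∀ k, X k) : derivKernel p κ a x y = derivKernel p κ a y x := by
  by_cases h : OffDiag x y
  · simp only [derivKernel, if_pos h, if_pos h.symm, prodKernel_comm hκ a _ x y]
  · rw [derivKernel, derivKernel, if_neg h, if_neg fun h' => h h'.symm]

theorem measurable_prodKernel (hκ : ∀ k, IsKernelFamily (U k) (g k) (d k) (κ k))
    (a : Fin N → ℕ) (z : Fin N → ℤ × ℤ) :
    Measurable fun q : (∀ k, X k) × (∀ k, X k) => prodKernel κ a z q.1 q.2 := by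
  refine Finset.measurable_prod _ fun k _ => Measurable.const_mul ?_ _
  exact ((hκ k).measurable (z k).2 (z k).1).comp
    (f := fun q : (∀ k, X k) × (∀ k, X k) => (q.1 k, q.2 k)) (by fun_prop)

/-- A bound for the terms of the series in `prodKernel`, over any set of coordinates. -/
theorem exists_prod_bound (hκ : ∀ k, IsKernelFamily (U k) (g k) (d k) (κ k)) (hd : ∀ k, 0 < d k)
    (a : Fin N → ℕ) : ∃ (L : ℕ) (w : ∀ _ : Fin N, ℝ → ℤ × ℤ → ℝ) (C : Fin N → ℝ),
      (∀ k, 0 ≤ C k) ∧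
      (∀ k ρ, 0 < ρ → SumBdd (w k ρ) (C k * ρ ^ (-(a k + d k / (d k + 1))))) ∧
      ∀ k (z : ℤ × ℤ) (x y : X k), x ≠ y →
        ‖(((2 : ℝ) ^ z.1 : ℝ) : ℂ) ^ a k * κ k z.2 z.1 x y‖ ≤
          (1 + |(z.2 : ℝ)|) ^ L * w k (dist x y ^ (d k + 1)) z := by
  choose A C w hC h1 _ h3 using fun k => (hκ k).exists_weight (hd k) (a k)
  refine ⟨Finset.univ.sup A, w, C, hC, h1, fun k z x y hxy => ?_⟩
  have h4 := h3 k z.2 z.1 x y hxy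
  have h5 := (h1 k _ (Real.rpow_pos_of_pos (dist_pos.2 hxy) (d k + 1))).1 z
  rw [norm_mul, norm_pow, Complex.norm_real, Real.norm_of_nonneg (by positivity)]
  refine h4.trans (mul_le_mul_of_nonneg_right ?_ h5)
  exact pow_le_pow_right₀ (by linarith [abs_nonneg (z.2 : ℝ)])
    (Finset.le_sup (f := A) (Finset.mem_univ k))

/-- The coefficients decay to the same order L to which the kernels grow in n, so these powers
cancel and the product of the one-variable weights remains. -/
theorem exists_sumBdd_prodKernel (hκ : ∀ k, IsKernelFamily (U k) (g k) (d k) (κ k))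
    (hd : ∀ k, 0 < d k) (hp : IsSymbolZero p) (a : Fin N → ℕ) :
    ∃ C, 0 ≤ C ∧ ∀ x y : ∀ k, X k, OffDiag x y →
      SumBdd (fun z => ‖symCoeff p a z * prodKernel κ a z x y‖)
        (C * ∏ k, (dist (x k) (y k) ^ (d k + 1)) ^ (-(a k + d k / (d k + 1)))) := by
  obtain ⟨L, w, B, hB, h1, h2⟩ := exists_prod_bound hκ hd a
  obtain ⟨C, hC, h3⟩ := exists_norm_symCoeff_le hp a L
  refine ⟨C * ∏ k, B k, mul_nonneg hC (Finset.prod_nonneg fun k _ => hB k), fun x y hxy => ?_⟩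
  have hρ : ∀ k, 0 < dist (x k) (y k) ^ (d k + 1) := fun k =>
    Real.rpow_pos_of_pos (dist_pos.2 (hxy k)) _
  have h4 := (SumBdd.pi fun k => h1 k _ (hρ k)).const_mul hC
  rw [Finset.prod_mul_distrib, ← mul_assoc] at h4
  refine h4.mono (fun _ => norm_nonneg _) fun z => ?_
  rw [norm_mul, prodKernel, norm_prod]
  have h5 : ∏ k, ‖(((2 : ℝ) ^ (z k).1 : ℝ) : ℂ) ^ a k * κ k (z k).2 (z k).1 (x k) (y k)‖ ≤
      ∏ k, ((1 + |((z k).2 : ℝ)|) ^ L * w k (dist (x k) (y k) ^ (d k + 1)) (z k)) :=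
    Finset.prod_le_prod (fun _ _ => norm_nonneg _) fun k _ => h2 k (z k) _ _ (hxy k)
  refine (mul_le_mul (h3 z) h5 (Finset.prod_nonneg fun _ _ => norm_nonneg _)
    (by positivity)).trans (le_of_eq ?_)
  rw [mul_assoc, ← Finset.prod_mul_distrib]
  congr 1
  refine Finset.prod_congr rfl fun k _ => ?_
  have : (1 + |((z k).2 : ℝ)|) ^ L ≠ 0 := by positivity
  field_simp

theorem measurableSet_offDiag [∀ k, SecondCountableTopology (X k)] :
    MeasurableSet {q : (∀ k, X k) × (∀ k, X k) | OffDiag q.1 q.2} := by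
  have : {q : (∀ k, X k) × (∀ k, X k) | OffDiag q.1 q.2} =
      ⋂ k, {q | q.1 k = q.2 k}ᶜ := by ext; simp [OffDiag]
  rw [this]
  exact MeasurableSet.iInter fun k => (measurableSet_eq_fun (by fun_prop) (by fun_prop)).compl

theorem measurable_derivKernel [∀ k, SecondCountableTopology (X k)]
    (hκ : ∀ k, IsKernelFamily (U k) (g k) (d k) (κ k)) (hd : ∀ k, 0 < d k) (hp : IsSymbolZero p)
    (a : Fin N → ℕ) : Measurable fun q : (∀ k, X k) × (∀ k, X k) => derivKernel p κ a q.1 q.2 := by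
  obtain ⟨C, _, hC⟩ := exists_sumBdd_prodKernel hκ hd hp a
  -- Moving the cutoff inside the series makes it summable at every point, so the sum is a pointwise
  -- limit of measurable functions.
  have h1 : (fun q : (∀ k, X k) × (∀ k, X k) => derivKernel p κ a q.1 q.2) = fun q =>
      (-1) ^ (∑ k, a k) * ∑' z, {q : (∀ k, X k) × (∀ k, X k) | OffDiag q.1 q.2}.indicator
        (fun q => symCoeff p a z * prodKernel κ a z q.1 q.2) q := by
    ext q
    by_cases h : OffDiag q.1 q.2
    · rw [derivKernel, if_pos h]
      congr 2
      ext z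
      rw [indicator_of_mem (show q ∈ {q : (∀ k, X k) × (∀ k, X k) | OffDiag q.1 q.2} from h)]
    · rw [derivKernel, if_neg h]
      have : ∀ z, {q : (∀ k, X k) × (∀ k, X k) | OffDiag q.1 q.2}.indicator
        (fun q => symCoeff p a z * prodKernel κ a z q.1 q.2) q = 0 := fun z =>
          indicator_of_notMem h _
      simp [this]
  rw [h1]
  refine (measurable_tsum_of_summable (fun z => ((measurable_prodKernel hκ a z).const_mul _).indicator
    measurableSet_offDiag) fun q => ?_).const_mul _
  by_cases h : OffDiag q.1 q.2
  · have h2 := (hC q.1 q.2 h).summable.of_norm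
    refine h2.congr fun z => ?_
    rw [indicator_of_mem (show q ∈ {q : (∀ k, X k) × (∀ k, X k) | OffDiag q.1 q.2} from h)]
  · have : ∀ z, {q : (∀ k, X k) × (∀ k, X k) | OffDiag q.1 q.2}.indicator
        (fun q => symCoeff p a z * prodKernel κ a z q.1 q.2) q = 0 := fun z =>
          indicator_of_notMem h _
    simpa only [this] using summable_zero

theorem norm_derivKernel_le {x y : ∀ k, X k} (h : OffDiag x y) {a : Fin N → ℕ} {B : ℝ}
    (hB : SumBdd (fun z => ‖symCoeff p a z * prodKernel κ a z x y‖) B) :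
    ‖derivKernel p κ a x y‖ ≤ B := by
  rw [derivKernel, if_pos h, norm_mul, norm_pow, norm_neg, norm_one, one_pow, one_mul]
  exact (norm_tsum_le_tsum_norm hB.summable).trans hB.tsum_le

/-- (d+1)(m + d/(d+1)) = m(d+1) + d: this translates the dyadic bound into the powers of the
distance in the theorem. -/
theorem rpow_weight {r : ℝ} (hr : 0 < r) {d : ℝ} (hd : 0 < d) (m : ℕ) :
    (r ^ (d + 1)) ^ (-(m + d / (d + 1))) = r ^ (-((m : ℝ) * (d + 1))) * r ^ (-d) := by
  rw [← Real.rpow_mul hr.le, ← Real.rpow_add hr]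
  congr 1
  field_simp
  ring

theorem exists_norm_derivKernel_le (hκ : ∀ k, IsKernelFamily (U k) (g k) (d k) (κ k))
    (hd : ∀ k, 0 < d k) (hp : IsSymbolZero p) (a : Fin N → ℕ) :
    ∃ C, 0 ≤ C ∧ ∀ x y : ∀ k, X k, OffDiag x y → ‖derivKernel p κ a x y‖ ≤
      C * ((∏ k, dist (x k) (y k) ^ (-((a k : ℝ) * (d k + 1)))) *
        ∏ k, dist (x k) (y k) ^ (-d k)) := by
  obtain ⟨C, hC0, hC⟩ := exists_sumBdd_prodKernel hκ hd hp a
  refine ⟨C, hC0, fun x y hxy => (norm_derivKernel_le hxy (hC x y hxy)).trans (le_of_eq ?_)⟩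
  rw [← Finset.prod_mul_distrib]
  congr 1
  exact Finset.prod_congr rfl fun k _ => rpow_weight (dist_pos.2 (hxy k)) (hd k) (a k)

theorem exists_norm_derivKernel_single_le (hκ : ∀ k, IsKernelFamily (U k) (g k) (d k) (κ k))
    (hd : ∀ k, 0 < d k) (hp : IsSymbolZero p) (i j : Fin N) (β₁ β₂ : ℕ) :
    ∃ C, ∀ x y : ∀ k, X k, OffDiag x y →
      ‖derivKernel p κ (Pi.single i β₁ + Pi.single j β₂) x y‖ ≤
        C * dist (x i) (y i) ^ (-((β₁ : ℝ) * (d i + 1))) *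
          dist (x j) (y j) ^ (-((β₂ : ℝ) * (d j + 1))) * ∏ k, dist (x k) (y k) ^ (-d k) := by
  obtain ⟨C, hC0, hC⟩ := exists_norm_derivKernel_le hκ hd hp (Pi.single i β₁ + Pi.single j β₂)
  refine ⟨C, fun x y hxy => (hC x y hxy).trans (le_of_eq ?_)⟩
  have h1 : ∀ (i : Fin N) (β : ℕ),
      ∏ k, dist (x k) (y k) ^ (-(((Pi.single i β : Fin N → ℕ) k : ℝ) * (d k + 1))) =
        dist (x i) (y i) ^ (-((β : ℝ) * (d i + 1))) := by
    intro i β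
    rw [Finset.prod_eq_single i (fun k _ hk => by simp [hk]) (by simp)]
    simp
  have h2 : ∏ k, dist (x k) (y k) ^
      (-(((Pi.single i β₁ + Pi.single j β₂ : Fin N → ℕ) k : ℝ) * (d k + 1))) =
      dist (x i) (y i) ^ (-((β₁ : ℝ) * (d i + 1))) *
        dist (x j) (y j) ^ (-((β₂ : ℝ) * (d j + 1))) := by
    rw [← h1 i β₁, ← h1 j β₂, ← Finset.prod_mul_distrib]
    refine Finset.prod_congr rfl fun k _ => ?_
    rw [← Real.rpow_add (dist_pos.2 (hxy k))]
    congr 1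
    simp only [Pi.add_apply]
    push_cast
    ring
  rw [h2]
  ring
end ProductKernel

/-! ### The multiplier as an integral operator off the diagonal -/

section OffDiagKernel

variable {N : ℕ} {X : Fin N → Type*} [∀ k, MetricSpace (X k)] [∀ k, MeasurableSpace (X k)]
  [∀ k, BorelSpace (X k)] {Ω : Fin N → Type*} [∀ k, MeasurableSpace (Ω k)]
  {ν : ∀ k, Measure (Ω k)} {μ : ∀ k, Measure (X k)}
  {U : ∀ k, Lp ℂ 2 (ν k) ≃ₗᵢ[ℂ] Lp ℂ 2 (μ k)} {g : ∀ k, Ω k → ℝ}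
  {d : Fin N → ℝ} {κ : ∀ k, ℤ → ℤ → X k → X k → ℂ} {p : (Fin N → ℝ) → ℂ}

/-- The terms of the expansion of the symbol `p` in the spectral representation. -/
def symTerm (p : (Fin N → ℝ) → ℂ) (g : ∀ k, Ω k → ℝ) (z : Fin N → ℤ × ℤ) (o : ∀ k, Ω k) : ℂ :=
  symCoeff p 0 z * ∏ k, chebSym 2 (z k).2.natAbs (2 ^ (-(z k).1)) (g k (o k))

theorem isBddMeas_prod_chebSym (hg : ∀ k, Measurable (g k)) (z : Fin N → ℤ × ℤ) :
    IsBddMeas fun o : ∀ k, Ω k => ∏ k, chebSym 2 (z k).2.natAbs (2 ^ (-(z k).1)) (g k (o k)) :=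
  IsBddMeas.prod fun k _ => (isBddMeas_chebSym 2 (z k).2.natAbs (by positivity)).comp
    ((hg k).comp (measurable_pi_apply k))

theorem isBddMeas_symTerm (hg : ∀ k, Measurable (g k)) (z : Fin N → ℤ × ℤ) :
    IsBddMeas (symTerm p g z) := (isBddMeas_prod_chebSym hg z).const_mul _

theorem exists_sumBdd_symTerm (hp : IsSymbolZero p) (g : ∀ k, Ω k → ℝ) :
    ∃ B, ∀ o, SumBdd (fun z => ‖symTerm p g z o‖) B := by
  obtain ⟨B, hB⟩ := exists_sumBdd_symCoeff hp
  exact ⟨B, fun o => hB fun k => g k (o k)⟩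

theorem tsum_symTerm (hp : IsSymbolZero p) (g : ∀ k, Ω k → ℝ) (o : ∀ k, Ω k) :
    ∑' z, symTerm p g z o = (posOrthant N).indicator p fun k => g k (o k) := by
  by_cases h : (fun k => g k (o k)) ∈ posOrthant N
  · rw [indicator_of_mem h]
    exact (hasSum_symCoeff hp h).tsum_eq
  · rw [indicator_of_notMem h]
    obtain ⟨k, hk⟩ := not_forall.1 h
    have : ∀ z, symTerm p g z o = 0 := fun z => by
      rw [symTerm, Finset.prod_eq_zero (Finset.mem_univ k)
        (chebSym_of_nonpos _ _ _ (not_lt.1 hk)), mul_zero]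
    simp [this]

variable [∀ k, SigmaFinite (ν k)] [∀ k, SigmaFinite (μ k)]
  {V : Lp ℂ 2 (Measure.pi ν) ≃ₗᵢ[ℂ] Lp ℂ 2 (Measure.pi μ)}

theorem hasKernel_symTerm (hκ : ∀ k, IsKernelFamily (U k) (g k) (d k) (κ k))
    (hg : ∀ k, Measurable (g k))
    (hV : ∀ f : ∀ k, Lp ℂ 2 (ν k), V (tensorLp f) = tensorLp fun k => U k (f k))
    (z : Fin N → ℤ × ℤ) : HasKernel (specOp V (symTerm p g z))
      fun x y => symCoeff p 0 z * prodKernel κ 0 z x y := by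
  have h1 := hasKernel_tensor (fun k => (hκ k).hasKernel (z k).2 (z k).1)
    (fun k x => (hκ k).memLp _ _ x) (specOp_tensorLp hV fun k =>
      (isBddMeas_chebSym 2 (z k).2.natAbs (by positivity)).comp (hg k))
  have h2 := h1.const_smul (symCoeff p 0 z)
  rw [← specOp_const_mul V (isBddMeas_prod_chebSym hg z)] at h2
  have h3 : ∀ x y, prodKernel κ 0 z x y = ∏ k, κ k (z k).2 (z k).1 (x k) (y k) :=
    fun x y => by simp [prodKernel]
  simp only [h3]
  exact h2

/-- The partial sums are operators with explicit kernels and converge strongly, hence almost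
everywhere along a subsequence. At positive distance from the support of u their kernels are
uniformly bounded, so integrability of u gives dominated convergence. -/
theorem hasOffDiagKernel_derivKernel [∀ k, SecondCountableTopology (X k)]
    (hκ : ∀ k, IsKernelFamily (U k) (g k) (d k) (κ k)) (hg : ∀ k, Measurable (g k))
    (hd : ∀ k, 0 < d k) (hp : IsSymbolZero p)
    (hV : ∀ f : ∀ k, Lp ℂ 2 (ν k), V (tensorLp f) = tensorLp fun k => U k (f k)) :
    HasOffDiagKernel (specOp V fun o => ∑' z, symTerm p g z o) (derivKernel p κ 0) := by
  have hKm := measurable_derivKernel hκ hd hp 0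
  refine ⟨hKm, fun u hu => ?_⟩
  obtain ⟨B, hB⟩ := exists_sumBdd_symTerm hp g
  obtain ⟨C, hC0, hC⟩ := exists_sumBdd_prodKernel hκ hd hp 0
  obtain ⟨ns, h1, h2⟩ := exists_seq_tendsto_ae_of_tendsto_Lp
    (tendsto_specOp_sum V (fun z => isBddMeas_symTerm (p := p) hg z) hB u)
  have h3 := fun F : Finset (Fin N → ℤ × ℤ) =>
    (HasKernel.sum (s := F) fun z _ => hasKernel_symTerm (p := p) hκ hg hV z).2 u
  filter_upwards [h2, ae_all_iff.2 h3] with x h4 h5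
  rintro ⟨ε, hε, hx⟩
  -- The off-diagonal bound evaluated at distance ε in every coordinate; the exponents are negative,
  -- so larger distances only improve it.
  set B' := C * ∏ k, (ε ^ (d k + 1)) ^ (-(((0 : Fin N → ℕ) k : ℝ) + d k / (d k + 1))) with hB'
  have hoff : ∀ᵐ y ∂(Measure.pi μ), u y ≠ 0 → OffDiag x y ∧
      SumBdd (fun z => ‖symCoeff p 0 z * prodKernel κ 0 z x y‖) B' := by
    filter_upwards [hx] with y hy huy
    have hxy : OffDiag x y := fun k => dist_pos.1 (hε.trans_le (hy huy k))
    refine ⟨hxy, (hC x y hxy).mono_right (mul_le_mul_of_nonneg_left ?_ hC0)⟩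
    refine Finset.prod_le_prod (fun k _ => by positivity) fun k _ => ?_
    have := hd k
    refine Real.rpow_le_rpow_of_nonpos (by positivity) ?_ ?_
    · exact Real.rpow_le_rpow hε.le (hy huy k) (by positivity)
    · have : 0 ≤ d k / (d k + 1) := by positivity
      simpa using this
  have hKx : Measurable fun y => derivKernel p κ 0 x y := hKm.comp measurable_prodMk_left
  have hint : Integrable (fun y => derivKernel p κ 0 x y * u y) (Measure.pi μ) := by
    refine (hu.norm.const_mul B').mono' (hKx.aestronglyMeasurable.mul hu.1) ?_
    filter_upwards [hoff] with y hy
    rw [norm_mul]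
    by_cases huy : u y = 0
    · simp [huy]
    · exact mul_le_mul_of_nonneg_right (norm_derivKernel_le (hy huy).1 (hy huy).2) (norm_nonneg _)
  refine ⟨hint, ?_⟩
  refine tendsto_nhds_unique h4 ?_
  have h6 : ∀ n, (∑ z ∈ ns n, specOp V (symTerm p g z) u : Lp ℂ 2 (Measure.pi μ)) x =
      ∫ y, (∑ z ∈ ns n, symCoeff p 0 z * prodKernel κ 0 z x y) * u y ∂(Measure.pi μ) := fun n => by
    rw [← (h5 (ns n)).2, sum_apply]
  simp only [h6]
  refine tendsto_integral_of_dominated_convergence (fun y => B' * ‖u y‖) (fun n => ?_)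
    (hu.norm.const_mul B') (fun n => ?_) ?_
  · refine AEStronglyMeasurable.mul ?_ hu.1
    exact (Finset.measurable_sum _ fun z _ => ((measurable_prodKernel hκ 0 z).comp
      measurable_prodMk_left).const_mul _).aestronglyMeasurable
  · filter_upwards [hoff] with y hy
    rw [norm_mul]
    by_cases huy : u y = 0
    · simp [huy]
    · exact mul_le_mul_of_nonneg_right ((norm_sum_le _ _).trans ((hy huy).2.2 _)) (norm_nonneg _)
  · filter_upwards [hoff] with y hy
    by_cases huy : u y = 0
    · simp [huy]
    · refine Tendsto.mul_const _ ?_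
      have h7 : Tendsto (fun F : Finset (Fin N → ℤ × ℤ) =>
          ∑ z ∈ F, symCoeff p 0 z * prodKernel κ 0 z x y) atTop
          (𝓝 (∑' z, symCoeff p 0 z * prodKernel κ 0 z x y)) :=
        (hy huy).2.summable.of_norm.hasSum
      have h8 : derivKernel p κ 0 x y = ∑' z, symCoeff p 0 z * prodKernel κ 0 z x y := by
        rw [derivKernel, if_pos (hy huy).1]; simp
      rw [h8]
      exact h7.comp h1

end OffDiagKernel

/-! ### The kernel as a function of one variable -/

section Slice

theorem IsLocalLaplacian.congr {X : Type*} [MetricSpace X] [MeasurableSpace X] [BorelSpace X]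
    {μ : Measure X} {Δ : Lp ℂ 2 μ →ₗ.[ℂ] Lp ℂ 2 μ} {S : Set X} {f f' g g' : X → ℂ}
    (h : IsLocalLaplacian Δ S f g) (hS : IsOpen S) (hf : EqOn f f' S) (hg : EqOn g g' S) :
    IsLocalLaplacian Δ S f' g' := by
  obtain ⟨F, hF⟩ := h
  refine ⟨F, fun x hx => ?_⟩
  obtain ⟨W, hW, h1, h2⟩ := hF x hx
  have key : ∀ (v : ℕ → Lp ℂ 2 μ) {f f' : X → ℂ}, EqOn f f' S →
      Tendsto (fun n => eLpNorm (fun s => v n s - f s) 2 (μ.restrict W)) atTop (𝓝 0) →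
      Tendsto (fun n => eLpNorm (fun s => v n s - f' s) 2 (μ.restrict (W ∩ S))) atTop (𝓝 0) := by
    intro v f f' hff h
    refine tendsto_of_tendsto_of_tendsto_of_le_of_le tendsto_const_nhds h (fun _ => zero_le)
      fun n => ?_
    have h3 : (fun s => v n s - f' s) =ᵐ[μ.restrict (W ∩ S)] fun s => v n s - f s := by
      have h4 : ∀ᵐ s ∂μ.restrict (W ∩ S), s ∈ S :=
        ae_restrict_of_ae_restrict_of_subset inter_subset_right (ae_restrict_mem hS.measurableSet)
      filter_upwards [h4] with s hs
      rw [hff hs]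
    simp only [eLpNorm_congr_ae h3]
    exact eLpNorm_mono_measure _ (Measure.restrict_mono inter_subset_left le_rfl)
  exact ⟨W ∩ S, inter_mem hW (hS.mem_nhds hx), key _ hf h1, key _ hg h2⟩

variable {N : ℕ}

/-- The index with `i`-th component `q` and other components `z`. -/
def joinIdx (i : Fin N) (q : ℤ × ℤ) (z : {k // k ≠ i} → ℤ × ℤ) : Fin N → ℤ × ℤ :=
  (Equiv.funSplitAt i (ℤ × ℤ)).symm (q, z)

@[simp] theorem joinIdx_self (i : Fin N) (q : ℤ × ℤ) (z : {k // k ≠ i} → ℤ × ℤ) :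
    joinIdx i q z i = q := by simp [joinIdx, Equiv.funSplitAt, Equiv.piSplitAt]

@[simp] theorem joinIdx_ne (i : Fin N) (q : ℤ × ℤ) (z : {k // k ≠ i} → ℤ × ℤ) (k : {k // k ≠ i}) :
    joinIdx i q z k = z k := by simp [joinIdx, Equiv.funSplitAt, Equiv.piSplitAt, k.2]

theorem update_joinIdx (i : Fin N) (q q' : ℤ × ℤ) (z : {k // k ≠ i} → ℤ × ℤ) :
    Function.update (joinIdx i q z) i q' = joinIdx i q' z := by
  ext1 k
  rcases eq_or_ne k i with rfl | hk
  · simp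
  · rw [Function.update_of_ne hk, joinIdx_ne i q z ⟨k, hk⟩, joinIdx_ne i q' z ⟨k, hk⟩]

variable {X : Fin N → Type*}

/-- The factors of `prodKernel` for the variables other than the `i`-th one. -/
def restKernel (κ : ∀ k, ℤ → ℤ → X k → X k → ℂ) (a : Fin N → ℕ) (i : Fin N)
    (z : {k // k ≠ i} → ℤ × ℤ) (x y : ∀ k, X k) : ℂ :=
  ∏ k : {k // k ≠ i}, (((2 : ℝ) ^ (z k).1 : ℝ) : ℂ) ^ a k *
    κ k (z k).2 (z k).1 (x k) (y k)

/-- The coefficients of the kernel as a function of the `i`-th variable. -/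
def lineCoeff (p : (Fin N → ℝ) → ℂ) (κ : ∀ k, ℤ → ℤ → X k → X k → ℂ) (a : Fin N → ℕ) (i : Fin N)
    (x y : ∀ k, X k) (q : ℤ × ℤ) : ℂ :=
  (-1) ^ (∑ k, a k) * ((((2 : ℝ) ^ q.1 : ℝ) : ℂ) ^ a i *
    ∑' z, symCoeff p a (joinIdx i q z) * restKernel κ a i z x y)

theorem prodKernel_joinIdx (κ : ∀ k, ℤ → ℤ → X k → X k → ℂ) (a : Fin N → ℕ) (i : Fin N)
    (q : ℤ × ℤ) (z : {k // k ≠ i} → ℤ × ℤ) (x y : ∀ k, X k) (s : X i) :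
    prodKernel κ a (joinIdx i q z) (Function.update x i s) y =
      (((2 : ℝ) ^ q.1 : ℝ) : ℂ) ^ a i * κ i q.2 q.1 s (y i) * restKernel κ a i z x y := by
  rw [prodKernel, Fintype.prod_eq_mul_prod_subtype_ne _ i, joinIdx_self, Function.update_self,
    restKernel]
  congr 1
  refine Finset.prod_congr rfl fun k _ => ?_
  rw [joinIdx_ne, Function.update_of_ne k.2]

variable [∀ k, MetricSpace (X k)] [∀ k, MeasurableSpace (X k)]
  [∀ k, BorelSpace (X k)] {Ω : Fin N → Type*} [∀ k, MeasurableSpace (Ω k)]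
  {ν : ∀ k, Measure (Ω k)} {μ : ∀ k, Measure (X k)}
  {U : ∀ k, Lp ℂ 2 (ν k) ≃ₗᵢ[ℂ] Lp ℂ 2 (μ k)} {g : ∀ k, Ω k → ℝ}
  {d : Fin N → ℝ} {κ : ∀ k, ℤ → ℤ → X k → X k → ℂ} {p : (Fin N → ℝ) → ℂ}

/-- Coefficient decay of order max(L, L₀) is used twice: L powers are kept for the distinguished
index q, and L₀ powers cancel the growth of the other kernels. Neither x_i nor y_i is involved. -/
theorem exists_rest_bound (hκ : ∀ k, IsKernelFamily (U k) (g k) (d k) (κ k)) (hd : ∀ k, 0 < d k)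
    (hp : IsSymbolZero p) (a : Fin N → ℕ) (i : Fin N) {x y : ∀ k, X k}
    (hxy : ∀ k, k ≠ i → x k ≠ y k) (L : ℕ) :
    ∃ (C B : ℝ) (W : ({k // k ≠ i} → ℤ × ℤ) → ℝ), 0 ≤ C ∧ SumBdd W B ∧ ∀ q z,
      ‖symCoeff p a (joinIdx i q z) * restKernel κ a i z x y‖ ≤
        C * (((1 + |(q.2 : ℝ)|) ^ L)⁻¹ * W z) := by
  obtain ⟨L₀, w, B, _, h1, h2⟩ := exists_prod_bound hκ hd a
  obtain ⟨C, hC, h3⟩ := exists_norm_symCoeff_le hp a (max L L₀)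
  have hρ : ∀ k : {k // k ≠ i}, 0 < dist (x k) (y k) ^ (d k + 1) := fun k =>
    Real.rpow_pos_of_pos (dist_pos.2 (hxy k k.2)) _
  have h4 := SumBdd.pi fun k : {k // k ≠ i} => h1 k _ (hρ k)
  refine ⟨C, _, _, hC, h4, fun q z => ?_⟩
  rw [norm_mul]
  have h5 := h3 (joinIdx i q z)
  rw [Fintype.prod_eq_mul_prod_subtype_ne _ i, joinIdx_self] at h5
  simp only [joinIdx_ne] at h5
  have h6 : ‖restKernel κ a i z x y‖ ≤ ∏ k : {k // k ≠ i}, ((1 + |((z k).2 : ℝ)|) ^ L₀ *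
      w k (dist (x k) (y k) ^ (d k + 1)) (z k)) := by
    rw [restKernel, norm_prod]
    exact Finset.prod_le_prod (fun _ _ => norm_nonneg _) fun k _ =>
      h2 k (z k) _ _ (hxy k k.2)
  refine (mul_le_mul h5 h6 (norm_nonneg _) (by positivity)).trans ?_
  rw [mul_assoc C, mul_assoc, ← Finset.prod_mul_distrib]
  refine mul_le_mul_of_nonneg_left (mul_le_mul ?_ ?_ ?_ (by positivity)) hC
  · exact inv_anti₀ (by positivity) (pow_le_pow_right₀ (by linarith [abs_nonneg (q.2 : ℝ)])
      (le_max_left _ _))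
  · refine Finset.prod_le_prod (fun k _ => ?_) fun k _ => ?_
    · have := (h1 k _ (hρ k)).1 (z k)
      positivity
    · rw [← mul_assoc]
      refine mul_le_of_le_one_left ((h1 k _ (hρ k)).1 (z k)) ?_
      rw [inv_mul_le_one₀ (by positivity)]
      exact pow_le_pow_right₀ (by linarith [abs_nonneg ((z k).2 : ℝ)]) (le_max_right _ _)
  · refine Finset.prod_nonneg fun k _ => ?_
    have := (h1 k _ (hρ k)).1 (z k)
    positivity

open IsKernelFamily

theorem isCoeff_lineCoeff (hκ : ∀ k, IsKernelFamily (U k) (g k) (d k) (κ k)) (hd : ∀ k, 0 < d k)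
    (hp : IsSymbolZero p) (a : Fin N → ℕ) (i : Fin N) {x y : ∀ k, X k}
    (hxy : ∀ k, k ≠ i → x k ≠ y k) : IsCoeff (a i) (lineCoeff p κ a i x y) := by
  intro L
  obtain ⟨C, B, W, hC, hW, h⟩ := exists_rest_bound hκ hd hp a i hxy L
  refine ⟨C * B, mul_nonneg hC hW.nonneg, fun j m => ?_⟩
  rw [lineCoeff, norm_mul, norm_pow, norm_neg, norm_one, one_pow, one_mul, norm_mul, norm_pow,
    Complex.norm_real, Real.norm_of_nonneg (by positivity)]
  have h1 := hW.summable.mul_left (C * ((1 + |(m : ℝ)|) ^ L)⁻¹)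
  have h2 : ‖∑' z, symCoeff p a (joinIdx i (j, m) z) * restKernel κ a i z x y‖ ≤
      C * ((1 + |(m : ℝ)|) ^ L)⁻¹ * B := by
    refine (tsum_of_norm_bounded h1.hasSum fun z => ?_).trans ?_
    · rw [mul_assoc]; exact h (j, m) z
    · rw [tsum_mul_left]
      exact mul_le_mul_of_nonneg_left hW.tsum_le (by positivity)
  calc _ ≤ ((2 : ℝ) ^ j) ^ a i * (C * ((1 + |(m : ℝ)|) ^ L)⁻¹ * B) := by gcongr
    _ = _ := by ring

/-- The sums over m and over the remaining indices are interchanged by absolute convergence,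
exposing the inner sum to which `exists_hasSum_symCoeff_update` applies. -/
theorem scaleSym_lineCoeff (hκ : ∀ k, IsKernelFamily (U k) (g k) (d k) (κ k)) (hd : ∀ k, 0 < d k)
    (hp : IsSymbolZero p) (a : Fin N → ℕ) (i : Fin N) {x y : ∀ k, X k}
    (hxy : ∀ k, k ≠ i → x k ≠ y k) (j : ℤ) (l : ℝ) :
    scaleSym (lineCoeff p κ a i x y) j l =
      (-1) ^ (∑ k, a k) * ((((2 : ℝ) ^ j : ℝ) : ℂ) ^ a i *
        ∑' z, restKernel κ a i z x y * ∑' m : ℤ, symCoeff p a (joinIdx i (j, m) z) *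
          chebSym 1 m.natAbs (2 ^ (-j)) l) := by
  obtain ⟨C, B, W, hC, hW, h⟩ := exists_rest_bound hκ hd hp a i hxy 2
  obtain ⟨B', hB'⟩ := exists_sumBdd_inv_sq
  have hsum : Summable (Function.uncurry fun (m : ℤ) (z : {k // k ≠ i} → ℤ × ℤ) =>
      symCoeff p a (joinIdx i (j, m) z) * restKernel κ a i z x y *
        chebSym 1 m.natAbs (2 ^ (-j)) l) := by
    refine Summable.of_norm_bounded ((hB'.prod hW).const_mul hC).summable ?_
    rintro ⟨m, z⟩
    rw [Function.uncurry_apply_pair, norm_mul]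
    exact (mul_le_of_le_one_right (norm_nonneg _) (norm_chebSym_le _ _ (by positivity) _)).trans
      (h (j, m) z)
  have h1 : scaleSym (lineCoeff p κ a i x y) j l = ∑' m : ℤ, (-1) ^ (∑ k, a k) *
      ((((2 : ℝ) ^ j : ℝ) : ℂ) ^ a i * ∑' z, symCoeff p a (joinIdx i (j, m) z) *
        restKernel κ a i z x y * chebSym 1 m.natAbs (2 ^ (-j)) l) := by
    refine tsum_congr fun m => ?_
    rw [lineCoeff, tsum_mul_right]
    ring
  rw [h1, tsum_mul_left, tsum_mul_left, ← hsum.tsum_comm]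
  congr 2
  refine tsum_congr fun z => ?_
  rw [← tsum_mul_left]
  exact tsum_congr fun m => by ring

/-- The inner sum gains 2^{-j}l and the prefactor gains 2^j, so together they give l; the sign comes
from (-1)^{|a|+1}, as Δ has symbol -l. -/
theorem scaleSym_lineCoeff_add_single (hκ : ∀ k, IsKernelFamily (U k) (g k) (d k) (κ k))
    (hd : ∀ k, 0 < d k) (hp : IsSymbolZero p) (a : Fin N → ℕ) (i : Fin N) {x y : ∀ k, X k}
    (hxy : ∀ k, k ≠ i → x k ≠ y k) (j : ℤ) {l : ℝ} (hl : 0 < l) :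
    scaleSym (lineCoeff p κ (a + Pi.single i 1) i x y) j l =
      -(l * scaleSym (lineCoeff p κ a i x y) j l) := by
  rw [scaleSym_lineCoeff hκ hd hp _ i hxy, scaleSym_lineCoeff hκ hd hp _ i hxy]
  have h1 : ∀ z, restKernel κ (a + Pi.single i 1) i z x y = restKernel κ a i z x y := by
    intro z
    refine Finset.prod_congr rfl fun k _ => ?_
    have : (a + Pi.single i 1 : Fin N → ℕ) k = a k := by simp [k.2]
    rw [this]
  have h2 : ∀ z, ∑' m : ℤ, symCoeff p (a + Pi.single i 1) (joinIdx i (j, m) z) *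
      chebSym 1 m.natAbs (2 ^ (-j)) l = (2 ^ (-j) * l : ℝ) *
        ∑' m : ℤ, symCoeff p a (joinIdx i (j, m) z) * chebSym 1 m.natAbs (2 ^ (-j)) l := by
    intro z
    obtain ⟨W, hW1, hW2⟩ := exists_hasSum_symCoeff_update hp a i j (joinIdx i (j, 0) z) hl
    simp only [update_joinIdx] at hW1 hW2
    rw [hW1.tsum_eq, hW2.tsum_eq]
  have h3 : ∑ k, (a + Pi.single i 1 : Fin N → ℕ) k = ∑ k, a k + 1 := by
    simp [Finset.sum_add_distrib]
  have h4 : (a + Pi.single i 1 : Fin N → ℕ) i = a i + 1 := by simp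
  have h5 : ((((2 : ℝ) ^ j : ℝ) : ℂ)) * ((2 ^ (-j) * l : ℝ) : ℂ) = l := by
    rw [← Complex.ofReal_mul, ← mul_assoc, ← zpow_add₀ two_ne_zero]
    simp
  simp only [h1, h2, h3, h4, mul_left_comm _ (((2 ^ (-j) * l : ℝ) : ℂ)), tsum_mul_left, pow_succ]
  rw [← h5]
  ring

theorem tsum_joinIdx {f : (Fin N → ℤ × ℤ) → ℂ} (hf : Summable f) (i : Fin N) :
    ∑' z, f z = ∑' q, ∑' z, f (joinIdx i q z) := by
  have hf' : Summable fun c : (ℤ × ℤ) × ({k // k ≠ i} → ℤ × ℤ) => f (joinIdx i c.1 c.2) :=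
    (Equiv.funSplitAt i (ℤ × ℤ)).symm.summable_iff.2 hf
  rw [← (Equiv.funSplitAt i (ℤ × ℤ)).symm.tsum_eq f]
  exact hf'.tsum_prod

/-- Grouping the series by the i-th index leaves a one-variable series whose coefficients do not
depend on s, the form handled by `isLocalLaplacian_slice`. -/
theorem derivKernel_update (hκ : ∀ k, IsKernelFamily (U k) (g k) (d k) (κ k)) (hd : ∀ k, 0 < d k)
    (hp : IsSymbolZero p) (a : Fin N → ℕ) (i : Fin N) {x y : ∀ k, X k}
    (hxy : OffDiag x y) {s : X i} (hs : s ≠ y i) :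
    derivKernel p κ a (Function.update x i s) y =
      ∑' q : ℤ × ℤ, lineCoeff p κ a i x y q * κ i q.2 q.1 s (y i) := by
  have hoff : OffDiag (Function.update x i s) y := fun k => by
    rcases eq_or_ne k i with rfl | hk
    · simpa using hs
    · simpa [hk] using hxy k
  obtain ⟨C, _, hC⟩ := exists_sumBdd_prodKernel hκ hd hp a
  have hsum := (hC _ _ hoff).summable.of_norm
  rw [derivKernel, if_pos hoff, tsum_joinIdx hsum i, ← tsum_mul_left]
  refine tsum_congr fun q => ?_
  have h1 : ∀ z, symCoeff p a (joinIdx i q z) *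
      prodKernel κ a (joinIdx i q z) (Function.update x i s) y =
      ((((2 : ℝ) ^ q.1 : ℝ) : ℂ) ^ a i * κ i q.2 q.1 s (y i)) *
        (symCoeff p a (joinIdx i q z) * restKernel κ a i z x y) := by
    intro z
    rw [prodKernel_joinIdx κ a i q z x y s]
    ring
  simp only [h1, tsum_mul_left]
  rw [lineCoeff]
  ring

theorem isLocalLaplacian_derivKernel (hκ : ∀ k, IsKernelFamily (U k) (g k) (d k) (κ k))
    (hd : ∀ k, 0 < d k) (hg : ∀ k, Measurable (g k)) (hμ : ∀ k, IsDoubling (μ k))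
    (hp : IsSymbolZero p) {Δ : ∀ k, Lp ℂ 2 (μ k) →ₗ.[ℂ] Lp ℂ 2 (μ k)}
    {E : ∀ k, ProjectionValuedMeasure ℝ (Lp ℂ 2 (μ k))} (hU : ∀ k, Represents (U k) (g k) (E k))
    (hE : ∀ k, (E k).IsSpectralResolution (-(Δ k))) (a : Fin N → ℕ) (i : Fin N) {x y : ∀ k, X k}
    (hxy : OffDiag x y) :
    IsLocalLaplacian (Δ i) {s | s ≠ y i} (fun s => derivKernel p κ a (Function.update x i s) y)
      (fun s => derivKernel p κ (a + Pi.single i 1) (Function.update x i s) y) := by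
  have hxy' : ∀ k, k ≠ i → x k ≠ y k := fun k _ => hxy k
  refine ((hκ i).isLocalLaplacian_slice (hd i) (hg i) (hμ i) (hU i) (hE i)
    (isCoeff_lineCoeff hκ hd hp a i hxy')
    (isCoeff_lineCoeff hκ hd hp (a + Pi.single i 1) i hxy')
    (fun j l hl => scaleSym_lineCoeff_add_single hκ hd hp a i hxy' j hl) (y i)).congr
    isOpen_ne ?_ ?_
  · exact fun s hs => (derivKernel_update hκ hd hp a i hxy hs).symm
  · exact fun s hs => (derivKernel_update hκ hd hp _ i hxy hs).symm

/-- Laplacians in x and in y act in the same way on a symmetric kernel of a multiplier, so only a +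
b matters, and the y-variables reduce to the x-variables by exchanging the points. -/
theorem isSmoothOffDiagWith_derivKernel [∀ k, SecondCountableTopology (X k)]
    (hκ : ∀ k, IsKernelFamily (U k) (g k) (d k) (κ k))
    (hd : ∀ k, 0 < d k) (hg : ∀ k, Measurable (g k)) (hμ : ∀ k, IsDoubling (μ k))
    (hp : IsSymbolZero p) {Δ : ∀ k, Lp ℂ 2 (μ k) →ₗ.[ℂ] Lp ℂ 2 (μ k)}
    {E : ∀ k, ProjectionValuedMeasure ℝ (Lp ℂ 2 (μ k))} (hU : ∀ k, Represents (U k) (g k) (E k))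
    (hE : ∀ k, (E k).IsSpectralResolution (-(Δ k))) :
    IsSmoothOffDiagWith Δ (derivKernel p κ 0) fun a b => derivKernel p κ (a + b) := by
  refine ⟨fun x y _ => by simp, fun a b => measurable_derivKernel hκ hd hp _,
    fun a b i x y hxy => ?_, fun a b j x y hxy => ?_⟩
  · have := isLocalLaplacian_derivKernel hκ hd hg hμ hp hU hE (a + b) i hxy
    rwa [add_right_comm] at this
  · have := isLocalLaplacian_derivKernel hκ hd hg hμ hp hU hE (a + b) j hxy.symm
    simp only [derivKernel_comm hκ _ (Function.update y j _) x] at this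
    rwa [add_assoc] at this

end Slice

/-! ### Assembly of the theorem -/

theorem isBddMeas_indicator_posOrthant {N : ℕ} {p : (Fin N → ℝ) → ℂ} (hp : IsSymbolZero p) :
    IsBddMeas ((posOrthant N).indicator p) := by
  obtain ⟨C, hC0, hC⟩ := exists_norm_scaledPartial_le hp 0
  rw [scaledPartial_zero] at hC
  refine ⟨?_, C, fun l => ?_⟩
  · classical
    have h := hp.1.continuousOn.measurable_piecewise (g := fun _ => 0)
      continuousOn_const measurableSet_posOrthant
    convert h using 1
    ext l
    by_cases hl : l ∈ posOrthant N <;> simp [hl]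
  · by_cases hl : l ∈ posOrthant N
    · simpa [hl] using hC l hl
    · simpa [hl] using hC0

theorem exists_isKernelFamily_of_heatKernel {X : Type*} [MetricSpace X] [MeasurableSpace X]
    [BorelSpace X] {μ : Measure X} (hμ : IsDoubling μ) {Δ : Lp ℂ 2 μ →ₗ.[ℂ] Lp ℂ 2 μ}
    {d γ : ℝ} (hd : 0 < d) (hγ : 0 < γ) {h : ℂ → X → X → ℂ} (hh : IsHeatKernel Δ h)
    (hbound : SubGaussianBound d γ h) :
    ∃ E : ProjectionValuedMeasure ℝ (Lp ℂ 2 μ), E.IsSpectralResolution (-Δ) ∧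
      ∃ ν : Measure (ℕ × ℝ), SigmaFinite ν ∧ ∃ U : Lp ℂ 2 ν ≃ₗᵢ[ℂ] Lp ℂ 2 μ,
        Represents U Prod.snd E ∧ ∃ κ, IsKernelFamily U Prod.snd d κ := by
  have := hμ.sigmaFinite
  have := hμ.secondCountableTopology
  have : Fact ((2 : ℝ≥0∞) ≠ ⊤) := ⟨by norm_num⟩
  obtain ⟨⟨E, hE, hS⟩, -, hreal⟩ := hh
  obtain ⟨ν, hν, U, hU⟩ := E.exists_representation
  obtain ⟨c₁, hc₁, c₂, hc₂, hb⟩ := hbound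
  refine ⟨E, hE, ν, hν, U, hU, ?_⟩
  have H : HeatModel U Prod.snd (fun t : ℝ => h t) d γ c₁ c₂ := by
    refine ⟨measurable_snd, hμ, hd, hγ, hc₁, hc₂, fun t ht => ?_, hb, hreal⟩
    -- The operator that has the heat kernel is specified only by its spectral integral; uniqueness
    -- identifies it with the heat multiplier in the representation.
    obtain ⟨S, hS1, hS2⟩ := hS t (by simpa using ht)
    rwa [hU.eq_of_isIntegralOn measurable_snd measurableSet_Ioi (isBddMeas_heatSym ht.le) hS1]
      at hS2
  exact H.exists_isKernelFamily

theorem isJointMultiplier_specOp {N : ℕ} {X : Fin N → Type*}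
    [∀ k, MetricSpace (X k)] [∀ k, MeasurableSpace (X k)] {μ : ∀ k, Measure (X k)}
    [∀ k, SigmaFinite (μ k)] {Ω : Fin N → Type*} [∀ k, MeasurableSpace (Ω k)]
    {ν : ∀ k, Measure (Ω k)} [∀ k, SigmaFinite (ν k)]
    {Δ : ∀ k, Lp ℂ 2 (μ k) →ₗ.[ℂ] Lp ℂ 2 (μ k)}
    {U : ∀ k, Lp ℂ 2 (ν k) ≃ₗᵢ[ℂ] Lp ℂ 2 (μ k)} {g : ∀ k, Ω k → ℝ}
    (hg : ∀ k, Measurable (g k)) {E : ∀ k, ProjectionValuedMeasure ℝ (Lp ℂ 2 (μ k))}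
    (hE : ∀ k, (E k).IsSpectralResolution (-(Δ k))) (hU : ∀ k, Represents (U k) (g k) (E k))
    {V : Lp ℂ 2 (Measure.pi ν) ≃ₗᵢ[ℂ] Lp ℂ 2 (Measure.pi μ)}
    (hV : ∀ f : ∀ k, Lp ℂ 2 (ν k), V (tensorLp f) = tensorLp fun k => U k (f k))
    {p : (Fin N → ℝ) → ℂ} (hp : IsSymbolZero p) :
    IsJointMultiplier Δ p
      (specOp V fun o => (posOrthant N).indicator p fun k => g k (o k)) := by
  have hG : Measurable fun (o : ∀ k, Ω k) k => g k (o k) :=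
    measurable_pi_lambda _ fun k => (hg k).comp (measurable_pi_apply k)
  exact ⟨E, hE, pvmOfRep V _ hG, isJointResolution_pvmOfRep hV hg hU hG,
    (represents_pvmOfRep V _ hG).isIntegralOn hG measurableSet_posOrthant
      (isBddMeas_indicator_posOrthant hp)⟩

theorem mainTheorem2 {N : ℕ} (hN : 1 ≤ N) {X : Fin N → Type*}
    [∀ k, MetricSpace (X k)] [∀ k, MeasurableSpace (X k)] [∀ k, BorelSpace (X k)]
    (μ : ∀ k, Measure (X k)) (hμ : ∀ k, IsDoubling (μ k))
    (Δ : ∀ k, Lp ℂ 2 (μ k) →ₗ.[ℂ] Lp ℂ 2 (μ k)) (hΔ : ∀ k, IsNegSelfAdjoint (Δ k))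
    (d γ : Fin N → ℝ) (hd : ∀ k, 0 < d k) (hγ : ∀ k, 0 < γ k)
    (h : ∀ k, ℂ → X k → X k → ℂ) (hh : ∀ k, IsHeatKernel (Δ k) (h k))
    (hbound : ∀ k, SubGaussianBound (d k) (γ k) (h k))
    (p : (Fin N → ℝ) → ℂ) (hp : IsSymbolZero p) :
    ∃ T : Lp ℂ 2 (Measure.pi μ) →L[ℂ] Lp ℂ 2 (Measure.pi μ), IsJointMultiplier Δ p T ∧
      ∃ K : (∀ k, X k) → (∀ k, X k) → ℂ, HasOffDiagKernel T K ∧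
        (∃ C : ℝ, ∀ x y, OffDiag x y →
          ‖K x y‖ ≤ C * ∏ k, dist (x k) (y k) ^ (-d k)) ∧
        ∃ D : (Fin N → ℕ) → (Fin N → ℕ) → (∀ k, X k) → (∀ k, X k) → ℂ,
          IsSmoothOffDiagWith Δ K D ∧
          ∀ (i j : Fin N) (β₁ β₂ : ℕ), ∃ C : ℝ, ∀ x y, OffDiag x y →
            ‖D (Pi.single i β₁) (Pi.single j β₂) x y‖ ≤
              C * dist (x i) (y i) ^ (-((β₁ : ℝ) * (d i + 1))) *
                dist (x j) (y j) ^ (-((β₂ : ℝ) * (d j + 1))) *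
                ∏ k, dist (x k) (y k) ^ (-d k) := by
  have := fun k => (hμ k).sigmaFinite
  have := fun k => (hμ k).secondCountableTopology
  choose E hE ν hν U hU κ hκ using fun k =>
    exists_isKernelFamily_of_heatKernel (hμ k) (hd k) (hγ k) (hh k) (hbound k)
  obtain ⟨V, hV⟩ := exists_tensor_isometryEquiv U
  have hg : ∀ _ : Fin N, Measurable (Prod.snd : ℕ × ℝ → ℝ) := fun _ => measurable_snd
  have hT := isJointMultiplier_specOp hg hE hU hV hp
  have hK := hasOffDiagKernel_derivKernel hκ hg hd hp hV
  -- The summed series equals p on the orthant and zero elsewhere, so the operator with the kernel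
  -- is the joint multiplier itself.
  simp only [tsum_symTerm hp] at hK
  refine ⟨_, hT, derivKernel p κ 0, hK, ?_, fun a b => derivKernel p κ (a + b),
    isSmoothOffDiagWith_derivKernel hκ hd hg hμ hp hU hE,
    exists_norm_derivKernel_single_le hκ hd hp⟩
  obtain ⟨C, -, hC⟩ := exists_norm_derivKernel_le hκ hd hp 0
  exact ⟨C, fun x y hxy => by simpa using hC x y hxy⟩

end
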